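/- **Setting.** Let $d,\eta>0$. In the singly periodic case put $\xi=0$; in the doubly periodic case let $\xi\in\mathbb R$ with $\sqrt{\xi^2+\eta^2}\le d$. Let ${\bf l}_{mn}=(md+n\xi,\,n\eta)$ and let $\mathcal C=\{a(d,0)+b(\xi,\eta): a,b\in[-\tfrac12,\tfrac12]\}$ be the unit cell. Let ${\bf s}_j=(x'_j,y'_j)\in\mathcal C$ ($j=1,\dots,N_S$) be sources with real charge vectors $q_j\in\mathbb R^2$ satisfying $\sum_j q_j=0$, and ${\bf t}_l=(x_l,y_l)\in\mathcal C$ ($l=1,\dots,N_T$) targets. The west image cells are $W_1=\{(m,0):m\le-2\}$ (singly periodic) and $W_2=\{(m,n):m\le-4,\ |n|\le1\}$ (doubly periodic). Let ${\bf G}^{(S)}({\bf t})=-\frac1{4\pi}\big(\log|{\bf t}|\,{\bf I}-\frac{{\bf t}\otimes{\bf t}}{|{\bf t}|^2}\big)$ be the Stokeslet and, for $\beta>0$, ${\bf G}^{(MS)}_\beta=(\nabla\otimes\nabla-\Delta{\bf I})\big(-\frac{1}{2\pi\beta^2}[K_0(\beta|{\bf t}|)-\log(1/|{\bf t}|)]\big)$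 the modified Stokeslet. For $i=1,2$, a *west contribution* is a function $u:\mathcal C\to\mathbb R^2$ for which there are vectors $c_\beta\in\mathbb R^2$ independent of ${\bf t}$ with $u({\bf t})=\lim_{\beta\to0^+}\big(c_\beta+\sum_{(m,n)\in W_i}\sum_j{\bf G}^{(MS)}_\beta({\bf t}-{\bf s}_j-{\bf l}_{mn})q_j\big)$ for all ${\bf t}\in\mathcal C$, the series being absolutely convergent for each $\beta>0$. Thus $u$ is determined up to an additive constant vector. Write $e_\lambda=e^{-|\lambda|d}$, $J(\lambda)=\begin{bmatrix}-1&i\,\mathrm{sign}\lambda\\ i\,\mathrm{sign}\lambda&1\end{bmatrix}$ and, for ${\bf t}=(x,y)$, ${\bf s}=(x',y')$, $$k_1({\bf t},{\bf s};\lambda)=\frac1{8\pi}\frac{e_\lambda^2}{1-e_\lambda}e^{-|\lambda|(x-x')+i\lambda(y-y')}\Big\{\frac1{|\lambda|}{\bf I}_2-\Big(x-x'+\frac{2-e_\lambda}{1-e_\lambda}d\Big)J(\lambda)\Big\},$$ $$k_2({\bf t},{\bf s};\lambda)=\frac1{8\pi}\sum_{n=-1}^1\frac{e_\lambda^4}{1-e_\lambda}e^{-|\lambda|(x-x'-n\xi)+i\lambda(y-y'-n\eta)}\Big\{\frac1{|\lambda|}{\bf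 I}_2-\Big(x-x'-n\xi+\frac{4-3e_\lambda}{1-e_\lambda}d\Big)J(\lambda)\Big\}.$$ A quadrature rule of precision $\varepsilon$ for the integrals of $k_i$ over $\lambda\in\mathbb R$ consists of finitely many nodes $\lambda_n\in\mathbb R\setminus\{0\}$ and real weights $w_n$ such that for all ${\bf t},{\bf t}^0,{\bf s},{\bf s}^0\in\mathcal C$ the real part of each entry of $\int_{\mathbb R}\Delta(\lambda)\,d\lambda$ is reproduced by $\sum_n w_n\Delta(\lambda_n)$ with error at most $\varepsilon$, where $\Delta(\lambda)=k_i({\bf t},{\bf s};\lambda)-k_i({\bf t}^0,{\bf s};\lambda)-k_i({\bf t},{\bf s}^0;\lambda)+k_i({\bf t}^0,{\bf s}^0;\lambda)$ (the $\lambda^{-2}$ singularity of $k_i$ cancels in $\Delta$). Given nodes and weights, let ${\bf L}$, ${\bf R}$ be the block matrices with blocks ${\bf L}(l,n)=e^{-|\lambda_n|x_l}e^{i\lambda_ny_l}{\bf I}_2$, ${\bf R}(n,j)=e^{|\lambda_n|x'_j}e^{-i\lambda_ny'_j}{\bf I}_2$, let ${\bf D}_T$, ${\bf D}_S$ be block diagonal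 with blocks $x_l{\bf I}_2$, $x'_j{\bf I}_2$, and let ${\bf D}_{i,a},{\bf D}_{i,b}$ be block diagonal with blocks (writing $\lambda=\lambda_n$, $w=w_n$, $E_\pm=e^{\pm(|\lambda|\xi-i\lambda\eta)}$) $${\bf D}_{1,a}=\frac{w}{8\pi}\frac{e_\lambda^2}{1-e_\lambda}\Big(\frac1{|\lambda|}{\bf I}_2-\frac{2-e_\lambda}{1-e_\lambda}d\,J(\lambda)\Big),\qquad {\bf D}_{1,b}=\frac{w}{8\pi}\frac{e_\lambda^2}{1-e_\lambda}J(\lambda),$$ $${\bf D}_{2,a}=\frac{w}{8\pi}\frac{e_\lambda^4}{1-e_\lambda}\Big([E_-+E_++1]\Big(\frac1{|\lambda|}{\bf I}_2-\frac{4-3e_\lambda}{1-e_\lambda}d\,J(\lambda)\Big)-[E_--E_+]\,\xi\,J(\lambda)\Big),$$ $${\bf D}_{2,b}=\frac{w}{8\pi}\frac{e_\lambda^4}{1-e_\lambda}[E_-+E_++1]\,J(\lambda).$$ Put ${\bf P}_i={\bf L}{\bf D}_{i,a}{\bf R}-{\bf D}_T{\bf L}{\bf D}_{i,b}{\bf R}+{\bf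 L}{\bf D}_{i,b}{\bf R}{\bf D}_S$. **Theorem.** For $i=1$ (singly periodic) and $i=2$ (doubly periodic): 1. For every $\varepsilon>0$ there is a quadrature rule of precision $\varepsilon$ for the integrals of $k_i$; its nodes and weights depend only on $d,\eta,\varepsilon$ (in particular, for $i=2$, one rule serves all admissible $\xi$). 2. A west contribution $u$ exists. For all ${\bf t},{\bf t}^0\in\mathcal C$, $u({\bf t})-u({\bf t}^0)=\sum_{(m,n)\in W_i}\sum_j\big[{\bf G}^{(S)}({\bf t}-{\bf s}_j-{\bf l}_{mn})-{\bf G}^{(S)}({\bf t}^0-{\bf s}_j-{\bf l}_{mn})\big]q_j$ (absolutely convergent sum over $(m,n)$), and $u({\bf t})-u({\bf t}^0)=\int_{\mathbb R}\sum_j\big[k_i({\bf t},{\bf s}_j;\lambda)-k_i({\bf t}^0,{\bf s}_j;\lambda)\big]q_j\,d\lambda$ with integrable integrand. 3. For any finite set of nonzero nodes and weights, the $2\times2$ blocks of ${\bf P}_i$ are ${\bf P}_i(l,j)=\sum_nw_n\,k_i({\bf t}_l,{\bf s}_j;\lambda_n)$. 4. For every rule of precision $\varepsilon$, the real part of ${\bf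 P}_i{\bf q}$ is the west contribution to precision $O(\varepsilon)$: there is a constant vector $c\in\mathbb R^2$, independent of the targets, such that for every choice of targets in $\mathcal C$, each component of $\mathrm{Re}\,({\bf P}_i{\bf q})({\bf t}_l)-u({\bf t}_l)-c$ is at most $\varepsilon\sum_j\|q_j\|_1$ in absolute value, for all $l$. -/

import Mathlib

open Real Set Filter Topology MeasureTheory
open scoped Matrix Kronecker BigOperators

noncomputable section

namespace StokesWest

/-! ### Geometry -/

/-- The unit cell spanned by `e₁ = (d, 0)` and `e₂ = (ξ, η)`, centred at the origin. -/
def cell (d ξ η : ℝ) : Set (ℝ × ℝ) :=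
  {p | ∃ a ∈ Icc (-(1 / 2) : ℝ) (1 / 2), ∃ b ∈ Icc (-(1 / 2) : ℝ) (1 / 2),
    p = a • ((d, 0) : ℝ × ℝ) + b • ((ξ, η) : ℝ × ℝ)}

/-- The lattice vector `m e₁ + n e₂`. -/
def latticeVec (d ξ η : ℝ) (w : ℤ × ℤ) : ℝ × ℝ :=
  ((w.1 : ℝ) * d + (w.2 : ℝ) * ξ, (w.2 : ℝ) * η)

/-- The west image cells of the singly periodic problem: `m ≤ -2`, `n = 0`. -/
def west₁ : Set (ℤ × ℤ) := {w | w.1 ≤ -2 ∧ w.2 = 0}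

/-- The west image cells of the doubly periodic problem: `m ≤ -4`, `n ∈ {-1, 0, 1}`. -/
def west₂ : Set (ℤ × ℤ) := {w | w.1 ≤ -4 ∧ -1 ≤ w.2 ∧ w.2 ≤ 1}

/-! ### Fundamental solutions -/

/-- The Euclidean length of a vector of the plane (`ℝ × ℝ` itself carries the sup norm). -/
def len (p : ℝ × ℝ) : ℝ := √(p.1 ^ 2 + p.2 ^ 2)

/-- The Stokeslet `-(1/4π) (log |t| I - t ⊗ t / |t|²)`. -/
def stokeslet (p : ℝ × ℝ) : Matrix (Fin 2) (Fin 2) ℝ :=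
  (-(1 / (4 * π))) • (Real.log (len p) • (1 : Matrix (Fin 2) (Fin 2) ℝ) -
    (1 / len p ^ 2) • Matrix.vecMulVec ![p.1, p.2] ![p.1, p.2])

/-- The modified Bessel function of the second kind of order zero,
`K₀(z) = ∫₀^∞ exp (-z cosh v) dv` for `z > 0`. -/
def besselK₀ (z : ℝ) : ℝ := ∫ v in Ioi (0 : ℝ), Real.exp (-z * Real.cosh v)

/-- The fundamental solution of the modified biharmonic equation,
`-(1 / 2πβ²) (K₀(β|t|) - log (1/|t|))` at `t = (x, y)`. -/
def modBiharmonic (β x y : ℝ) : ℝ :=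
  -(1 / (2 * π * β ^ 2)) * (besselK₀ (β * len (x, y)) - Real.log (1 / len (x, y)))

/-- The modified Stokeslet `(∇ ⊗ ∇ - Δ I) G_MB`. -/
def modStokeslet (β : ℝ) (p : ℝ × ℝ) : Matrix (Fin 2) (Fin 2) ℝ :=
  let dxx := deriv (fun x => deriv (fun x' => modBiharmonic β x' p.2) x) p.1
  let dyy := deriv (fun y => deriv (fun y' => modBiharmonic β p.1 y') y) p.2
  let dxy := deriv (fun x => deriv (fun y => modBiharmonic β x y) p.2) p.1
  !![-dyy, dxy; dxy, -dxx]

/-! ### The contribution of the west sources -/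

variable {NS NT N : ℕ}

/-- The velocity induced at `t` by the copies of the sources in the single image cell `w`,
for a translation invariant Green's tensor `G`. -/
def imageField (G : ℝ × ℝ → Matrix (Fin 2) (Fin 2) ℝ) (d ξ η : ℝ)
    (s : Fin NS → ℝ × ℝ) (q : Fin NS → Fin 2 → ℝ) (t : ℝ × ℝ) (w : ℤ × ℤ) : Fin 2 → ℝ :=
  ∑ j, G (t - (s j + latticeVec d ξ η w)) *ᵥ q j

/-- `u` is the contribution of the image cells in `W` to the periodizing potential of the
Stokeslet. It is the limit `β → 0⁺` of the corresponding (absolutely convergent) sums of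
modified Stokeslets. As is usual for a zero-mode problem, the limit is taken modulo
constant vectors, that is, after adding a vector `c β` that does not depend on the target. -/
def IsImagePotential (W : Set (ℤ × ℤ)) (d ξ η : ℝ)
    (s : Fin NS → ℝ × ℝ) (q : Fin NS → Fin 2 → ℝ) (u : ℝ × ℝ → Fin 2 → ℝ) : Prop :=
  (∀ β : ℝ, 0 < β → ∀ t ∈ cell d ξ η,
    Summable fun w : W => imageField (modStokeslet β) d ξ η s q t w) ∧
  ∃ c : ℝ → Fin 2 → ℝ, ∀ t ∈ cell d ξ η,
    Tendsto (fun β : ℝ => (∑' w : W, imageField (modStokeslet β) d ξ η s q t w) + c β)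
      (𝓝[>] 0) (𝓝 (u t))

/-! ### The integral representations -/

/-- `sign`, as a complex number. -/
def csgn (lam : ℝ) : ℂ := (Real.sign lam : ℂ)

/-- `exp (-|λ| c)`, as a complex number. -/
def decay (lam c : ℝ) : ℂ := Complex.exp (-((|lam| * c : ℝ) : ℂ))

/-- `exp (i λ c)`. -/
def osc (lam c : ℝ) : ℂ := Complex.exp (Complex.I * ((lam * c : ℝ) : ℂ))

/-- The matrix `[-1, i sign λ; i sign λ, 1]`. -/
def signMat (lam : ℝ) : Matrix (Fin 2) (Fin 2) ℂ :=
  !![-1, Complex.I * csgn lam; Complex.I * csgn lam, 1]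

/-- The integrand of the singly periodic west kernel at target `t` and source `s`. -/
def kernel₁ (d : ℝ) (t s : ℝ × ℝ) (lam : ℝ) : Matrix (Fin 2) (Fin 2) ℂ :=
  ((1 / (8 * π) : ℝ) * (decay lam (2 * d) / (1 - decay lam d)) *
      decay lam (t.1 - s.1) * osc lam (t.2 - s.2)) •
    ((1 / ((|lam| : ℝ) : ℂ)) • (1 : Matrix (Fin 2) (Fin 2) ℂ) -
      (((t.1 - s.1 : ℝ) : ℂ) + (2 - decay lam d) / (1 - decay lam d) * d) • signMat lam)

/-- The integrand of the doubly periodic west kernel at target `t` and source `s`. -/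
def kernel₂ (d ξ η : ℝ) (t s : ℝ × ℝ) (lam : ℝ) : Matrix (Fin 2) (Fin 2) ℂ :=
  ∑ n ∈ Finset.Icc (-1 : ℤ) 1,
    ((1 / (8 * π) : ℝ) * (decay lam (4 * d) / (1 - decay lam d)) *
        decay lam (t.1 - s.1 - n * ξ) * osc lam (t.2 - s.2 - n * η)) •
      ((1 / ((|lam| : ℝ) : ℂ)) • (1 : Matrix (Fin 2) (Fin 2) ℂ) -
        (((t.1 - s.1 - n * ξ : ℝ) : ℂ) +
          (4 - 3 * decay lam d) / (1 - decay lam d) * d) • signMat lam)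

/-! ### Quadrature -/

/-- Nodes `nd` and weights `wt` of a quadrature rule of precision `ε` for the integrals over `ℝ`
of the kernel integrand `k`, uniformly for targets and sources in `C`. The integrand has a
`λ⁻²` singularity at the origin; what is integrated is its combination for a neutral
pair of sources `s, s₀` and the difference of the targets `t, t₀`, where it cancels. -/
def IsQuadrature (C : Set (ℝ × ℝ)) (k : ℝ × ℝ → ℝ × ℝ → ℝ → Matrix (Fin 2) (Fin 2) ℂ)
    (ε : ℝ) (wt nd : Fin N → ℝ) : Prop :=
  (∀ n, nd n ≠ 0) ∧
  ∀ t ∈ C, ∀ t₀ ∈ C, ∀ s ∈ C, ∀ s₀ ∈ C, ∀ a b : Fin 2,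
    |(∑ n, (wt n : ℂ) * (k t s (nd n) - k t₀ s (nd n) - k t s₀ (nd n) + k t₀ s₀ (nd n)) a b).re -
      (∫ lam : ℝ, (k t s lam - k t₀ s lam - k t s₀ lam + k t₀ s₀ lam) a b).re| ≤ ε

/-! ### The factors. Block matrices are indexed by (component, block number). -/

/-- `L(l, n) = exp (-|λₙ| x_l) exp (i λₙ y_l) I₂`. -/
def Lmat (T : Fin NT → ℝ × ℝ) (nd : Fin N → ℝ) : Matrix (Fin 2 × Fin NT) (Fin 2 × Fin N) ℂ :=
  (1 : Matrix (Fin 2) (Fin 2) ℂ) ⊗ₖ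
    Matrix.of fun l n => decay (nd n) (T l).1 * osc (nd n) (T l).2

/-- `R(n, j) = exp (|λₙ| x'_j) exp (-i λₙ y'_j) I₂`. -/
def Rmat (s : Fin NS → ℝ × ℝ) (nd : Fin N → ℝ) : Matrix (Fin 2 × Fin N) (Fin 2 × Fin NS) ℂ :=
  (1 : Matrix (Fin 2) (Fin 2) ℂ) ⊗ₖ
    Matrix.of fun n j => decay (nd n) (-(s j).1) * osc (nd n) (-(s j).2)

/-- The block diagonal matrix with blocks `x_l I₂`; this is `D_T` for targets, `D_S` for sources. -/
def Xmat {M : ℕ} (p : Fin M → ℝ × ℝ) : Matrix (Fin 2 × Fin M) (Fin 2 × Fin M) ℂ :=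
  Matrix.blockDiagonal fun l => ((p l).1 : ℂ) • (1 : Matrix (Fin 2) (Fin 2) ℂ)

/-- `D_{1,a}`. -/
def D₁a (d : ℝ) (wt nd : Fin N → ℝ) : Matrix (Fin 2 × Fin N) (Fin 2 × Fin N) ℂ :=
  Matrix.blockDiagonal fun n =>
    ((wt n / (8 * π) : ℝ) * (decay (nd n) (2 * d) / (1 - decay (nd n) d))) •
      ((1 / ((|nd n| : ℝ) : ℂ)) • (1 : Matrix (Fin 2) (Fin 2) ℂ) -
        ((2 - decay (nd n) d) / (1 - decay (nd n) d) * d) • signMat (nd n))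

/-- `D_{1,b}`. -/
def D₁b (d : ℝ) (wt nd : Fin N → ℝ) : Matrix (Fin 2 × Fin N) (Fin 2 × Fin N) ℂ :=
  Matrix.blockDiagonal fun n =>
    ((wt n / (8 * π) : ℝ) * (decay (nd n) (2 * d) / (1 - decay (nd n) d))) • signMat (nd n)

/-- `exp (-|λ| ξ + i λ η)`. -/
def shiftW (ξ η lam : ℝ) : ℂ := decay lam ξ * osc lam η

/-- `exp (|λ| ξ - i λ η)`. -/
def shiftE (ξ η lam : ℝ) : ℂ := decay lam (-ξ) * osc lam (-η)

/-- `D_{2,a}`. -/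
def D₂a (d ξ η : ℝ) (wt nd : Fin N → ℝ) : Matrix (Fin 2 × Fin N) (Fin 2 × Fin N) ℂ :=
  Matrix.blockDiagonal fun n =>
    ((wt n / (8 * π) : ℝ) * (decay (nd n) (4 * d) / (1 - decay (nd n) d))) •
      ((shiftW ξ η (nd n) + shiftE ξ η (nd n) + 1) •
          ((1 / ((|nd n| : ℝ) : ℂ)) • (1 : Matrix (Fin 2) (Fin 2) ℂ) -
            ((4 - 3 * decay (nd n) d) / (1 - decay (nd n) d) * d) • signMat (nd n)) -
        ((shiftW ξ η (nd n) - shiftE ξ η (nd n)) * ξ) • signMat (nd n))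

/-- `D_{2,b}`. -/
def D₂b (d ξ η : ℝ) (wt nd : Fin N → ℝ) : Matrix (Fin 2 × Fin N) (Fin 2 × Fin N) ℂ :=
  Matrix.blockDiagonal fun n =>
    ((wt n / (8 * π) : ℝ) * (decay (nd n) (4 * d) / (1 - decay (nd n) d)) *
      (shiftW ξ η (nd n) + shiftE ξ η (nd n) + 1)) • signMat (nd n)

/-- The singly periodic west operator `L D_{1,a} R - D_T L D_{1,b} R + L D_{1,b} R D_S`. -/
def P₁ (d : ℝ) (T : Fin NT → ℝ × ℝ) (s : Fin NS → ℝ × ℝ) (wt nd : Fin N → ℝ) :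
    Matrix (Fin 2 × Fin NT) (Fin 2 × Fin NS) ℂ :=
  Lmat T nd * D₁a d wt nd * Rmat s nd - Xmat T * Lmat T nd * D₁b d wt nd * Rmat s nd +
    Lmat T nd * D₁b d wt nd * Rmat s nd * Xmat s

/-- The doubly periodic west operator `L D_{2,a} R - D_T L D_{2,b} R + L D_{2,b} R D_S`. -/
def P₂ (d ξ η : ℝ) (T : Fin NT → ℝ × ℝ) (s : Fin NS → ℝ × ℝ) (wt nd : Fin N → ℝ) :
    Matrix (Fin 2 × Fin NT) (Fin 2 × Fin NS) ℂ :=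
  Lmat T nd * D₂a d ξ η wt nd * Rmat s nd - Xmat T * Lmat T nd * D₂b d ξ η wt nd * Rmat s nd +
    Lmat T nd * D₂b d ξ η wt nd * Rmat s nd * Xmat s

/-- The charge vector, stacked as a complex vector that block matrices act on. -/
def stack (q : Fin NS → Fin 2 → ℝ) : Fin 2 × Fin NS → ℂ := fun p => (q p.2 p.1 : ℂ)

end StokesWest

end

/-! East of its source the Stokeslet is, up to a constant, a superposition over `λ` of the
evanescent waves `exp (-|λ| x + i λ y)` with symbol `(1/8π) (I/|λ| - x J(λ))`. The constant diverges
because of the singularity at `λ = 0`, so only differences have a meaning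
(`stokeslet_sub_stokeslet`). For fixed `λ` the images in one row contribute a geometric and an
arithmetic-geometric series in `exp (-|λ| d)`, and their sum is the kernel (`hasSum_symb`).

Interchanging the lattice sum and the integral rests on neutrality. Since the charges add up to
zero, a source at the origin can be subtracted from each source, so a difference between two targets
becomes a mixed second difference of the Green's tensor. A plane wave is a character, so its second
difference gains a factor `λ²`. This removes the singularity and bounds a cell at distance `X` by a
multiple of `exp (-|λ| X / 2) / X` (`norm_dd_symb_le`). The integral is `O(1/X²)`, which is summable
over a finite number of rows (`hasSum_dd_stokeslet`).

For the limit `β → 0⁺`, rotation invariance and the substitution `λ = β sinh v` represent `K₀` by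
waves of decay rate `√(λ² + β²)` (`besselK₀_eq_superpos`). The modified Stokeslet is then `β⁻²`
times the difference of one symbol at the rates `√(λ² + β²)` and `|λ|`. This is a difference
quotient in the squared rate, and the derivative there is half the Stokeslet symbol
(`hasDerivAt_biSymb`). The mean value inequality gives the same `O(1/X²)` bound uniformly in `β`,
and dominated convergence, in `λ` and then over the cells, gives the limit
(`tendsto_tsum_imageField_sub`).

Quadrature rules exist by a soft argument. The integrand is a Bochner integrable map from `λ ≠ 0` to
the continuous functions on the compact space of configurations, shear included. Its integral lies
in the closed span of its values, and an element of the span close to it in the sup norm is a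
uniform rule (`exists_uniform_quadrature`). The factorization only uses that exponentials separate
targets from sources, while `x - x'` splits into a row and a column scaling. -/

noncomputable section

namespace StokesWest

/-! ### Plane waves -/

/-- The evanescent plane wave `exp (-ν x + i λ y)`. -/
def wave (ν lam : ℝ) (p : ℝ × ℝ) : ℂ :=
  Complex.exp (-((ν * p.1 : ℝ) : ℂ) + Complex.I * ((lam * p.2 : ℝ) : ℂ))

lemma norm_wave (ν lam : ℝ) (p : ℝ × ℝ) : ‖wave ν lam p‖ = Real.exp (-(ν * p.1)) := by
  simp [wave, Complex.norm_exp]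

lemma wave_add (ν lam : ℝ) (p q : ℝ × ℝ) : wave ν lam (p + q) = wave ν lam p * wave ν lam q := by
  rw [wave, wave, wave, ← Complex.exp_add]
  congr 1
  simp only [Prod.fst_add, Prod.snd_add]
  push_cast
  ring

lemma decay_mul_osc (lam x y : ℝ) : decay lam x * osc lam y = wave |lam| lam (x, y) := by
  rw [decay, osc, wave, Complex.exp_add]

lemma measurable_wave {ν : ℝ → ℝ} (hν : Measurable ν) (p : ℝ × ℝ) :
    Measurable fun lam => wave (ν lam) lam p := by
  unfold wave
  fun_prop

lemma integrable_exp_neg_mul_abs {a : ℝ} (ha : 0 < a) :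
    Integrable fun lam : ℝ => Real.exp (-(|lam| * a)) := by
  rw [← integrableOn_univ, ← Iic_union_Ioi (a := (0 : ℝ))]
  refine IntegrableOn.union ?_ ?_
  · refine (integrableOn_exp_mul_Iic ha 0).congr_fun ?_ measurableSet_Iic
    intro x hx
    simp only [abs_of_nonpos (show x ≤ 0 from hx)]
    ring_nf
  · refine (integrableOn_exp_mul_Ioi (a := -a) (by linarith) 0).congr_fun ?_ measurableSet_Ioi
    intro x hx
    simp only [abs_of_pos (show 0 < x from hx)]
    ring_nf

lemma integral_exp_neg_mul_abs {a : ℝ} (ha : 0 < a) :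
    ∫ lam : ℝ, Real.exp (-(|lam| * a)) = 2 / a := by
  have h := integral_comp_abs (f := fun x => Real.exp (-(x * a)))
  rw [h]
  have := integral_exp_mul_Ioi (a := -a) (by linarith) 0
  have h2 : ∫ x in Ioi (0 : ℝ), Real.exp (-(x * a)) = ∫ x in Ioi (0 : ℝ), Real.exp (-a * x) := by
    congr 1; ext x; ring_nf
  rw [h2, this]
  simp
  field_simp

/-- Used to absorb powers of a decay rate into a fraction of the exponential decay. -/
lemma le_mul_exp {x a : ℝ} (ha : 0 < a) : x ≤ 1 / a * Real.exp (x * a) := by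
  have := Real.add_one_le_exp (x * a)
  rw [div_mul_eq_mul_div, le_div_iff₀ ha]
  linarith

/-- Differentiation of a superposition of plane waves along a curve in the right half plane. -/
theorem hasDerivAt_integral_wave {μ : ℝ → ℝ} {c w : ℝ → ℂ} (hμ : Measurable μ)
    (hμ' : ∀ lam, |lam| ≤ μ lam) (hc : Measurable c) (hw : Measurable w) {B : ℝ}
    (hB : ∀ lam, ‖c lam‖ * μ lam ≤ B * (1 + μ lam)) {x y x' y' : ℝ → ℝ} {D t₀ : ℝ}
    (hx : ∀ t, HasDerivAt x (x' t) t) (hy : ∀ t, HasDerivAt y (y' t) t)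
    (hx' : ∀ t, |x' t| ≤ D) (hy' : ∀ t, |y' t| ≤ D) (h₀ : 0 < x t₀)
    (hint : Integrable fun lam => c lam * (wave (μ lam) lam (x t₀, y t₀) - w lam)) :
    (Integrable fun lam => c lam * ((-(μ lam : ℂ) * x' t₀ + Complex.I * lam * y' t₀) *
        wave (μ lam) lam (x t₀, y t₀))) ∧
    HasDerivAt (fun t => ∫ lam, c lam * (wave (μ lam) lam (x t, y t) - w lam))
      (∫ lam, c lam * ((-(μ lam : ℂ) * x' t₀ + Complex.I * lam * y' t₀) *
        wave (μ lam) lam (x t₀, y t₀))) t₀ := by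
  have hcont : ContinuousAt x t₀ := (hx t₀).continuousAt
  have hB0 : 0 ≤ B := by
    have h := hB 0
    have h0 : 0 ≤ μ 0 := by simpa using hμ' 0
    by_contra hneg
    have : B * (1 + μ 0) < 0 := mul_neg_of_neg_of_pos (by linarith) (by linarith)
    have : 0 ≤ ‖c 0‖ * μ 0 := by positivity
    linarith
  have hD0 : 0 ≤ D := (abs_nonneg _).trans (hx' t₀)
  -- The reference `w` makes the integral converge when `c` is singular at `0`; it does not depend
  -- on `t`, so it drops out of the derivative. Near `t₀` the abscissa stays above `x t₀ / 2`. Half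
  -- of that decay absorbs the factor `1 + μ`, the other half, `exp (-|λ| x t₀ / 4)`, remains as the
  -- integrable bound.
  have hs : {t | x t₀ / 2 < x t} ∈ 𝓝 t₀ := hcont.eventually (lt_mem_nhds (by linarith))
  refine hasDerivAt_integral_of_dominated_loc_of_deriv_le hs
    (F' := fun t lam => c lam * ((-(μ lam : ℂ) * x' t + Complex.I * lam * y' t) *
        wave (μ lam) lam (x t, y t)))
    (bound := fun lam => 2 * B * D * (1 + 1 / (x t₀ / 4)) * Real.exp (-(|lam| * (x t₀ / 4))))
    ?_ hint ?_ ?_ ?_ ?_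
  · refine Eventually.of_forall fun t => Measurable.aestronglyMeasurable ?_
    exact hc.mul ((measurable_wave hμ _).sub hw)
  · refine Measurable.aestronglyMeasurable ?_
    refine hc.mul (Measurable.mul ?_ (measurable_wave hμ _))
    fun_prop
  · refine Eventually.of_forall fun lam t ht => ?_
    have hm : 0 ≤ μ lam := (abs_nonneg _).trans (hμ' lam)
    rw [norm_mul, norm_mul, norm_wave]
    have h1 : ‖-(μ lam : ℂ) * x' t + Complex.I * lam * y' t‖ ≤ μ lam * (2 * D) := by
      refine (norm_add_le _ _).trans ?_
      simp only [norm_mul, norm_neg, Complex.norm_real, Complex.norm_I, one_mul, Real.norm_eq_abs,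
        abs_of_nonneg hm]
      have := mul_le_mul_of_nonneg_left (hx' t) hm
      have := mul_le_mul (hμ' lam) (hy' t) (abs_nonneg _) hm
      linarith
    have h2 : Real.exp (-(μ lam * x t)) ≤ Real.exp (-(μ lam * (x t₀ / 4))) * Real.exp (-(μ lam * (x t₀ / 4))) := by
      rw [← Real.exp_add]
      apply Real.exp_le_exp.2
      have := mul_le_mul_of_nonneg_left (le_of_lt ht) hm
      linarith
    have h3 : Real.exp (-(μ lam * (x t₀ / 4))) ≤ Real.exp (-(|lam| * (x t₀ / 4))) := by
      apply Real.exp_le_exp.2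
      have := mul_le_mul_of_nonneg_right (hμ' lam) (show 0 ≤ x t₀ / 4 by positivity)
      linarith
    have h4 : (1 + μ lam) * Real.exp (-(μ lam * (x t₀ / 4))) ≤ 1 + 1 / (x t₀ / 4) := by
      have e1 : Real.exp (-(μ lam * (x t₀ / 4))) ≤ 1 := by
        rw [Real.exp_le_one_iff]
        have : 0 ≤ μ lam * (x t₀ / 4) := by positivity
        linarith
      have e2 : μ lam * Real.exp (-(μ lam * (x t₀ / 4))) ≤ 1 / (x t₀ / 4) := by
        have := le_mul_exp (x := μ lam) (show 0 < x t₀ / 4 by positivity)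
        rw [Real.exp_neg, ← div_eq_mul_inv, div_le_iff₀ (Real.exp_pos _)]
        exact this
      linarith
    calc ‖c lam‖ * (‖-(μ lam : ℂ) * x' t + Complex.I * lam * y' t‖ * Real.exp (-(μ lam * x t)))
        ≤ ‖c lam‖ * ((μ lam * (2 * D)) * (Real.exp (-(μ lam * (x t₀ / 4))) *
            Real.exp (-(μ lam * (x t₀ / 4))))) := by gcongr
      _ = (‖c lam‖ * μ lam) * (2 * D * (Real.exp (-(μ lam * (x t₀ / 4))) *
            Real.exp (-(μ lam * (x t₀ / 4))))) := by ring
      _ ≤ (B * (1 + μ lam)) * (2 * D * (Real.exp (-(μ lam * (x t₀ / 4))) *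
            Real.exp (-(μ lam * (x t₀ / 4))))) := by
          apply mul_le_mul_of_nonneg_right (hB lam); positivity
      _ = 2 * B * D * ((1 + μ lam) * Real.exp (-(μ lam * (x t₀ / 4)))) *
            Real.exp (-(μ lam * (x t₀ / 4))) := by ring
      _ ≤ 2 * B * D * (1 + 1 / (x t₀ / 4)) * Real.exp (-(|lam| * (x t₀ / 4))) := by gcongr
  · exact (integrable_exp_neg_mul_abs (by positivity)).const_mul _
  · refine Eventually.of_forall fun lam t _ => ?_
    have h1 : HasDerivAt (fun t : ℝ => ((x t : ℝ) : ℂ)) (x' t : ℂ) t := (hx t).ofReal_comp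
    have h2 : HasDerivAt (fun t : ℝ => ((y t : ℝ) : ℂ)) (y' t : ℂ) t := (hy t).ofReal_comp
    have h3 := (((h1.const_mul (-(μ lam : ℂ))).add (h2.const_mul (Complex.I * lam))).cexp.sub_const
      (w lam)).const_mul (c lam)
    have e : ∀ t, wave (μ lam) lam (x t, y t) =
        Complex.exp (-(μ lam : ℂ) * x t + Complex.I * lam * y t) := fun t => by
      rw [wave]; congr 1; push_cast; ring
    simp only [e]
    refine h3.congr_deriv ?_
    show c lam * (Complex.exp (-(μ lam : ℂ) * x t + Complex.I * lam * y t) * _) = _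
    ring

/-! ### Laplace-type integrals over the line -/

/-- Folding the line at `0`, where `|λ|` has its kink, leaves two complex Laplace transforms. -/
lemma integral_eq_add_integral_comp_neg {f : ℝ → ℂ} (hf : Integrable f) :
    ∫ x, f x = (∫ x in Ioi (0 : ℝ), f x) + ∫ x in Ioi (0 : ℝ), f (-x) := by
  rw [integral_comp_neg_Ioi, neg_zero, add_comm]
  exact (intervalIntegral.integral_Iic_add_Ioi hf.integrableOn hf.integrableOn).symm

lemma integrable_wave_abs {p : ℝ × ℝ} (hp : 0 < p.1) :
    Integrable fun lam => wave |lam| lam p := by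
  refine (integrable_exp_neg_mul_abs hp).mono' (measurable_wave measurable_norm p).aestronglyMeasurable ?_
  exact Eventually.of_forall fun lam => (norm_wave _ _ _).le

lemma wave_abs_of_pos {lam : ℝ} (h : 0 < lam) (p : ℝ × ℝ) :
    wave |lam| lam p = Complex.exp (-(p.1 - Complex.I * p.2) * lam) := by
  rw [wave, abs_of_pos h]; congr 1; push_cast; ring

lemma wave_abs_neg_of_pos {lam : ℝ} (h : 0 < lam) (p : ℝ × ℝ) :
    wave |-lam| (-lam) p = Complex.exp (-(p.1 + Complex.I * p.2) * lam) := by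
  rw [wave, abs_neg, abs_of_pos h]; congr 1; push_cast; ring

lemma integral_cexp_neg {a : ℂ} (ha : 0 < a.re) :
    ∫ x in Ioi (0 : ℝ), Complex.exp (-a * x) = 1 / a := by
  have := integral_exp_mul_complex_Ioi (a := -a) (by simpa) 0
  rw [this]; simp

lemma sq_add_sq_pos {p : ℝ × ℝ} (hp : 0 < p.1) : 0 < p.1 ^ 2 + p.2 ^ 2 := by positivity

lemma one_div_conj_eq (p : ℝ × ℝ) (hp : 0 < p.1) :
    1 / ((p.1 : ℂ) - Complex.I * p.2) = (p.1 + Complex.I * p.2) / (p.1 ^ 2 + p.2 ^ 2) := by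
  have h2 : ((p.1 : ℂ) ^ 2 + (p.2 : ℂ) ^ 2) = (p.1 - Complex.I * p.2) * (p.1 + Complex.I * p.2) := by
    ring_nf; rw [Complex.I_sq]; ring
  have h3 : ((p.1 : ℂ) ^ 2 + (p.2 : ℂ) ^ 2) ≠ 0 := by exact_mod_cast (sq_add_sq_pos hp).ne'
  rw [h2] at h3
  have h4 := left_ne_zero_of_mul h3
  have h5 := right_ne_zero_of_mul h3
  rw [h2]
  field_simp

lemma one_div_eq (p : ℝ × ℝ) (hp : 0 < p.1) :
    1 / ((p.1 : ℂ) + Complex.I * p.2) = (p.1 - Complex.I * p.2) / (p.1 ^ 2 + p.2 ^ 2) := by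
  have := one_div_conj_eq (p.1, -p.2) hp
  simpa [sub_eq_add_neg] using this

lemma integral_wave_abs {p : ℝ × ℝ} (hp : 0 < p.1) :
    ∫ lam, wave |lam| lam p = 2 * p.1 / (p.1 ^ 2 + p.2 ^ 2) := by
  rw [integral_eq_add_integral_comp_neg (integrable_wave_abs hp),
    setIntegral_congr_fun measurableSet_Ioi fun x hx => wave_abs_of_pos hx p,
    setIntegral_congr_fun measurableSet_Ioi fun x hx => wave_abs_neg_of_pos hx p,
    integral_cexp_neg (by simpa), integral_cexp_neg (by simpa), one_div_conj_eq p hp,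
    one_div_eq p hp]
  ring

lemma norm_csgn_le (lam : ℝ) : ‖csgn lam‖ ≤ 1 := by
  rcases Real.sign_apply_eq lam with h | h | h <;> simp [csgn, h]

lemma csgn_eq (lam : ℝ) : csgn lam = lam / ((|lam| : ℝ) : ℂ) := by
  rw [csgn]
  rcases lt_trichotomy lam 0 with h | rfl | h
  · have : (lam : ℂ) ≠ 0 := by exact_mod_cast h.ne
    rw [Real.sign_of_neg h, abs_of_neg h]
    push_cast
    field_simp
  · simp
  · have : (lam : ℂ) ≠ 0 := by exact_mod_cast h.ne'
    rw [Real.sign_of_pos h, abs_of_pos h]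
    simp [this]

lemma measurable_csgn : Measurable csgn := by
  unfold csgn
  refine Complex.measurable_ofReal.comp ?_
  exact Measurable.ite measurableSet_Iio measurable_const
    (Measurable.ite measurableSet_Ioi measurable_const measurable_const)

lemma integrable_csgn_mul_wave {p : ℝ × ℝ} (hp : 0 < p.1) :
    Integrable fun lam => csgn lam * wave |lam| lam p := by
  refine (integrable_wave_abs hp).norm.mono'
    (measurable_csgn.mul (measurable_wave measurable_norm p)).aestronglyMeasurable ?_
  refine Eventually.of_forall fun lam => ?_
  rw [norm_mul]
  exact mul_le_of_le_one_left (norm_nonneg _) (norm_csgn_le lam)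

/-- The transforms `1/(x - iy)` and `1/(x + iy)` of the two half lines, added in
`integral_wave_abs`, are subtracted here because of the sign. -/
lemma integral_csgn_mul_wave {p : ℝ × ℝ} (hp : 0 < p.1) :
    ∫ lam, csgn lam * wave |lam| lam p = 2 * Complex.I * p.2 / (p.1 ^ 2 + p.2 ^ 2) := by
  have h1 : EqOn (fun x => csgn x * wave |x| x p)
      (fun x => Complex.exp (-((p.1 : ℂ) - Complex.I * p.2) * x)) (Ioi 0) := fun x hx => by
    simp only [wave_abs_of_pos hx, csgn, Real.sign_of_pos hx]; simp
  have h2 : EqOn (fun x => csgn (-x) * wave |-x| (-x) p)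
      (fun x => - Complex.exp (-((p.1 : ℂ) + Complex.I * p.2) * x)) (Ioi 0) := fun x hx => by
    have : -x < 0 := neg_lt_zero.2 hx
    simp only [wave_abs_neg_of_pos hx, csgn, Real.sign_of_neg this]; simp
  rw [integral_eq_add_integral_comp_neg (integrable_csgn_mul_wave hp),
    setIntegral_congr_fun measurableSet_Ioi h1, setIntegral_congr_fun measurableSet_Ioi h2,
    integral_neg, integral_cexp_neg (by simpa), integral_cexp_neg (by simpa), one_div_conj_eq p hp,
    one_div_eq p hp]
  ring

/-- Mean value inequality for `exp` on the convex half plane `Re z ≤ -ν a`. The factor `ν` is what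
cancels an amplitude `1/ν`. -/
lemma norm_wave_sub_wave_le {ν lam : ℝ} (h : |lam| ≤ ν) {p q : ℝ × ℝ} {a : ℝ} (hp : a ≤ p.1)
    (hq : a ≤ q.1) :
    ‖wave ν lam p - wave ν lam q‖ ≤ ν * (|p.1 - q.1| + |p.2 - q.2|) * Real.exp (-(ν * a)) := by
  have hν : 0 ≤ ν := (abs_nonneg _).trans h
  have key : ∀ x ∈ {z : ℂ | z.re ≤ -(ν * a)}, ∀ y ∈ {z : ℂ | z.re ≤ -(ν * a)},
      ‖Complex.exp x - Complex.exp y‖ ≤ Real.exp (-(ν * a)) * ‖x - y‖ := by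
    intro x hx y hy
    refine Convex.norm_image_sub_le_of_norm_hasDerivWithin_le
      (f' := Complex.exp) (fun z _ => (Complex.hasDerivAt_exp z).hasDerivWithinAt) ?_
      (convex_halfSpace_re_le _) hy hx
    intro z hz
    rw [Complex.norm_exp]
    exact Real.exp_le_exp.2 hz
  have h1 : ∀ r : ℝ × ℝ, a ≤ r.1 → (-((ν * r.1 : ℝ) : ℂ) + Complex.I * ((lam * r.2 : ℝ) : ℂ)) ∈
      {z : ℂ | z.re ≤ -(ν * a)} := fun r hr => by
    have := mul_le_mul_of_nonneg_left hr hν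
    simp
    linarith
  refine (key _ (h1 p hp) _ (h1 q hq)).trans ?_
  rw [mul_comm]
  apply mul_le_mul_of_nonneg_right _ (Real.exp_pos _).le
  calc _ = ‖((-(ν * (p.1 - q.1)) : ℝ) : ℂ) + Complex.I * ((lam * (p.2 - q.2) : ℝ) : ℂ)‖ := by
        congr 1; push_cast; ring
    _ ≤ ν * |p.1 - q.1| + |lam| * |p.2 - q.2| := by
        refine (norm_add_le _ _).trans (le_of_eq ?_)
        rw [norm_mul, Complex.norm_real, Complex.norm_real, Complex.norm_I, one_mul,
          Real.norm_eq_abs, Real.norm_eq_abs, abs_neg, abs_mul, abs_mul, abs_of_nonneg hν]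
    _ ≤ _ := by
        have := mul_le_mul_of_nonneg_right h (abs_nonneg (p.2 - q.2))
        linarith

lemma integrable_wave_sub_wave_div {p q : ℝ × ℝ} (hp : 0 < p.1) (hq : 0 < q.1) :
    Integrable fun lam : ℝ => (1 / ((|lam| : ℝ) : ℂ)) * (wave |lam| lam p - wave |lam| lam q) := by
  refine ((integrable_exp_neg_mul_abs (lt_min hp hq)).const_mul
    (|p.1 - q.1| + |p.2 - q.2|)).mono' (Measurable.aestronglyMeasurable ?_) ?_
  · have := measurable_wave measurable_norm p
    have := measurable_wave measurable_norm q
    simp only [Real.norm_eq_abs] at *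
    fun_prop
  · refine Eventually.of_forall fun lam => ?_
    have h := norm_wave_sub_wave_le (le_refl |lam|) (min_le_left p.1 q.1) (min_le_right p.1 q.1)
    rw [norm_mul, norm_div, norm_one, Complex.norm_real, Real.norm_eq_abs, abs_abs]
    rcases eq_or_ne lam 0 with rfl | h0
    · simp; positivity
    · have : 0 < |lam| := abs_pos.2 h0
      rw [div_mul_eq_mul_div, one_mul, div_le_iff₀ this]
      linarith

/-- A Frullani integral in the plane. Along the segment from `q` to `p`, which stays in the right
half plane, the integral plus `log (x² + y²)` has derivative zero by the two transforms above, and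
at `q` the integral vanishes. -/
lemma integral_wave_sub_wave_div {p q : ℝ × ℝ} (hp : 0 < p.1) (hq : 0 < q.1) :
    ∫ lam : ℝ, (1 / ((|lam| : ℝ) : ℂ)) * (wave |lam| lam p - wave |lam| lam q) =
      ((Real.log (q.1 ^ 2 + q.2 ^ 2) - Real.log (p.1 ^ 2 + p.2 ^ 2) : ℝ) : ℂ) := by
  set x : ℝ → ℝ := fun t => q.1 + t * (p.1 - q.1) with hxdef
  set y : ℝ → ℝ := fun t => q.2 + t * (p.2 - q.2) with hydef
  have hx : ∀ t, HasDerivAt x (p.1 - q.1) t := fun t => by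
    simpa [hxdef] using ((hasDerivAt_id t).mul_const (p.1 - q.1)).const_add q.1
  have hy : ∀ t, HasDerivAt y (p.2 - q.2) t := fun t => by
    simpa [hydef] using ((hasDerivAt_id t).mul_const (p.2 - q.2)).const_add q.2
  have hpos : ∀ t ∈ Icc (0 : ℝ) 1, 0 < x t := fun t ht => by
    have h1 : x t = (1 - t) * q.1 + t * p.1 := by simp only [hxdef]; ring
    rw [h1]
    rcases eq_or_lt_of_le ht.1 with h | h
    · rw [← h]; simpa
    · have := mul_pos h hp
      have := mul_nonneg (sub_nonneg.2 ht.2) hq.le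
      linarith
  set G : ℝ → ℂ := fun t => (∫ lam : ℝ, (1 / ((|lam| : ℝ) : ℂ)) *
    (wave |lam| lam (x t, y t) - wave |lam| lam q)) +
      ((Real.log (x t ^ 2 + y t ^ 2) : ℝ) : ℂ) with hG
  have hder : ∀ t ∈ Icc (0 : ℝ) 1, HasDerivAt G 0 t := by
    intro t ht
    have hpt := hpos t ht
    obtain ⟨hi, hd⟩ := hasDerivAt_integral_wave (μ := fun lam => |lam|)
      (c := fun lam => 1 / ((|lam| : ℝ) : ℂ)) (w := fun lam => wave |lam| lam q) (B := 1)
      (x' := fun _ => p.1 - q.1) (y' := fun _ => p.2 - q.2)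
      (D := max |p.1 - q.1| |p.2 - q.2|) (t₀ := t) (by fun_prop) (fun _ => le_rfl)
      (by fun_prop) (measurable_wave measurable_norm q)
      (fun lam => by
        rw [norm_div, norm_one, Complex.norm_real, Real.norm_eq_abs, abs_abs]
        have : 1 / |lam| * |lam| ≤ 1 := by
          rw [one_div_mul_eq_div]; exact div_self_le_one _
        linarith [abs_nonneg lam])
      hx hy (fun _ => le_max_left _ _) (fun _ => le_max_right _ _) hpt
      (integrable_wave_sub_wave_div hpt hq)
    have hl : HasDerivAt (fun t => ((Real.log (x t ^ 2 + y t ^ 2) : ℝ) : ℂ)) _ t :=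
      ((((hx t).pow 2).add ((hy t).pow 2)).log (sq_add_sq_pos (p := (x t, y t)) hpt).ne').ofReal_comp
    refine (hd.add hl).congr_deriv ?_
    have hae : (fun lam : ℝ => 1 / ((|lam| : ℝ) : ℂ) * ((-((|lam| : ℝ) : ℂ) * ((p.1 - q.1 : ℝ) : ℂ)
        + Complex.I * lam * ((p.2 - q.2 : ℝ) : ℂ)) * wave |lam| lam (x t, y t))) =ᵐ[volume]
        fun lam => -((p.1 - q.1 : ℝ) : ℂ) * wave |lam| lam (x t, y t) +
          Complex.I * ((p.2 - q.2 : ℝ) : ℂ) * (csgn lam * wave |lam| lam (x t, y t)) := by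
      filter_upwards [compl_mem_ae_iff.2 (measure_singleton (0 : ℝ))] with lam hlam
      have h0 : lam ≠ 0 := hlam
      have h1 : ((|lam| : ℝ) : ℂ) ≠ 0 := by exact_mod_cast (abs_pos.2 h0).ne'
      rw [csgn_eq]
      field_simp
    rw [integral_congr_ae hae, integral_add ((integrable_wave_abs hpt).const_mul _)
      ((integrable_csgn_mul_wave hpt).const_mul _), integral_const_mul, integral_const_mul,
      integral_wave_abs hpt, integral_csgn_mul_wave hpt]
    have h3 : ((x t : ℂ) ^ 2 + (y t : ℂ) ^ 2) ≠ 0 := by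
      exact_mod_cast (sq_add_sq_pos (p := (x t, y t)) hpt).ne'
    simp only [Pi.add_apply, Pi.pow_apply]
    push_cast
    field_simp
    ring_nf
    rw [Complex.I_sq]
    ring
  have hconst := constant_of_has_deriv_right_zero (f := G) (a := 0) (b := 1)
    (fun t ht => (hder t ht).continuousAt.continuousWithinAt)
    (fun t ht => (hder t (Ico_subset_Icc_self ht)).hasDerivWithinAt) 1 (by simp)
  simp only [hG, hxdef, hydef] at hconst
  simp only [one_mul, zero_mul, add_zero, add_sub_cancel, Prod.mk.eta, sub_self, mul_zero,
    integral_zero, zero_add] at hconst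
  push_cast
  rw [← hconst]
  ring

/-! ### The Stokeslet as a superposition of plane waves -/

/-- The plane wave symbol `(ν⁻¹ A + x C) exp (-ν x + i λ y)` of the Stokeslet (`ν = |λ|`), and
of the derivative in `ν²` of the modified Stokeslet. -/
def symb (ν lam : ℝ) (p : ℝ × ℝ) : Matrix (Fin 2) (Fin 2) ℂ :=
  wave ν lam p • !![(lam / ν : ℂ) ^ 2 * (1 / ν + p.1), -(Complex.I * (lam / ν) * p.1);
    -(Complex.I * (lam / ν) * p.1), 1 / ν - p.1]

lemma ae_ne_zero : ∀ᵐ lam : ℝ, lam ≠ 0 := compl_mem_ae_iff.2 (measure_singleton (0 : ℝ))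

lemma ofReal_sq_div_abs {lam : ℝ} (h : lam ≠ 0) : ((lam : ℂ) / ((|lam| : ℝ) : ℂ)) ^ 2 = 1 := by
  rw [div_pow, ← Complex.ofReal_pow, ← Complex.ofReal_pow, sq_abs, div_self]
  exact_mod_cast pow_ne_zero 2 h

lemma stokeslet_apply_zero_zero {p : ℝ × ℝ} (hp : 0 < p.1) :
    stokeslet p 0 0 = -(1 / (4 * π)) * (Real.log (p.1 ^ 2 + p.2 ^ 2) / 2 -
      p.1 ^ 2 / (p.1 ^ 2 + p.2 ^ 2)) := by
  have h := (sq_add_sq_pos hp).le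
  simp [stokeslet, len, Matrix.vecMulVec, Real.log_sqrt h, Real.sq_sqrt h]
  ring

lemma stokeslet_apply_one_one {p : ℝ × ℝ} (hp : 0 < p.1) :
    stokeslet p 1 1 = -(1 / (4 * π)) * (Real.log (p.1 ^ 2 + p.2 ^ 2) / 2 -
      p.2 ^ 2 / (p.1 ^ 2 + p.2 ^ 2)) := by
  have h := (sq_add_sq_pos hp).le
  simp [stokeslet, len, Matrix.vecMulVec, Real.log_sqrt h, Real.sq_sqrt h]
  ring

lemma stokeslet_apply_zero_one {p : ℝ × ℝ} (hp : 0 < p.1) :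
    stokeslet p 0 1 = (1 / (4 * π)) * (p.1 * p.2 / (p.1 ^ 2 + p.2 ^ 2)) := by
  have h := (sq_add_sq_pos hp).le
  simp [stokeslet, len, Matrix.vecMulVec, Real.sq_sqrt h]
  ring

lemma stokeslet_apply_one_zero (p : ℝ × ℝ) : stokeslet p 1 0 = stokeslet p 0 1 := by
  simp [stokeslet, Matrix.vecMulVec, mul_comm]

/-- Differences of the Stokeslet are integrals of differences of its plane wave symbol. -/
theorem stokeslet_sub_stokeslet {p q : ℝ × ℝ} (hp : 0 < p.1) (hq : 0 < q.1) (a b : Fin 2) :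
    (Integrable fun lam : ℝ => symb |lam| lam p a b - symb |lam| lam q a b) ∧
    ((stokeslet p a b - stokeslet q a b : ℝ) : ℂ) =
      (1 / (8 * π) : ℝ) * ∫ lam : ℝ, (symb |lam| lam p a b - symb |lam| lam q a b) := by
  have hpi : (π : ℂ) ≠ 0 := by exact_mod_cast Real.pi_ne_zero
  have hp2 : ((p.1 : ℂ) ^ 2 + (p.2 : ℂ) ^ 2) ≠ 0 := by exact_mod_cast (sq_add_sq_pos hp).ne'
  have hq2 : ((q.1 : ℂ) ^ 2 + (q.2 : ℂ) ^ 2) ≠ 0 := by exact_mod_cast (sq_add_sq_pos hq).ne'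
  have iL := integrable_wave_sub_wave_div hp hq
  have ip := integrable_wave_abs hp
  have iq := integrable_wave_abs hq
  have jp := integrable_csgn_mul_wave hp
  have jq := integrable_csgn_mul_wave hq
  have isub : Integrable fun lam => (p.1 : ℂ) * wave |lam| lam p - (q.1 : ℂ) * wave |lam| lam q :=
    (ip.const_mul _).sub (iq.const_mul _)
  have hoff : (Integrable fun lam : ℝ => symb |lam| lam p 0 1 - symb |lam| lam q 0 1) ∧
      ((stokeslet p 0 1 - stokeslet q 0 1 : ℝ) : ℂ) =
      (1 / (8 * π) : ℝ) * ∫ lam : ℝ, (symb |lam| lam p 0 1 - symb |lam| lam q 0 1) := by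
    have e : (fun lam : ℝ => symb |lam| lam p 0 1 - symb |lam| lam q 0 1) = fun lam =>
        (-(Complex.I * p.1)) * (csgn lam * wave |lam| lam p) -
          (-(Complex.I * q.1)) * (csgn lam * wave |lam| lam q) := by
      ext lam; simp [symb, csgn_eq]; ring
    rw [e]
    refine ⟨(jp.const_mul _).sub (jq.const_mul _), ?_⟩
    rw [integral_sub (jp.const_mul _) (jq.const_mul _), integral_const_mul, integral_const_mul,
      integral_csgn_mul_wave hp, integral_csgn_mul_wave hq, stokeslet_apply_zero_one hp,
      stokeslet_apply_zero_one hq]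
    push_cast
    field_simp
    ring_nf
    rw [Complex.I_sq]
    ring
  have h00 : (Integrable fun lam : ℝ => symb |lam| lam p 0 0 - symb |lam| lam q 0 0) ∧
      ((stokeslet p 0 0 - stokeslet q 0 0 : ℝ) : ℂ) =
      (1 / (8 * π) : ℝ) * ∫ lam : ℝ, (symb |lam| lam p 0 0 - symb |lam| lam q 0 0) := by
    have e : (fun lam : ℝ => symb |lam| lam p 0 0 - symb |lam| lam q 0 0) =ᵐ[volume] fun lam =>
        (1 / ((|lam| : ℝ) : ℂ)) * (wave |lam| lam p - wave |lam| lam q) +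
          ((p.1 : ℂ) * wave |lam| lam p - (q.1 : ℂ) * wave |lam| lam q) := by
      filter_upwards [ae_ne_zero] with lam h
      simp [symb, ofReal_sq_div_abs h]; ring
    refine ⟨(integrable_congr e).2 (iL.add isub), ?_⟩
    rw [integral_congr_ae e, integral_add iL isub,
      integral_sub (ip.const_mul _) (iq.const_mul _), integral_const_mul, integral_const_mul,
      integral_wave_sub_wave_div hp hq, integral_wave_abs hp, integral_wave_abs hq,
      stokeslet_apply_zero_zero hp, stokeslet_apply_zero_zero hq]
    push_cast
    field_simp
    ring
  have h11 : (Integrable fun lam : ℝ => symb |lam| lam p 1 1 - symb |lam| lam q 1 1) ∧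
      ((stokeslet p 1 1 - stokeslet q 1 1 : ℝ) : ℂ) =
      (1 / (8 * π) : ℝ) * ∫ lam : ℝ, (symb |lam| lam p 1 1 - symb |lam| lam q 1 1) := by
    have e : (fun lam : ℝ => symb |lam| lam p 1 1 - symb |lam| lam q 1 1) = fun lam =>
        (1 / ((|lam| : ℝ) : ℂ)) * (wave |lam| lam p - wave |lam| lam q) -
          ((p.1 : ℂ) * wave |lam| lam p - (q.1 : ℂ) * wave |lam| lam q) := by
      ext lam
      simp [symb]; ring
    rw [e]
    refine ⟨(iL.sub isub), ?_⟩
    rw [integral_sub iL isub,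
      integral_sub (ip.const_mul _) (iq.const_mul _), integral_const_mul, integral_const_mul,
      integral_wave_sub_wave_div hp hq, integral_wave_abs hp, integral_wave_abs hq,
      stokeslet_apply_one_one hp, stokeslet_apply_one_one hq]
    push_cast
    field_simp
    ring
  have hoff' := hoff
  rw [← stokeslet_apply_one_zero, ← stokeslet_apply_one_zero] at hoff'
  fin_cases a <;> fin_cases b
  exacts [h00, hoff, hoff', h11]

/-! ### The modified Stokeslet as a superposition of plane waves -/

/-- The decay rate `√(λ² + β²)` of the plane waves of frequency `λ` annihilated by `Δ - β²`. -/
def rate (β lam : ℝ) : ℝ := √(lam ^ 2 + β ^ 2)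

lemma abs_le_rate (β lam : ℝ) : |lam| ≤ rate β lam :=
  Real.abs_le_sqrt (by nlinarith [sq_nonneg β])

lemma rate_nonneg (β lam : ℝ) : 0 ≤ rate β lam := Real.sqrt_nonneg _

lemma le_rate (β lam : ℝ) : β ≤ rate β lam :=
  (le_abs_self β).trans (Real.abs_le_sqrt (by nlinarith [sq_nonneg lam]))

lemma rate_zero (lam : ℝ) : rate 0 lam = |lam| := by simp [rate, Real.sqrt_sq_eq_abs]

lemma continuous_rate (β : ℝ) : Continuous (rate β) := by unfold rate; fun_prop

/-- The superposition of the plane waves of decay rate `rate β` with amplitude `c`. -/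
def superpos (β : ℝ) (c : ℝ → ℂ) (p : ℝ × ℝ) : ℂ := ∫ lam, c lam * wave (rate β lam) lam p

lemma integrable_superpos_of_le_one {β : ℝ} {c : ℝ → ℂ} {p : ℝ × ℝ} {B : ℝ} (hp : 0 < p.1)
    (hc : Measurable c) (hB : ∀ lam, ‖c lam‖ ≤ B) :
    Integrable fun lam => c lam * wave (rate β lam) lam p := by
  refine ((integrable_exp_neg_mul_abs hp).const_mul B).mono'
    (hc.mul (measurable_wave (continuous_rate β).measurable p)).aestronglyMeasurable ?_
  refine Eventually.of_forall fun lam => ?_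
  rw [norm_mul, norm_wave]
  have := mul_le_mul_of_nonneg_right (abs_le_rate β lam) hp.le
  exact mul_le_mul (hB lam) (Real.exp_le_exp.2 (by linarith)) (Real.exp_pos _).le
    ((norm_nonneg _).trans (hB lam))

lemma mul_exp_neg_le {ν x : ℝ} (hx : 0 < x) :
    ν * Real.exp (-(ν * x)) ≤ 2 / x * Real.exp (-(ν * (x / 2))) := by
  have h := le_mul_exp (x := ν) (half_pos hx)
  calc ν * Real.exp (-(ν * x)) ≤ (1 / (x / 2) * Real.exp (ν * (x / 2))) * Real.exp (-(ν * x)) :=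
        mul_le_mul_of_nonneg_right h (Real.exp_pos _).le
    _ = _ := by
        rw [mul_assoc, ← Real.exp_add, one_div_div]
        ring_nf

lemma norm_mul_wave_le {ν lam : ℝ} (h : |lam| ≤ ν) {c : ℂ} (hc : ‖c‖ ≤ ν) {p : ℝ × ℝ}
    (hp : 0 < p.1) : ‖c * wave ν lam p‖ ≤ 2 / p.1 * Real.exp (-(|lam| * (p.1 / 2))) := by
  rw [norm_mul, norm_wave]
  refine (mul_le_mul_of_nonneg_right hc (Real.exp_pos _).le).trans ((mul_exp_neg_le hp).trans ?_)
  have := mul_le_mul_of_nonneg_right h (half_pos hp).le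
  gcongr

lemma integrable_superpos_of_le_rate {β : ℝ} {c : ℝ → ℂ} {p : ℝ × ℝ} (hp : 0 < p.1)
    (hc : Measurable c) (hB : ∀ lam, ‖c lam‖ ≤ rate β lam) :
    Integrable fun lam => c lam * wave (rate β lam) lam p :=
  ((integrable_exp_neg_mul_abs (half_pos hp)).const_mul (2 / p.1)).mono'
    (hc.mul (measurable_wave (continuous_rate β).measurable p)).aestronglyMeasurable
    (Eventually.of_forall fun lam => norm_mul_wave_le (abs_le_rate β lam) (hB lam) hp)

lemma hasDerivAt_superpos {β : ℝ} {c : ℝ → ℂ} (hc : Measurable c) {B : ℝ}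
    (hB : ∀ lam, ‖c lam‖ ≤ B) {x y x' y' : ℝ → ℝ} {D t₀ : ℝ}
    (hx : ∀ t, HasDerivAt x (x' t) t) (hy : ∀ t, HasDerivAt y (y' t) t)
    (hx' : ∀ t, |x' t| ≤ D) (hy' : ∀ t, |y' t| ≤ D) (h₀ : 0 < x t₀) :
    HasDerivAt (fun t => superpos β c (x t, y t))
      (superpos β (fun lam => c lam * (-(rate β lam : ℂ) * x' t₀ + Complex.I * lam * y' t₀))
        (x t₀, y t₀)) t₀ := by
  have h := (hasDerivAt_integral_wave (μ := rate β) (c := c) (w := fun _ => 0) (B := B)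
    (continuous_rate β).measurable (abs_le_rate β) hc measurable_const
    (fun lam => by
      have := mul_le_mul_of_nonneg_right (hB lam) (rate_nonneg β lam)
      have := (norm_nonneg _).trans (hB lam)
      linarith) hx hy hx' hy' h₀
    (by simpa using integrable_superpos_of_le_one (p := (x t₀, y t₀)) h₀ hc hB)).2
  simpa [superpos, mul_assoc] using h

lemma hasDerivAt_superpos_fst {β : ℝ} {c : ℝ → ℂ} (hc : Measurable c) {B : ℝ}
    (hB : ∀ lam, ‖c lam‖ ≤ B) {x : ℝ} (hx : 0 < x) (y : ℝ) :
    HasDerivAt (fun t => superpos β c (t, y))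
      (superpos β (fun lam => c lam * (-(rate β lam : ℂ))) (x, y)) x := by
  simpa using hasDerivAt_superpos (D := 1) (β := β) (x := fun t => t) (y := fun _ => y) (t₀ := x)
    hc hB (fun t => hasDerivAt_id t) (fun t => hasDerivAt_const t y) (by simp) (by simp) hx

lemma hasDerivAt_superpos_snd {β : ℝ} {c : ℝ → ℂ} (hc : Measurable c) {B : ℝ}
    (hB : ∀ lam, ‖c lam‖ ≤ B) {x : ℝ} (hx : 0 < x) (y : ℝ) :
    HasDerivAt (fun t => superpos β c (x, t))
      (superpos β (fun lam => c lam * (Complex.I * lam)) (x, y)) y := by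
  simpa using hasDerivAt_superpos (D := 1) (β := β) (x := fun _ => x) (y := fun t => t) (t₀ := y)
    hc hB (fun t => hasDerivAt_const t x) (fun t => hasDerivAt_id t) (by simp) (by simp) hx

/-! ### Plane wave representation of the Bessel function `K₀`. -/

lemma norm_one_div_rate_le {β : ℝ} (hβ : 0 < β) (lam : ℝ) :
    ‖(1 / (rate β lam : ℂ))‖ ≤ 1 / β := by
  rw [norm_div, norm_one, Complex.norm_real, Real.norm_eq_abs, abs_of_nonneg (rate_nonneg β lam)]
  exact one_div_le_one_div_of_le hβ (le_rate β lam)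

lemma measurable_ofReal_rate (β : ℝ) : Measurable fun lam => (rate β lam : ℂ) :=
  Complex.measurable_ofReal.comp (continuous_rate β).measurable

/-- Rotation invariance of the superposition that represents the Bessel function. -/
lemma superpos_one_div_rate_polar {β : ℝ} (hβ : 0 < β) {r φ : ℝ} (hr : 0 < r)
    (hφ : φ ∈ Ioo (-(π / 2)) (π / 2)) :
    superpos β (fun lam => 1 / (rate β lam : ℂ)) (r * Real.cos φ, r * Real.sin φ) =
      superpos β (fun lam => 1 / (rate β lam : ℂ)) (r, 0) := by
  have hm := measurable_ofReal_rate β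
  have hder : ∀ t ∈ Ioo (-(π / 2)) (π / 2), HasDerivAt (fun t =>
      superpos β (fun lam => 1 / (rate β lam : ℂ)) (r * Real.cos t, r * Real.sin t)) 0 t := by
    intro t ht
    have hcos : 0 < r * Real.cos t := mul_pos hr (Real.cos_pos_of_mem_Ioo ht)
    have h := hasDerivAt_superpos (β := β) (c := fun lam => 1 / (rate β lam : ℂ)) (D := r)
      (x := fun t => r * Real.cos t) (y := fun t => r * Real.sin t) (t₀ := t)
      (by fun_prop) (norm_one_div_rate_le hβ)
      (fun t => (Real.hasDerivAt_cos t).const_mul r) (fun t => (Real.hasDerivAt_sin t).const_mul r)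
      (fun t => by
        rw [abs_mul, abs_of_pos hr, abs_neg]
        exact mul_le_of_le_one_right hr.le (Real.abs_sin_le_one t))
      (fun t => by
        rw [abs_mul, abs_of_pos hr]
        exact mul_le_of_le_one_right hr.le (Real.abs_cos_le_one t)) hcos
    refine h.congr_deriv ?_
    set p : ℝ × ℝ := (r * Real.cos t, r * Real.sin t) with hp
    -- The integrand of the angular derivative is `-i` times the `λ`-derivative of the wave, so its
    -- integral over the line vanishes.
    have hd : ∀ lam, HasDerivAt (fun lam => wave (rate β lam) lam p)
        ((-(lam / rate β lam : ℂ) * p.1 + Complex.I * p.2) * wave (rate β lam) lam p) lam := by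
      intro lam
      have hpos : 0 < lam ^ 2 + β ^ 2 := by positivity
      have h1 : HasDerivAt (fun lam => rate β lam) (lam / rate β lam) lam := by
        have := ((hasDerivAt_pow 2 lam).add_const (β ^ 2)).sqrt hpos.ne'
        refine this.congr_deriv ?_
        rw [rate]; field_simp; norm_num
      have h2 := ((h1.mul_const p.1).ofReal_comp.neg.add
        (((hasDerivAt_id lam).mul_const p.2).ofReal_comp.const_mul Complex.I)).cexp
      refine h2.congr_deriv ?_
      simp only [wave, Pi.add_apply, Pi.neg_apply, id_eq, one_mul]
      push_cast
      ring
    have hi1 : Integrable fun lam => wave (rate β lam) lam p := by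
      simpa using integrable_superpos_of_le_one (β := β) (c := fun _ => 1) (B := 1) (p := p) hcos
        measurable_const (by simp)
    have hi2 : Integrable fun lam => (-(lam / rate β lam : ℂ) * p.1 + Complex.I * p.2) *
        wave (rate β lam) lam p := by
      refine integrable_superpos_of_le_one (B := |p.1| + |p.2|) hcos (by fun_prop) fun lam => ?_
      refine (norm_add_le _ _).trans ?_
      have : |lam| / rate β lam ≤ 1 := div_le_one_of_le₀ (abs_le_rate β lam) (rate_nonneg β lam)
      simp only [norm_mul, norm_neg, norm_div, Complex.norm_real, Complex.norm_I, one_mul,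
        Real.norm_eq_abs, abs_of_nonneg (rate_nonneg β lam)]
      have := mul_le_of_le_one_left (abs_nonneg p.1) this
      linarith
    have h0 := integral_eq_zero_of_hasDerivAt_of_integrable hd hi2 hi1
    have : superpos β (fun lam => 1 / (rate β lam : ℂ) * (-(rate β lam : ℂ) * (r * -Real.sin t : ℝ) +
        Complex.I * lam * (r * Real.cos t : ℝ))) p = -Complex.I * 0 := by
      rw [← h0, superpos, ← integral_const_mul]
      congr 1
      ext lam
      have hne : (rate β lam : ℂ) ≠ 0 := by exact_mod_cast (hβ.trans_le (le_rate β lam)).ne'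
      rw [← mul_assoc]
      congr 1
      simp only [hp]
      push_cast
      field_simp
      ring_nf
      rw [Complex.I_sq]
      ring
    rw [this, mul_zero]
  have hconst := (convex_Ioo (-(π / 2)) (π / 2)).norm_image_sub_le_of_norm_hasDerivWithin_le
    (C := 0) (fun t ht => (hder t ht).hasDerivWithinAt) (by simp)
    (show (0 : ℝ) ∈ Ioo (-(π / 2)) (π / 2) by constructor <;> linarith [Real.pi_pos]) hφ
  rw [zero_mul, norm_le_zero_iff, sub_eq_zero] at hconst
  simpa using hconst

/-- The substitution `λ = β sinh v`, which turns `√(λ² + β²)` into `β cosh v`. -/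
lemma integral_comp_mul_sinh {β : ℝ} (hβ : 0 < β) (g : ℝ → ℂ) :
    ∫ lam, g lam = ∫ v, ((β * Real.cosh v : ℝ) : ℂ) * g (β * Real.sinh v) := by
  have h := integral_image_eq_integral_abs_deriv_smul (s := univ) (f := fun v => β * Real.sinh v)
    (f' := fun v => β * Real.cosh v) MeasurableSet.univ
    (fun v _ => ((Real.hasDerivAt_sinh v).const_mul β).hasDerivWithinAt)
    (fun v _ w _ h => Real.sinh_injective (mul_left_cancel₀ hβ.ne' h)) g
  have himg : (fun v => β * Real.sinh v) '' univ = univ := by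
    rw [image_univ, range_eq_univ]
    intro z
    obtain ⟨v, hv⟩ := Real.sinh_surjective (z / β)
    exact ⟨v, by simp only [hv]; field_simp⟩
  rw [himg, setIntegral_univ, setIntegral_univ] at h
  rw [h]
  congr 1
  ext v
  rw [abs_of_pos (mul_pos hβ (Real.cosh_pos v)), Complex.real_smul]

/-- Rotating `p` onto the positive axis removes the oscillation. The Jacobian `β cosh v` then
cancels the amplitude, leaving the even function `exp (-β r cosh v)` over the whole line, that is,
twice the defining integral. -/
lemma besselK₀_eq_superpos {β : ℝ} (hβ : 0 < β) {p : ℝ × ℝ} (hp : 0 < p.1) :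
    (besselK₀ (β * len p) : ℂ) = 1 / 2 * superpos β (fun lam => 1 / (rate β lam : ℂ)) p := by
  set z : ℂ := ⟨p.1, p.2⟩ with hz
  have hlen : len p = ‖z‖ := by
    rw [len, Complex.norm_def, Complex.normSq_apply]; congr 1; simp only [hz]; ring
  have hr : 0 < ‖z‖ := by
    rw [norm_pos_iff]; intro h; have := congrArg Complex.re h; simp [hz] at this; linarith
  have harg : z.arg ∈ Ioo (-(π / 2)) (π / 2) :=
    abs_lt.1 (Complex.abs_arg_lt_pi_div_two_iff.2 (Or.inl hp))
  have hpol := superpos_one_div_rate_polar hβ hr harg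
  rw [Complex.norm_mul_cos_arg, Complex.norm_mul_sin_arg] at hpol
  have hpe : ((z.re, z.im) : ℝ × ℝ) = p := rfl
  rw [hpe] at hpol
  rw [hpol, hlen, superpos, integral_comp_mul_sinh hβ]
  have hint : ∀ v, ((β * Real.cosh v : ℝ) : ℂ) * (1 / (rate β (β * Real.sinh v) : ℂ) *
      wave (rate β (β * Real.sinh v)) (β * Real.sinh v) (‖z‖, 0)) =
      ((Real.exp (-(β * ‖z‖) * Real.cosh |v|) : ℝ) : ℂ) := by
    intro v
    have h1 : rate β (β * Real.sinh v) = β * Real.cosh v := by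
      rw [rate, show (β * Real.sinh v) ^ 2 + β ^ 2 = (β * Real.cosh v) ^ 2 by
        rw [mul_pow, mul_pow, Real.cosh_sq]; ring,
        Real.sqrt_sq (mul_pos hβ (Real.cosh_pos v)).le]
    have h2 : ((β * Real.cosh v : ℝ) : ℂ) ≠ 0 := by
      exact_mod_cast (mul_pos hβ (Real.cosh_pos v)).ne'
    rw [h1, ← mul_assoc, mul_one_div_cancel h2, one_mul, wave, Real.cosh_abs]
    push_cast
    congr 1
    ring
  simp_rw [hint]
  rw [integral_complex_ofReal, integral_comp_abs (f := fun v => Real.exp (-(β * ‖z‖) * Real.cosh v)),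
    besselK₀]
  push_cast
  ring

/-! ### Second derivatives of the modified biharmonic fundamental solution. -/

/-- The plane wave symbol of `∇ ⊗ ∇ - Δ I` applied to `-exp (-ν x + i λ y) / ν`. -/
def biSymb (ν lam : ℝ) (p : ℝ × ℝ) : Matrix (Fin 2) (Fin 2) ℂ :=
  wave ν lam p • !![-(lam * (lam / ν) : ℂ), Complex.I * lam; Complex.I * lam, ν]

/-- The amplitudes of `superpos` that correspond to `biSymb`. -/
def biAmp (β lam : ℝ) : Matrix (Fin 2) (Fin 2) ℂ :=
  !![-(lam * (lam / rate β lam) : ℂ), Complex.I * lam; Complex.I * lam, rate β lam]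

lemma biSymb_apply (β lam : ℝ) (p : ℝ × ℝ) (a b : Fin 2) :
    biSymb (rate β lam) lam p a b = biAmp β lam a b * wave (rate β lam) lam p := by
  simp [biSymb, biAmp, mul_comm]

lemma norm_div_rate_le (β lam : ℝ) : ‖(lam / rate β lam : ℂ)‖ ≤ 1 := by
  rw [norm_div, Complex.norm_real, Complex.norm_real, Real.norm_eq_abs, Real.norm_eq_abs,
    abs_of_nonneg (rate_nonneg β lam)]
  exact div_le_one_of_le₀ (abs_le_rate β lam) (rate_nonneg β lam)

lemma norm_biAmp_le (β lam : ℝ) (a b : Fin 2) : ‖biAmp β lam a b‖ ≤ rate β lam := by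
  have h := abs_le_rate β lam
  have h1 : ‖(lam : ℂ)‖ ≤ rate β lam := by rwa [Complex.norm_real, Real.norm_eq_abs]
  have h2 : ‖(lam : ℂ) * (lam / rate β lam)‖ ≤ rate β lam := by
    rw [norm_mul]
    exact (mul_le_of_le_one_right (norm_nonneg _) (norm_div_rate_le β lam)).trans h1
  have h3 : ‖(rate β lam : ℂ)‖ ≤ rate β lam := by
    rw [Complex.norm_real, Real.norm_eq_abs, abs_of_nonneg (rate_nonneg β lam)]
  fin_cases a <;> fin_cases b
  · show ‖-((lam : ℂ) * (lam / rate β lam))‖ ≤ _; rwa [norm_neg]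
  · show ‖Complex.I * (lam : ℂ)‖ ≤ _; rwa [norm_mul, Complex.norm_I, one_mul]
  · show ‖Complex.I * (lam : ℂ)‖ ≤ _; rwa [norm_mul, Complex.norm_I, one_mul]
  · exact h3

lemma measurable_biAmp (β : ℝ) (a b : Fin 2) : Measurable fun lam => biAmp β lam a b := by
  have hm := measurable_ofReal_rate β
  fin_cases a <;> fin_cases b <;> simp only [biAmp] <;> simp <;> fun_prop

lemma integrable_biSymb (β : ℝ) {p : ℝ × ℝ} (hp : 0 < p.1) (a b : Fin 2) :
    Integrable fun lam => biSymb (rate β lam) lam p a b := by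
  simp_rw [biSymb_apply]
  exact integrable_superpos_of_le_rate hp (measurable_biAmp β a b) (norm_biAmp_le β · a b)

lemma integrable_biSymb_sub (β : ℝ) {p : ℝ × ℝ} (hp : 0 < p.1) (a b : Fin 2) :
    Integrable fun lam => biSymb (rate β lam) lam p a b - biSymb |lam| lam p a b := by
  refine (integrable_biSymb β hp a b).sub ?_
  simpa only [rate_zero] using integrable_biSymb 0 hp a b

lemma integral_biSymb (β : ℝ) (p : ℝ × ℝ) (a b : Fin 2) :
    ∫ lam, biSymb (rate β lam) lam p a b = superpos β (fun lam => biAmp β lam a b) p := by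
  simp_rw [biSymb_apply]; rfl

lemma hasDerivAt_re {f : ℝ → ℂ} {f' : ℂ} {t : ℝ} (h : HasDerivAt f f' t) :
    HasDerivAt (fun t => (f t).re) f'.re t :=
  (Complex.reCLM.hasFDerivAt (x := f t)).comp_hasDerivAt t h

/-- The logarithm has no convergent representation with amplitude `1/|λ|`, but its gradient has one.
From the first derivative on, the logarithmic part is the case `β = 0` of the Bessel part. -/
lemma superpos_zero_one {p : ℝ × ℝ} (hp : 0 < p.1) :
    (superpos 0 (fun _ => -1) p).re = -(2 * (p.1 / (p.1 ^ 2 + p.2 ^ 2))) := by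
  have h := integral_wave_abs hp
  simp only [superpos, rate_zero, neg_mul, one_mul, integral_neg, h]
  have : (2 * (p.1 : ℂ) / (p.1 ^ 2 + p.2 ^ 2)) = ((2 * (p.1 / (p.1 ^ 2 + p.2 ^ 2)) : ℝ) : ℂ) := by
    push_cast; ring
  rw [this, Complex.neg_re, Complex.ofReal_re]

lemma superpos_zero_I_sign {p : ℝ × ℝ} (hp : 0 < p.1) :
    (superpos 0 (fun lam => Complex.I * (lam / rate 0 lam)) p).re =
      -(2 * (p.2 / (p.1 ^ 2 + p.2 ^ 2))) := by
  have h := integral_csgn_mul_wave hp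
  simp only [csgn_eq] at h
  simp only [superpos, rate_zero, mul_assoc]
  rw [integral_const_mul, h]
  have : Complex.I * (2 * Complex.I * p.2 / ((p.1 : ℂ) ^ 2 + p.2 ^ 2)) =
      ((-(2 * (p.2 / (p.1 ^ 2 + p.2 ^ 2))) : ℝ) : ℂ) := by
    push_cast
    rw [mul_div_assoc, ← mul_assoc, ← mul_assoc]
    rw [show Complex.I * 2 * Complex.I = -2 by ring_nf; rw [Complex.I_sq]; ring]
    ring
  rw [this, Complex.ofReal_re]

lemma modBiharmonic_eq {β : ℝ} (hβ : 0 < β) {x : ℝ} (hx : 0 < x) (y : ℝ) :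
    modBiharmonic β x y = -(1 / (2 * π * β ^ 2)) * (1 / 2 *
      ((superpos β (fun lam => 1 / (rate β lam : ℂ)) (x, y)).re + Real.log (x ^ 2 + y ^ 2))) := by
  have h := congrArg Complex.re (besselK₀_eq_superpos hβ (p := (x, y)) hx)
  rw [Complex.ofReal_re, show (1 / 2 : ℂ) = ((1 / 2 : ℝ) : ℂ) by push_cast; ring,
    Complex.re_ofReal_mul] at h
  rw [modBiharmonic, h, len, one_div (√_), Real.log_inv, Real.log_sqrt (by positivity)]
  ring

lemma hasDerivAt_modBiharmonic_fst {β : ℝ} (hβ : 0 < β) {x : ℝ} (hx : 0 < x) (y : ℝ) :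
    HasDerivAt (fun x => modBiharmonic β x y) (-(1 / (4 * π * β ^ 2)) *
      ((superpos β (fun _ => -1) (x, y)).re - (superpos 0 (fun _ => -1) (x, y)).re)) x := by
  have hm := measurable_ofReal_rate β
  have h1 := hasDerivAt_re (hasDerivAt_superpos_fst (β := β) (c := fun lam => 1 / (rate β lam : ℂ))
    (by fun_prop) (norm_one_div_rate_le hβ) hx y)
  have hpos : 0 < x ^ 2 + y ^ 2 := by positivity
  have h2 := ((hasDerivAt_pow 2 x).add_const (y ^ 2)).log hpos.ne'
  have h3 := ((h1.add h2).const_mul (1 / 2)).const_mul (-(1 / (2 * π * β ^ 2)))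
  refine (h3.congr_of_eventuallyEq ?_).congr_deriv ?_
  · filter_upwards [lt_mem_nhds hx] with t ht
    exact modBiharmonic_eq hβ ht y
  · rw [superpos_zero_one (p := (x, y)) hx]
    have : (fun lam => 1 / (rate β lam : ℂ) * (-(rate β lam : ℂ))) = fun _ => -1 := by
      ext lam
      have hne : (rate β lam : ℂ) ≠ 0 := by exact_mod_cast (hβ.trans_le (le_rate β lam)).ne'
      field_simp
    rw [this]
    norm_num
    field_simp
    ring

lemma hasDerivAt_modBiharmonic_snd {β : ℝ} (hβ : 0 < β) {x : ℝ} (hx : 0 < x) (y : ℝ) :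
    HasDerivAt (fun y => modBiharmonic β x y) (-(1 / (4 * π * β ^ 2)) *
      ((superpos β (fun lam => Complex.I * (lam / rate β lam)) (x, y)).re -
        (superpos 0 (fun lam => Complex.I * (lam / rate 0 lam)) (x, y)).re)) y := by
  have hm := measurable_ofReal_rate β
  have h1 := hasDerivAt_re (hasDerivAt_superpos_snd (β := β) (c := fun lam => 1 / (rate β lam : ℂ))
    (by fun_prop) (norm_one_div_rate_le hβ) hx y)
  have hpos : 0 < x ^ 2 + y ^ 2 := by positivity
  have h2 := ((hasDerivAt_pow 2 y).const_add (x ^ 2)).log hpos.ne'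
  have h3 := ((h1.add h2).const_mul (1 / 2)).const_mul (-(1 / (2 * π * β ^ 2)))
  refine (h3.congr_of_eventuallyEq ?_).congr_deriv ?_
  · filter_upwards with t
    exact modBiharmonic_eq hβ hx t
  · rw [superpos_zero_I_sign (p := (x, y)) hx]
    have : (fun lam : ℝ => 1 / (rate β lam : ℂ) * (Complex.I * lam)) =
        fun lam : ℝ => Complex.I * (lam / rate β lam) := by
      ext lam
      ring
    rw [this]
    norm_num
    field_simp
    ring

/-- The modified Stokeslet as a superposition of plane waves, east of the source. -/
theorem modStokeslet_apply {β : ℝ} (hβ : 0 < β) {p : ℝ × ℝ} (hp : 0 < p.1) (a b : Fin 2) :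
    modStokeslet β p a b = 1 / (4 * π * β ^ 2) *
      (∫ lam, (biSymb (rate β lam) lam p a b - biSymb |lam| lam p a b)).re := by
  have hsub : ∀ a b, ∫ lam, (biSymb (rate β lam) lam p a b - biSymb |lam| lam p a b) =
      superpos β (fun lam => biAmp β lam a b) p - superpos 0 (fun lam => biAmp 0 lam a b) p := by
    intro a b
    rw [← integral_biSymb, ← integral_biSymb, ← integral_sub (integrable_biSymb β hp a b)
      (integrable_biSymb 0 hp a b)]
    simp only [rate_zero]
  have hm : ∀ β, Measurable fun lam : ℝ => Complex.I * (lam / rate β lam : ℂ) := fun β => by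
    have := measurable_ofReal_rate β
    fun_prop
  have hI : ∀ β lam, ‖Complex.I * (lam / rate β lam : ℂ)‖ ≤ 1 := fun β lam => by
    rw [norm_mul, Complex.norm_I, one_mul]; exact norm_div_rate_le β lam
  have fst := fun (c : ℝ → ℝ → ℂ) (hc : ∀ β, Measurable (c β)) (hB : ∀ β lam, ‖c β lam‖ ≤ 1) =>
    ((hasDerivAt_re (hasDerivAt_superpos_fst (β := β) (hc β) (hB β) hp p.2)).sub
      (hasDerivAt_re (hasDerivAt_superpos_fst (β := 0) (hc 0) (hB 0) hp p.2))).const_mul (-(1 / (4 * π * β ^ 2)))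
  have hxx : deriv (fun x => deriv (fun x' => modBiharmonic β x' p.2) x) p.1 =
      -(1 / (4 * π * β ^ 2)) * ((superpos β (fun lam => biAmp β lam 1 1) p).re -
        (superpos 0 (fun lam => biAmp 0 lam 1 1) p).re) := by
    refine (HasDerivAt.congr_of_eventuallyEq
      (fst (fun _ _ => -1) (fun _ => measurable_const) (by simp)) ?_).deriv.trans ?_
    -- The formula for the first derivative holds only for positive abscissas, so the functions
    -- agree merely near `p.1`.
    · filter_upwards [lt_mem_nhds hp] with t ht
      exact (hasDerivAt_modBiharmonic_fst hβ ht p.2).deriv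
    · simp [biAmp]
  have hxy : deriv (fun x => deriv (fun y => modBiharmonic β x y) p.2) p.1 =
      (1 / (4 * π * β ^ 2)) * ((superpos β (fun lam => biAmp β lam 0 1) p).re -
        (superpos 0 (fun lam => biAmp 0 lam 0 1) p).re) := by
    refine (HasDerivAt.congr_of_eventuallyEq
      (fst (fun β lam => Complex.I * (lam / rate β lam)) hm hI) ?_).deriv.trans ?_
    · filter_upwards [lt_mem_nhds hp] with t ht
      exact (hasDerivAt_modBiharmonic_snd hβ ht p.2).deriv
    · have : ∀ β, superpos β (fun lam => Complex.I * (lam / rate β lam) * (-(rate β lam : ℂ))) p =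
          - superpos β (fun lam => biAmp β lam 0 1) p := by
        intro β
        rw [superpos, superpos, ← integral_neg]
        refine integral_congr_ae ?_
        -- The statement includes `β = 0`, where the rate vanishes at `λ = 0`.
        filter_upwards [ae_ne_zero] with lam h
        have hne : (rate β lam : ℂ) ≠ 0 := by
          exact_mod_cast ((abs_pos.2 h).trans_le (abs_le_rate β lam)).ne'
        simp only [biAmp, Matrix.of_apply, Matrix.cons_val_zero, Matrix.cons_val_one]
        field_simp
      simp only [Prod.mk.eta, this, Complex.neg_re]
      ring
  have hyy : deriv (fun y => deriv (fun y' => modBiharmonic β p.1 y') y) p.2 =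
      -(1 / (4 * π * β ^ 2)) * ((superpos β (fun lam => biAmp β lam 0 0) p).re -
        (superpos 0 (fun lam => biAmp 0 lam 0 0) p).re) := by
    have h := ((hasDerivAt_re (hasDerivAt_superpos_snd (β := β) (hm β) (hI β) hp p.2)).sub
      (hasDerivAt_re (hasDerivAt_superpos_snd (β := 0) (hm 0) (hI 0) hp p.2))).const_mul
        (-(1 / (4 * π * β ^ 2)))
    refine (h.congr_of_eventuallyEq ?_).deriv.trans ?_
    · filter_upwards with t
      exact (hasDerivAt_modBiharmonic_snd hβ hp t).deriv
    · have : ∀ β, (fun lam : ℝ => Complex.I * (lam / rate β lam : ℂ) * (Complex.I * lam)) =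
          fun lam => biAmp β lam 0 0 := by
        intro β
        ext lam
        simp only [biAmp, Matrix.of_apply, Matrix.cons_val_zero]
        ring_nf
        rw [Complex.I_sq]
        ring
      simp only [Prod.mk.eta, this]
  rw [hsub, Complex.sub_re]
  have h10 : ∀ β, (fun lam => biAmp β lam 1 0) = fun lam => biAmp β lam 0 1 := fun _ => rfl
  fin_cases a <;> fin_cases b <;> simp only [Fin.zero_eta, Fin.mk_one, h10] <;>
    simp only [modStokeslet, hxx, hyy, hxy, Matrix.of_apply, Matrix.cons_val_zero,
      Matrix.cons_val_one] <;> ring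

/-! ### Second differences -/

/-- The mixed second difference of `F` at `p` with increments `a` and `b`. -/
def dd {E : Type*} [AddCommGroup E] (F : ℝ × ℝ → E) (p a b : ℝ × ℝ) : E :=
  F (p + a + b) - F (p + b) - F (p + a) + F p

/-- The abscissas of the four points of a mixed second difference are at least `X`, at most
comparable to `X`, and the increments have size at most `K`. -/
structure IsEast (p a b : ℝ × ℝ) (X K κ : ℝ) : Prop where
  pos : 0 < X
  le₀₀ : X ≤ p.1
  le₁₀ : X ≤ (p + a).1
  le₀₁ : X ≤ (p + b).1
  le₁₁ : X ≤ (p + a + b).1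
  le_mul : p.1 ≤ κ * X
  left_le : |a.1| + |a.2| ≤ K
  right_le : |b.1| + |b.2| ≤ K

lemma wave_zero (ν lam : ℝ) : wave ν lam 0 = 1 := by simp [wave]

/-- An increment may point west, where the wave grows; hence the minimum with `0`. -/
lemma norm_wave_sub_one_le {ν lam : ℝ} (h : |lam| ≤ ν) (a : ℝ × ℝ) :
    ‖wave ν lam a - 1‖ ≤ ν * (|a.1| + |a.2|) * Real.exp (-(ν * min a.1 0)) := by
  simpa [wave_zero] using norm_wave_sub_wave_le h (p := a) (q := 0) (a := min a.1 0)
    (min_le_left _ _) (by simp)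

/-- Waves are characters of the plane, so the second difference factors, and each of the last two
factors is `O(ν)` for small `ν`. -/
lemma dd_wave (ν lam : ℝ) (p a b : ℝ × ℝ) :
    dd (wave ν lam) p a b = wave ν lam p * (wave ν lam a - 1) * (wave ν lam b - 1) := by
  simp only [dd, wave_add]
  ring

/-- Discrete Leibniz rule: where one increment falls on the linear factor, a first difference of the
wave in the other increment remains. -/
lemma dd_fst_mul_wave (ν lam : ℝ) (p a b : ℝ × ℝ) :
    dd (fun p => (p.1 : ℂ) * wave ν lam p) p a b = p.1 * dd (wave ν lam) p a b +
      a.1 * (wave ν lam (p + a + b) - wave ν lam (p + a)) +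
      b.1 * (wave ν lam (p + b + a) - wave ν lam (p + b)) := by
  simp only [dd, wave_add, Prod.fst_add]
  push_cast
  ring

section

variable {p a b : ℝ × ℝ} {X K κ : ℝ}

lemma norm_dd_wave_le (c : IsEast p a b X K κ) {ν lam : ℝ} (h : |lam| ≤ ν) :
    ‖dd (wave ν lam) p a b‖ ≤ (ν * K) ^ 2 * Real.exp (-(ν * X)) := by
  have hν : 0 ≤ ν := (abs_nonneg _).trans h
  have hK : 0 ≤ K := le_trans (by positivity) c.left_le
  rw [dd_wave, norm_mul, norm_mul, norm_wave]
  -- The right side is the smallest abscissa among the four corners.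
  have hmin : X ≤ p.1 + min a.1 0 + min b.1 0 := by
    have h1 := c.le₀₀
    have h2 := c.le₁₀
    have h3 := c.le₀₁
    have h4 := c.le₁₁
    simp only [Prod.fst_add] at h2 h3 h4
    rcases min_cases a.1 0 with ⟨e1, _⟩ | ⟨e1, _⟩ <;> rcases min_cases b.1 0 with ⟨e2, _⟩ | ⟨e2, _⟩ <;>
      rw [e1, e2] <;> linarith
  calc _ ≤ Real.exp (-(ν * p.1)) * (ν * K * Real.exp (-(ν * min a.1 0))) *
        (ν * K * Real.exp (-(ν * min b.1 0))) := by
        gcongr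
        · exact (norm_wave_sub_one_le h a).trans (by gcongr; exact c.left_le)
        · exact (norm_wave_sub_one_le h b).trans (by gcongr; exact c.right_le)
    _ = (ν * K) ^ 2 * Real.exp (-(ν * (p.1 + min a.1 0 + min b.1 0))) := by
        rw [show -(ν * (p.1 + min a.1 0 + min b.1 0)) =
          -(ν * p.1) + -(ν * min a.1 0) + -(ν * min b.1 0) by ring, Real.exp_add, Real.exp_add]
        ring
    _ ≤ _ := by gcongr

/-- The first Leibniz term carries the large factor `p.1`; comparability `p.1 ≤ κ X` lets the
exponential absorb it later. The two edge terms give the coefficient `2`. -/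
lemma norm_dd_fst_mul_wave_le (c : IsEast p a b X K κ) {ν lam : ℝ} (h : |lam| ≤ ν) :
    ‖dd (fun p => (p.1 : ℂ) * wave ν lam p) p a b‖ ≤
      K ^ 2 * (κ * (ν ^ 2 * X * Real.exp (-(ν * X))) + 2 * (ν * Real.exp (-(ν * X)))) := by
  have hν : 0 ≤ ν := (abs_nonneg _).trans h
  have hK : 0 ≤ K := le_trans (by positivity) c.left_le
  have hp : 0 ≤ p.1 := c.pos.le.trans c.le₀₀
  rw [dd_fst_mul_wave]
  have hedge : ∀ q a b : ℝ × ℝ, X ≤ (q + b).1 → X ≤ q.1 → |a.1| ≤ K → |b.1| + |b.2| ≤ K →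
      ‖(a.1 : ℂ) * (wave ν lam (q + b) - wave ν lam q)‖ ≤ K * (ν * K * Real.exp (-(ν * X))) := by
    intro q a b h1 h2 ha hb
    rw [norm_mul, Complex.norm_real, Real.norm_eq_abs]
    have := norm_wave_sub_wave_le h h1 h2
    simp only [Prod.fst_add, Prod.snd_add, add_sub_cancel_left] at this
    have : ‖wave ν lam (q + b) - wave ν lam q‖ ≤ ν * K * Real.exp (-(ν * X)) :=
      this.trans (by gcongr)
    gcongr
  have h1 := hedge (p + a) a b c.le₁₁ c.le₁₀ (by linarith [c.left_le, abs_nonneg a.2]) c.right_le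
  have h2 := hedge (p + b) b a (by rw [add_right_comm]; exact c.le₁₁) c.le₀₁
    (by linarith [c.right_le, abs_nonneg b.2]) c.left_le
  have h3 : ‖(p.1 : ℂ) * dd (wave ν lam) p a b‖ ≤ (κ * X) * ((ν * K) ^ 2 * Real.exp (-(ν * X))) := by
    rw [norm_mul, Complex.norm_real, Real.norm_eq_abs, abs_of_nonneg hp]
    have := norm_dd_wave_le c h
    have hk : 0 ≤ κ * X := hp.trans c.le_mul
    gcongr
    exact c.le_mul
  refine (norm_add₃_le).trans ?_
  linarith

/-- The coefficients of `symb`: it is `(A / ν + x B) exp (-ν x + i λ y)`. -/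
lemma exists_symb_coeff {ν lam : ℝ} (hν : 0 < ν) (h : |lam| ≤ ν) (i j : Fin 2) :
    ∃ A B : ℂ, ‖A‖ ≤ 1 ∧ ‖B‖ ≤ 1 ∧ ∀ p, symb ν lam p i j =
      A * ((1 / ν : ℝ) * wave ν lam p) + B * (p.1 * wave ν lam p) := by
  have hq : ‖(lam / ν : ℂ)‖ ≤ 1 := by
    rw [norm_div, Complex.norm_real, Complex.norm_real, Real.norm_eq_abs, Real.norm_eq_abs,
      abs_of_pos hν]
    exact div_le_one_of_le₀ h hν.le
  have hI : ‖-(Complex.I * (lam / ν : ℂ))‖ ≤ 1 := by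
    rwa [norm_neg, norm_mul, Complex.norm_I, one_mul]
  have hq2 : ‖(lam / ν : ℂ) ^ 2‖ ≤ 1 := by
    rw [norm_pow]; exact pow_le_one₀ (norm_nonneg _) hq
  fin_cases i <;> fin_cases j
  · exact ⟨(lam / ν : ℂ) ^ 2, (lam / ν : ℂ) ^ 2, hq2, hq2, fun p => by
      show wave ν lam p * ((lam / ν : ℂ) ^ 2 * (1 / ν + p.1)) = _
      push_cast; ring⟩
  · exact ⟨0, -(Complex.I * (lam / ν : ℂ)), by simp, hI, fun p => by
      show wave ν lam p * (-(Complex.I * (lam / ν : ℂ) * p.1)) = _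
      ring⟩
  · exact ⟨0, -(Complex.I * (lam / ν : ℂ)), by simp, hI, fun p => by
      show wave ν lam p * (-(Complex.I * (lam / ν : ℂ) * p.1)) = _
      ring⟩
  · exact ⟨1, -1, by simp, by simp, fun p => by
      show wave ν lam p * (1 / ν - p.1 : ℂ) = _
      push_cast; ring⟩

/-- Each factor `ν` is traded for a quarter of the decay, so half of it survives. -/
lemma sq_mul_exp_neg_le {ν X : ℝ} (hX : 0 < X) (hν : 0 ≤ ν) :
    ν ^ 2 * X * Real.exp (-(ν * X)) ≤ 16 / X * Real.exp (-(ν * (X / 2))) := by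
  have h := le_mul_exp (x := ν) (show 0 < X / 4 by positivity)
  have h2 : ν ^ 2 ≤ (1 / (X / 4) * Real.exp (ν * (X / 4))) ^ 2 := by gcongr
  calc ν ^ 2 * X * Real.exp (-(ν * X))
      ≤ (1 / (X / 4) * Real.exp (ν * (X / 4))) ^ 2 * X * Real.exp (-(ν * X)) := by gcongr
    _ = 16 / X * (Real.exp (ν * (X / 4)) * Real.exp (ν * (X / 4)) * Real.exp (-(ν * X))) := by
        field_simp; ring
    _ = _ := by
        rw [← Real.exp_add, ← Real.exp_add]; ring_nf

/-- The square gained by the second difference outweighs the amplitude `1/ν`. One such term and two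
edge terms give `3 ν exp (-ν X)`, whence `6 = 3 · 2`; the Leibniz term with `p.1` gives `16 κ`. The
bound depends on `lam` only, not on `ν ≥ |lam|`, which later makes it uniform in `β`. -/
lemma norm_dd_symb_le (c : IsEast p a b X K κ) {ν lam : ℝ} (hν : 0 < ν) (h : |lam| ≤ ν)
    (i j : Fin 2) : ‖dd (fun p => symb ν lam p i j) p a b‖ ≤
      K ^ 2 * (6 + 16 * κ) / X * Real.exp (-(|lam| * (X / 2))) := by
  obtain ⟨A, B, hA, hB, e⟩ := exists_symb_coeff hν h i j
  have hX := c.pos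
  have hκ : 0 ≤ κ := by
    have := (c.pos.le.trans c.le₀₀).trans c.le_mul
    exact nonneg_of_mul_nonneg_left this c.pos
  have e1 : dd (fun p => symb ν lam p i j) p a b = A * ((1 / ν : ℝ) * dd (wave ν lam) p a b) +
      B * dd (fun p => (p.1 : ℂ) * wave ν lam p) p a b := by
    simp only [dd, e]; ring
  rw [e1]
  refine (norm_add_le _ _).trans ?_
  rw [norm_mul, norm_mul B, norm_mul, Complex.norm_real, Real.norm_eq_abs,
    abs_of_pos (one_div_pos.2 hν)]
  have h1 : 1 / ν * ‖dd (wave ν lam) p a b‖ ≤ K ^ 2 * (ν * Real.exp (-(ν * X))) := by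
    calc _ ≤ 1 / ν * ((ν * K) ^ 2 * Real.exp (-(ν * X))) := by
          gcongr; exact norm_dd_wave_le c h
      _ = _ := by field_simp
  have h2 := norm_dd_fst_mul_wave_le c h
  have h3 := mul_exp_neg_le (ν := ν) hX
  have h4 := sq_mul_exp_neg_le hX hν.le
  have h5 : Real.exp (-(ν * (X / 2))) ≤ Real.exp (-(|lam| * (X / 2))) := by gcongr
  calc _ ≤ 1 * (K ^ 2 * (ν * Real.exp (-(ν * X)))) +
        1 * (K ^ 2 * (κ * (ν ^ 2 * X * Real.exp (-(ν * X))) + 2 * (ν * Real.exp (-(ν * X))))) := by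
        gcongr
    _ = K ^ 2 * (3 * (ν * Real.exp (-(ν * X))) + κ * (ν ^ 2 * X * Real.exp (-(ν * X)))) := by ring
    _ ≤ K ^ 2 * (3 * (2 / X * Real.exp (-(ν * (X / 2)))) +
        κ * (16 / X * Real.exp (-(ν * (X / 2))))) := by gcongr
    _ = K ^ 2 * (6 + 16 * κ) / X * Real.exp (-(ν * (X / 2))) := by ring
    _ ≤ _ := by gcongr

/-- The link between the two Green's tensors: with the squared rate `u = ν²` as variable, the
derivative of the modified symbol is half the Stokeslet symbol. -/
lemma hasDerivAt_biSymb {u : ℝ} (hu : 0 < u) (lam : ℝ) (p : ℝ × ℝ) (i j : Fin 2) :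
    HasDerivAt (fun u => biSymb (√u) lam p i j) (1 / 2 * symb (√u) lam p i j) u := by
  have hs : 0 < √u := Real.sqrt_pos.2 hu
  have hsC : ((√u : ℝ) : ℂ) ≠ 0 := by exact_mod_cast hs.ne'
  have h1 : HasDerivAt (fun u => ((√u : ℝ) : ℂ)) ((1 / (2 * √u) : ℝ) : ℂ) u :=
    ((hasDerivAt_id u).sqrt hu.ne').ofReal_comp
  have hw : HasDerivAt (fun u => wave (√u) lam p)
      (wave (√u) lam p * (-(((1 / (2 * √u) : ℝ) : ℂ) * p.1))) u := by
    have := ((h1.mul_const (p.1 : ℂ)).neg.add_const (Complex.I * ((lam * p.2 : ℝ) : ℂ))).cexp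
    simpa [wave] using this
  have hoff : HasDerivAt (fun u => biSymb (√u) lam p 0 1) (1 / 2 * symb (√u) lam p 0 1) u := by
    have := hw.mul_const (Complex.I * lam)
    refine this.congr_deriv ?_
    show _ = 1 / 2 * (wave (√u) lam p * -(Complex.I * ((lam : ℂ) / ((√u : ℝ) : ℂ)) * p.1))
    push_cast
    field_simp
  have h00 : HasDerivAt (fun u => biSymb (√u) lam p 0 0) (1 / 2 * symb (√u) lam p 0 0) u := by
    have := hw.mul (((h1.inv hsC).const_mul (lam : ℂ)).const_mul (lam : ℂ)).neg
    refine (this.congr_of_eventuallyEq (Eventually.of_forall fun u => ?_)).congr_deriv ?_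
    · show wave (√u) lam p * -((lam : ℂ) * (lam / ((√u : ℝ) : ℂ))) = _
      rw [div_eq_mul_inv]; rfl
    · show _ = 1 / 2 * (wave (√u) lam p * (((lam : ℂ) / ((√u : ℝ) : ℂ)) ^ 2 *
        (1 / ((√u : ℝ) : ℂ) + p.1)))
      simp only [Pi.neg_apply, Pi.inv_apply]
      push_cast
      field_simp
      ring
  have h11 : HasDerivAt (fun u => biSymb (√u) lam p 1 1) (1 / 2 * symb (√u) lam p 1 1) u := by
    have := hw.mul h1
    refine this.congr_deriv ?_
    show _ = 1 / 2 * (wave (√u) lam p * (1 / ((√u : ℝ) : ℂ) - p.1))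
    push_cast
    field_simp
    ring
  fin_cases i <;> fin_cases j
  exacts [h00, hoff, hoff, h11]

lemma hasDerivAt_dd_biSymb {u : ℝ} (hu : 0 < u) (lam : ℝ) (p a b : ℝ × ℝ) (i j : Fin 2) :
    HasDerivAt (fun u => dd (fun p => biSymb (√u) lam p i j) p a b)
      (1 / 2 * dd (fun p => symb (√u) lam p i j) p a b) u := by
  have h := fun p => hasDerivAt_biSymb hu lam p i j
  refine ((((h (p + a + b)).sub (h (p + b))).sub (h (p + a))).add (h p)).congr_deriv ?_
  simp only [dd]
  ring

/-- Mean value inequality in `u` from `λ²` to `λ² + β²`; on this ray `√u ≥ |λ|`, so the bound of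
`norm_dd_symb_le` applies throughout. -/
lemma norm_dd_biSymb_sub_le (c : IsEast p a b X K κ) (β : ℝ) {lam : ℝ} (hlam : lam ≠ 0)
    (i j : Fin 2) : ‖dd (fun p => biSymb (rate β lam) lam p i j) p a b -
      dd (fun p => biSymb |lam| lam p i j) p a b‖ ≤
      1 / 2 * (K ^ 2 * (6 + 16 * κ) / X * Real.exp (-(|lam| * (X / 2)))) * β ^ 2 := by
  have h0 : 0 < lam ^ 2 := by positivity
  have h := Convex.norm_image_sub_le_of_norm_hasDerivWithin_le (s := Ici (lam ^ 2))
    (f := fun u => dd (fun p => biSymb (√u) lam p i j) p a b)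
    (C := 1 / 2 * (K ^ 2 * (6 + 16 * κ) / X * Real.exp (-(|lam| * (X / 2)))))
    (fun u hu => (hasDerivAt_dd_biSymb (h0.trans_le hu) lam p a b i j).hasDerivWithinAt)
    (fun u hu => by
      rw [norm_mul]
      have := norm_dd_symb_le c (ν := √u) (lam := lam) (Real.sqrt_pos.2 (h0.trans_le hu))
        (by rw [← Real.sqrt_sq_eq_abs]; exact Real.sqrt_le_sqrt hu) i j
      rw [show ‖(1 / 2 : ℂ)‖ = 1 / 2 by norm_num]
      linarith)
    (convex_Ici _) (self_mem_Ici (a := lam ^ 2))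
    (show lam ^ 2 + β ^ 2 ∈ Ici (lam ^ 2) from le_add_of_nonneg_right (sq_nonneg β))
  simpa [rate, Real.sqrt_sq_eq_abs] using h

/-- The mixed second difference of the Stokeslet, in terms of plane waves. -/
theorem dd_stokeslet (c : IsEast p a b X K κ) (i j : Fin 2) :
    (Integrable fun lam : ℝ => dd (fun p => symb |lam| lam p i j) p a b) ∧
    ((dd (fun p => stokeslet p i j) p a b : ℝ) : ℂ) = (1 / (8 * π) : ℝ) *
      ∫ lam : ℝ, dd (fun p => symb |lam| lam p i j) p a b := by
  obtain ⟨i1, e1⟩ := stokeslet_sub_stokeslet (c.pos.trans_le c.le₁₁) (c.pos.trans_le c.le₀₁) i j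
  obtain ⟨i2, e2⟩ := stokeslet_sub_stokeslet (c.pos.trans_le c.le₁₀) (c.pos.trans_le c.le₀₀) i j
  have e : (fun lam : ℝ => dd (fun p => symb |lam| lam p i j) p a b) = fun lam =>
      (symb |lam| lam (p + a + b) i j - symb |lam| lam (p + b) i j) -
        (symb |lam| lam (p + a) i j - symb |lam| lam p i j) := by
    ext lam; simp only [dd]; ring
  rw [e]
  refine ⟨i1.sub i2, ?_⟩
  rw [integral_sub i1 i2, mul_sub, ← e1, ← e2, ← Complex.ofReal_sub]
  congr 1
  simp only [dd]; ring

lemma integral_dd {F : ℝ → ℝ × ℝ → ℂ} (h11 : Integrable fun lam => F lam (p + a + b))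
    (h01 : Integrable fun lam => F lam (p + b)) (h10 : Integrable fun lam => F lam (p + a))
    (h00 : Integrable fun lam => F lam p) :
    ∫ lam, dd (F lam) p a b = dd (fun p => ∫ lam, F lam p) p a b := by
  have i1 : Integrable fun lam => F lam (p + a + b) - F lam (p + b) := h11.sub h01
  have i2 : Integrable fun lam => F lam (p + a + b) - F lam (p + b) - F lam (p + a) := i1.sub h10
  simp only [dd]
  rw [integral_add i2 h00, integral_sub i1 h10, integral_sub h11 h01]

/-- The factor `β⁻²` is put under the integral so that the integrand is a difference quotient of
step `β²` in the squared rate. -/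
lemma dd_modStokeslet (c : IsEast p a b X K κ) {β : ℝ} (hβ : 0 < β) (i j : Fin 2) :
    dd (fun p => modStokeslet β p i j) p a b = 1 / (4 * π) *
      (∫ lam, (β ^ 2 : ℝ)⁻¹ • (dd (fun p => biSymb (rate β lam) lam p i j) p a b -
        dd (fun p => biSymb |lam| lam p i j) p a b)).re := by
  have p11 := c.pos.trans_le c.le₁₁
  have p01 := c.pos.trans_le c.le₀₁
  have p10 := c.pos.trans_le c.le₁₀
  have p00 := c.pos.trans_le c.le₀₀
  have e : (fun lam : ℝ => (β ^ 2 : ℝ)⁻¹ • (dd (fun p => biSymb (rate β lam) lam p i j) p a b -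
        dd (fun p => biSymb |lam| lam p i j) p a b)) = fun lam => (β ^ 2 : ℝ)⁻¹ •
      dd (fun p => biSymb (rate β lam) lam p i j - biSymb |lam| lam p i j) p a b := by
    ext lam; simp only [dd]; congr 1; ring
  rw [e, integral_smul, integral_dd (integrable_biSymb_sub β p11 i j)
    (integrable_biSymb_sub β p01 i j) (integrable_biSymb_sub β p10 i j)
    (integrable_biSymb_sub β p00 i j), Complex.smul_re]
  simp only [dd, modStokeslet_apply hβ p11, modStokeslet_apply hβ p01, modStokeslet_apply hβ p10,
    modStokeslet_apply hβ p00, Complex.add_re, Complex.sub_re, smul_eq_mul]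
  ring

lemma norm_smul_dd_biSymb_sub_le (c : IsEast p a b X K κ) {β : ℝ} (hβ : 0 < β) (i j : Fin 2) :
    ∀ᵐ lam : ℝ, ‖(β ^ 2 : ℝ)⁻¹ • (dd (fun p => biSymb (rate β lam) lam p i j) p a b -
        dd (fun p => biSymb |lam| lam p i j) p a b)‖ ≤
      1 / 2 * (K ^ 2 * (6 + 16 * κ) / X) * Real.exp (-(|lam| * (X / 2))) := by
  filter_upwards [ae_ne_zero] with lam hlam
  rw [norm_smul, Real.norm_eq_abs, abs_of_pos (by positivity)]
  have h := norm_dd_biSymb_sub_le c β hlam i j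
  rw [inv_mul_le_iff₀ (by positivity)]
  linarith

/-- The uniform bound for mixed second differences of the modified Stokeslet. -/
theorem abs_dd_modStokeslet_le (c : IsEast p a b X K κ) {β : ℝ} (hβ : 0 < β) (i j : Fin 2) :
    |dd (fun p => modStokeslet β p i j) p a b| ≤ K ^ 2 * (6 + 16 * κ) / X ^ 2 := by
  have hX := c.pos
  have hκ : 0 ≤ κ := by
    have := (c.pos.le.trans c.le₀₀).trans c.le_mul
    exact nonneg_of_mul_nonneg_left this c.pos
  rw [dd_modStokeslet c hβ, abs_mul, abs_of_pos (by positivity)]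
  have h := norm_integral_le_of_norm_le ((integrable_exp_neg_mul_abs (half_pos hX)).const_mul
    (1 / 2 * (K ^ 2 * (6 + 16 * κ) / X))) (norm_smul_dd_biSymb_sub_le c hβ i j)
  -- The integral of the exponential is `4 / X`; it supplies the second power of `1/X`, which makes
  -- the bound summable over the cells.
  rw [integral_const_mul, integral_exp_neg_mul_abs (half_pos hX)] at h
  have h2 := (Complex.abs_re_le_norm _).trans h
  have h3 : 1 / (4 * π) ≤ 1 / 2 := by
    apply one_div_le_one_div_of_le (by norm_num)
    linarith [Real.pi_gt_three]
  calc _ ≤ 1 / 2 * (1 / 2 * (K ^ 2 * (6 + 16 * κ) / X) * (2 / (X / 2))) := by gcongr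
    _ = _ := by field_simp

/-- Mixed second differences of the modified Stokeslet tend to those of the Stokeslet. -/
theorem tendsto_dd_modStokeslet (c : IsEast p a b X K κ) (i j : Fin 2) :
    Tendsto (fun β => dd (fun p => modStokeslet β p i j) p a b) (𝓝[>] 0)
      (𝓝 (dd (fun p => stokeslet p i j) p a b)) := by
  have hS : dd (fun p => stokeslet p i j) p a b = 1 / (4 * π) *
      (∫ lam : ℝ, (1 / 2 : ℂ) * dd (fun p => symb |lam| lam p i j) p a b).re := by
    have h := congrArg Complex.re (dd_stokeslet c i j).2
    rw [Complex.re_ofReal_mul] at h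
    rw [← Complex.ofReal_re (dd _ _ _ _), h, integral_const_mul, show (1 / 2 : ℂ) = ((1 / 2 : ℝ) : ℂ) by push_cast; ring,
      Complex.re_ofReal_mul]
    ring
  rw [hS]
  have hlim : Tendsto (fun β : ℝ => ∫ lam, (β ^ 2 : ℝ)⁻¹ •
      (dd (fun p => biSymb (rate β lam) lam p i j) p a b -
        dd (fun p => biSymb |lam| lam p i j) p a b)) (𝓝[>] 0)
      (𝓝 (∫ lam : ℝ, (1 / 2 : ℂ) * dd (fun p => symb |lam| lam p i j) p a b)) := by
    refine tendsto_integral_filter_of_dominated_convergence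
      (fun lam => 1 / 2 * (K ^ 2 * (6 + 16 * κ) / X) * Real.exp (-(|lam| * (X / 2)))) ?_ ?_
      ((integrable_exp_neg_mul_abs (half_pos c.pos)).const_mul _) ?_
    · refine Eventually.of_forall fun β => ?_
      have hm : ∀ β p, AEStronglyMeasurable (fun lam => biSymb (rate β lam) lam p i j) volume := by
        intro β p
        simp_rw [biSymb_apply]
        exact ((measurable_biAmp β i j).mul
          (measurable_wave (continuous_rate β).measurable p)).aestronglyMeasurable
      have hm0 := hm 0
      simp only [rate_zero] at hm0
      have h1 : AEStronglyMeasurable (fun lam =>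
          dd (fun p => biSymb (rate β lam) lam p i j) p a b) volume :=
        (((hm β _).sub (hm β _)).sub (hm β _)).add (hm β _)
      have h2 : AEStronglyMeasurable (fun lam => dd (fun p => biSymb |lam| lam p i j) p a b) volume :=
        (((hm0 _).sub (hm0 _)).sub (hm0 _)).add (hm0 _)
      exact (h1.sub h2).const_smul ((β ^ 2)⁻¹)
    · filter_upwards [self_mem_nhdsWithin] with β hβ
      exact norm_smul_dd_biSymb_sub_le c hβ i j
    · filter_upwards [ae_ne_zero] with lam hlam
      -- Pointwise, the limit is a slope at `u = λ²` along the steps `β² → 0`.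
      have hd := (hasDerivAt_dd_biSymb (u := lam ^ 2) (by positivity) lam p a b i j).tendsto_slope_zero
      have hsq : Tendsto (fun β : ℝ => β ^ 2) (𝓝[>] 0) (𝓝[≠] 0) := by
        refine tendsto_nhdsWithin_iff.2 ⟨?_, ?_⟩
        · have : Tendsto (fun β : ℝ => β ^ 2) (𝓝 0) (𝓝 (0 ^ 2)) := (continuous_pow 2).tendsto 0
          rw [zero_pow two_ne_zero] at this
          exact this.mono_left nhdsWithin_le_nhds
        · filter_upwards [self_mem_nhdsWithin] with β hβ
          exact pow_ne_zero 2 (ne_of_gt hβ)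
      have := hd.comp hsq
      simp only [Real.sqrt_sq_eq_abs] at this
      exact this
  refine ((Complex.continuous_re.tendsto _).comp hlim |>.const_mul (1 / (4 * π))).congr' ?_
  filter_upwards [self_mem_nhdsWithin] with β hβ
  exact (dd_modStokeslet c hβ i j).symm

end

/-- For fixed `β` the modified Stokeslet decays quadratically. -/
theorem abs_modStokeslet_le {β : ℝ} (hβ : 0 < β) {p : ℝ × ℝ} {X : ℝ} (hX : 0 < X) (hp : X ≤ p.1)
    (i j : Fin 2) : |modStokeslet β p i j| ≤ 8 / β ^ 2 / X ^ 2 := by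
  have hp0 := hX.trans_le hp
  rw [modStokeslet_apply hβ hp0, abs_mul, abs_of_pos (by positivity)]
  -- No cancellation between the two symbols is used: each is bounded at its own rate, at the price
  -- of a constant that blows up with `1/β²`.
  have hb : ∀ β lam, ‖biSymb (rate β lam) lam p i j‖ ≤ 2 / p.1 * Real.exp (-(|lam| * (p.1 / 2))) :=
    fun β lam => by
      rw [biSymb_apply]
      exact norm_mul_wave_le (abs_le_rate β lam) (norm_biAmp_le β lam i j) hp0
  have h := norm_integral_le_of_norm_le
    (f := fun lam => biSymb (rate β lam) lam p i j - biSymb |lam| lam p i j)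
    ((integrable_exp_neg_mul_abs (half_pos hp0)).const_mul
    (2 * (2 / p.1))) (Eventually.of_forall fun lam => by
      have h1 := hb β lam
      have h2 := hb 0 lam
      rw [rate_zero] at h2
      exact (norm_sub_le _ _).trans (by linarith))
  rw [integral_const_mul, integral_exp_neg_mul_abs (half_pos hp0)] at h
  have h2 := (Complex.abs_re_le_norm _).trans h
  have h3 : 1 / (4 * π * β ^ 2) ≤ 1 / (2 * β ^ 2) := by
    apply one_div_le_one_div_of_le (by positivity)
    have := Real.pi_gt_three
    have : 0 < β ^ 2 := by positivity
    nlinarith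
  calc _ ≤ 1 / (2 * β ^ 2) * (2 * (2 / p.1) * (2 / (p.1 / 2))) := by gcongr
    _ = 8 / β ^ 2 / p.1 ^ 2 := by field_simp; norm_num
    _ ≤ _ := by gcongr

/-! ### The lattice sums -/

/-- The image cells `m ≤ -M`, `n ∈ S`. -/
def westOf (M : ℕ) (S : Finset ℤ) : Set (ℤ × ℤ) := {w | w.1 ≤ -(M : ℤ) ∧ w.2 ∈ S}

/-- The cells of `westOf M S`, indexed by row and by distance. -/
def westEquiv (M : ℕ) (S : Finset ℤ) : S × ℕ ≃ westOf M S where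
  toFun q := ⟨(-((M + q.2 : ℕ) : ℤ), q.1), by
    refine ⟨?_, q.1.2⟩
    push_cast; linarith [Int.natCast_nonneg q.2]⟩
  invFun w := (⟨w.1.2, w.2.2⟩, (-(M : ℤ) - w.1.1).toNat)
  left_inv q := by
    ext
    · rfl
    · simp
  right_inv w := by
    have h : w.1.1 ≤ -(M : ℤ) := w.2.1
    ext
    · simp only
      push_cast
      rw [Int.toNat_of_nonneg (by linarith)]
      ring
    · rfl

/-- The integrand of the west kernel for the image cells `westOf M S`. -/
def kernelW (M : ℕ) (S : Finset ℤ) (d ξ η : ℝ) (t s : ℝ × ℝ) (lam : ℝ) :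
    Matrix (Fin 2) (Fin 2) ℂ :=
  ∑ n ∈ S, ((1 / (8 * π) : ℝ) * (decay lam (M * d) / (1 - decay lam d)) *
        decay lam (t.1 - s.1 - n * ξ) * osc lam (t.2 - s.2 - n * η)) •
      ((1 / ((|lam| : ℝ) : ℂ)) • (1 : Matrix (Fin 2) (Fin 2) ℂ) -
        (((t.1 - s.1 - n * ξ : ℝ) : ℂ) +
          (M - (M - 1) * decay lam d) / (1 - decay lam d) * d) • signMat lam)

/-- The displacement from the copy of the source `s` in the image cell `q` to the target `t`. -/
def disp (M : ℕ) {S : Finset ℤ} (d ξ η : ℝ) (t s : ℝ × ℝ) (q : S × ℕ) : ℝ × ℝ :=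
  t - (s + latticeVec d ξ η (westEquiv M S q))

lemma disp_eq (M : ℕ) {S : Finset ℤ} (d ξ η : ℝ) (t s : ℝ × ℝ) (q : S × ℕ) :
    disp M d ξ η t s q = (t.1 - s.1 - (q.1 : ℤ) * ξ + (M + q.2) * d,
      t.2 - s.2 - (q.1 : ℤ) * η) := by
  ext
  · simp [disp, latticeVec, westEquiv]; ring
  · simp [disp, latticeVec, westEquiv]; ring

/-- At `ν = |λ|` the factor `(λ/ν)²` is `1`, and the symbol takes the form `I/|λ| - x J(λ)` of the
kernels. -/
lemma symb_abs_apply {lam : ℝ} (h : lam ≠ 0) (p : ℝ × ℝ) (a b : Fin 2) :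
    symb |lam| lam p a b = wave |lam| lam p *
      (1 / ((|lam| : ℝ) : ℂ) * (1 : Matrix (Fin 2) (Fin 2) ℂ) a b - p.1 * signMat lam a b) := by
  have h1 := ofReal_sq_div_abs h
  fin_cases a <;> fin_cases b
  · show wave |lam| lam p * (((lam : ℂ) / ((|lam| : ℝ) : ℂ)) ^ 2 * (1 / ((|lam| : ℝ) : ℂ) + p.1)) =
      wave |lam| lam p * (1 / ((|lam| : ℝ) : ℂ) * 1 - p.1 * (-1))
    rw [h1]; ring
  · show wave |lam| lam p * (-(Complex.I * ((lam : ℂ) / ((|lam| : ℝ) : ℂ)) * p.1)) =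
      wave |lam| lam p * (1 / ((|lam| : ℝ) : ℂ) * 0 - p.1 * (Complex.I * csgn lam))
    rw [csgn_eq]; ring
  · show wave |lam| lam p * (-(Complex.I * ((lam : ℂ) / ((|lam| : ℝ) : ℂ)) * p.1)) =
      wave |lam| lam p * (1 / ((|lam| : ℝ) : ℂ) * 0 - p.1 * (Complex.I * csgn lam))
    rw [csgn_eq]; ring
  · show wave |lam| lam p * (1 / ((|lam| : ℝ) : ℂ) - p.1) =
      wave |lam| lam p * (1 / ((|lam| : ℝ) : ℂ) * 1 - p.1 * 1)
    ring

lemma norm_decay (lam c : ℝ) : ‖decay lam c‖ = Real.exp (-(|lam| * c)) := by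
  rw [decay, Complex.norm_exp]; simp

lemma norm_decay_lt_one {lam d : ℝ} (h : lam ≠ 0) (hd : 0 < d) : ‖decay lam d‖ < 1 := by
  rw [norm_decay, Real.exp_lt_one_iff, neg_lt_zero]
  have := abs_pos.2 h
  positivity

lemma one_sub_decay_ne_zero {lam d : ℝ} (h : lam ≠ 0) (hd : 0 < d) : 1 - decay lam d ≠ 0 := by
  intro h0
  have := norm_decay_lt_one h hd
  rw [← sub_eq_zero.1 h0, norm_one] at this
  exact lt_irrefl _ this

lemma decay_natCast_mul (lam d : ℝ) (m : ℕ) : decay lam (m * d) = decay lam d ^ m := by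
  rw [decay, decay, ← Complex.exp_nat_mul]
  congr 1; push_cast; ring

lemma decay_add (lam x y : ℝ) : decay lam (x + y) = decay lam x * decay lam y := by
  rw [decay, decay, decay, ← Complex.exp_add]
  congr 1; push_cast; ring

lemma osc_add (lam x y : ℝ) : osc lam (x + y) = osc lam x * osc lam y := by
  rw [osc, osc, osc, ← Complex.exp_add]
  congr 1; push_cast; ring

/-- Each fibre is extended by zero to the product, and finitely many such sums are added; no
completeness is needed. -/
lemma hasSum_finite_prod {ι E : Type*} [Fintype ι] [DecidableEq ι] [AddCommMonoid E]
    [TopologicalSpace E] [ContinuousAdd E] {f : ι × ℕ → E} {g : ι → E}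
    (h : ∀ i, HasSum (fun k => f (i, k)) (g i)) : HasSum f (∑ i, g i) := by
  have h1 : ∀ i, HasSum (fun q : ι × ℕ => if q.1 = i then f q else 0) (g i) := by
    intro i
    have hinj : Function.Injective fun k : ℕ => (i, k) := fun k l hkl => (Prod.mk.inj hkl).2
    refine (hinj.hasSum_iff ?_).1 ?_
    · rintro ⟨j, k⟩ hq
      refine if_neg fun hj => hq ⟨k, ?_⟩
      rw [← show j = i from hj]
    · simpa [Function.comp_def] using h i
  simpa using hasSum_sum (s := Finset.univ) fun i _ => h1 i

lemma summable_finite_prod {ι : Type*} [Fintype ι] {f : ℕ → ℝ} (h : Summable f) :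
    Summable fun q : ι × ℕ => f q.2 := by
  classical
  exact (hasSum_finite_prod (f := fun q : ι × ℕ => f q.2) fun _ => h.hasSum).summable

/-- The integrand of the west kernel is the sum of the plane wave symbols of the images. -/
theorem hasSum_symb (M : ℕ) (S : Finset ℤ) {d lam : ℝ} (hd : 0 < d) (ξ η : ℝ) (h : lam ≠ 0)
    (t s : ℝ × ℝ) (a b : Fin 2) :
    HasSum (fun q : S × ℕ => (1 / (8 * π) : ℝ) * symb |lam| lam (disp M d ξ η t s q) a b)
      (kernelW M S d ξ η t s lam a b) := by
  have hr := norm_decay_lt_one h hd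
  have hr1 := one_sub_decay_ne_zero h hd
  rw [kernelW, Matrix.sum_apply, ← Finset.sum_coe_sort]
  refine hasSum_finite_prod fun n => ?_
  set Z : ℝ := t.1 - s.1 - (n : ℤ) * ξ with hZ
  set E : ℂ := decay lam Z * osc lam (t.2 - s.2 - (n : ℤ) * η) with hE
  set J := signMat lam a b with hJ
  set I := (1 : Matrix (Fin 2) (Fin 2) ℂ) a b with hI
  -- With `r = decay lam d`, the constant part of the symbol sums by `∑ r^k = 1/(1 - r)`. The part
  -- of the abscissa linear in `k` sums by `∑ k r^k = r/(1 - r)²`. They combine through `M/(1 - r) +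
  -- r/(1 - r)² = (M - (M - 1) r)/(1 - r)²`.
  have h1 := (hasSum_geometric_of_norm_lt_one hr).mul_left
    ((1 / (8 * π) : ℝ) * E * decay lam d ^ M * (1 / ((|lam| : ℝ) : ℂ) * I - (Z + M * d) * J))
  have h2 := (hasSum_coe_mul_geometric_of_norm_lt_one hr).mul_left
    ((1 / (8 * π) : ℝ) * E * decay lam d ^ M * (d * J))
  have h3 := h1.sub h2
  have e2 : ∀ k : ℕ, (1 / (8 * π) : ℝ) * symb |lam| lam (disp M d ξ η t s (n, k)) a b =
      (1 / (8 * π) : ℝ) * E * decay lam d ^ M * (1 / ((|lam| : ℝ) : ℂ) * I - (Z + M * d) * J) *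
        decay lam d ^ k - (1 / (8 * π) : ℝ) * E * decay lam d ^ M * (d * J) *
        (k * decay lam d ^ k) := by
    intro k
    rw [symb_abs_apply h, disp_eq, ← decay_mul_osc, ← hZ, ← hI, ← hJ, decay_add,
      show ((M : ℝ) + k) * d = M * d + k * d by ring, decay_add, decay_natCast_mul,
      decay_natCast_mul, hE]
    push_cast
    ring
  have e3 : ((1 / (8 * π) : ℝ) * (decay lam (M * d) / (1 - decay lam d)) * decay lam Z *
      osc lam (t.2 - s.2 - (n : ℤ) * η)) * (1 / ((|lam| : ℝ) : ℂ) * I - ((Z : ℂ) +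
        (M - (M - 1) * decay lam d) / (1 - decay lam d) * d) * J) =
      (1 / (8 * π) : ℝ) * E * decay lam d ^ M * (1 / ((|lam| : ℝ) : ℂ) * I - (Z + M * d) * J) *
        (1 - decay lam d)⁻¹ - (1 / (8 * π) : ℝ) * E * decay lam d ^ M * (d * J) *
        (decay lam d / (1 - decay lam d) ^ 2) := by
    rw [decay_natCast_mul, hE]
    field_simp
    ring
  have h4 := h3
  rw [← e3, ← funext e2] at h4
  exact h4

/-! ### Geometry of the image cells -/

/-- The period vectors and the image cells `westOf M S` are such that the images are well separated
from the targets. -/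
structure IsSeparated (M : ℕ) (S : Finset ℤ) (d ξ : ℝ) : Prop where
  pos : 0 < d
  le : ∀ n ∈ S, |ξ| + |n * ξ| ≤ (M - 2) * d

lemma abs_le_of_mem_cell {d ξ η : ℝ} (hd : 0 < d) (hη : 0 < η) {t : ℝ × ℝ} (ht : t ∈ cell d ξ η) :
    |t.1| ≤ (d + |ξ|) / 2 ∧ |t.2| ≤ η / 2 := by
  obtain ⟨a, ha, b, hb, rfl⟩ := ht
  have ha' : |a| ≤ 1 / 2 := abs_le.2 ⟨by linarith [ha.1], ha.2⟩
  have hb' : |b| ≤ 1 / 2 := abs_le.2 ⟨by linarith [hb.1], hb.2⟩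
  simp only [Prod.smul_mk, Prod.mk_add_mk, smul_eq_mul, mul_zero, zero_add]
  constructor
  · refine (abs_add_le _ _).trans ?_
    rw [abs_mul, abs_mul, abs_of_pos hd]
    nlinarith [abs_nonneg ξ]
  · rw [abs_mul, abs_of_pos hη]
    nlinarith

variable {M : ℕ} {S : Finset ℤ} {d ξ η : ℝ}

/-- Two points of the cell differ in abscissa by at most `d + |ξ|`, and the row shift costs `|n ξ|`.
Separation bounds the total by `(M - 1) d`, which leaves `(k + 1) d` of the distance `(M + k) d`.
From above the abscissa is at most `(2 M + k - 1) d`. -/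
lemma disp_fst_mem (hs : IsSeparated M S d ξ) (hη : 0 < η) {t s : ℝ × ℝ} (ht : t ∈ cell d ξ η)
    (hs' : s ∈ cell d ξ η) (q : S × ℕ) :
    (q.2 + 1) * d ≤ (disp M d ξ η t s q).1 ∧
      (disp M d ξ η t s q).1 ≤ (2 * M + 1) * ((q.2 + 1) * d) := by
  have hd := hs.pos
  have h := hs.le q.1 q.1.2
  have h1 := abs_le.1 (abs_le_of_mem_cell hd hη ht).1
  have h2 := abs_le.1 (abs_le_of_mem_cell hd hη hs').1
  have h3 := abs_le.1 (le_refl |((q.1 : ℤ) : ℝ) * ξ|)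
  rw [disp_eq]
  constructor
  · simp only; nlinarith
  · have h4 : 0 ≤ (M : ℝ) * q.2 * d := by positivity
    have h5 : 0 ≤ (q.2 : ℝ) * d := by positivity
    simp only; nlinarith

/-- The increments have size at most `d + |ξ| + η ≤ M d + η`. All constants are free of `ξ`, so the
resulting bounds hold for all shears at once. -/
lemma isEast_disp (hs : IsSeparated M S d ξ) (hη : 0 < η) {t t₀ s s₀ : ℝ × ℝ}
    (ht : t ∈ cell d ξ η) (ht₀ : t₀ ∈ cell d ξ η) (hs₁ : s ∈ cell d ξ η)
    (hs₀ : s₀ ∈ cell d ξ η) (q : S × ℕ) :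
    IsEast (disp M d ξ η t₀ s₀ q) (t - t₀) (s₀ - s) ((q.2 + 1) * d) (M * d + η) (2 * M + 1) := by
  have hd := hs.pos
  have e1 : disp M d ξ η t₀ s₀ q + (t - t₀) = disp M d ξ η t s₀ q := by simp only [disp]; abel
  have e2 : disp M d ξ η t₀ s₀ q + (s₀ - s) = disp M d ξ η t₀ s q := by simp only [disp]; abel
  have e3 : disp M d ξ η t₀ s₀ q + (t - t₀) + (s₀ - s) = disp M d ξ η t s q := by
    simp only [disp]; abel
  have hξ : |ξ| ≤ (M - 2) * d := by linarith [hs.le q.1 q.1.2, abs_nonneg (((q.1 : ℤ) : ℝ) * ξ)]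
  have hdiff : ∀ {x y : ℝ × ℝ}, x ∈ cell d ξ η → y ∈ cell d ξ η →
      |(x - y).1| + |(x - y).2| ≤ M * d + η := by
    intro x y hx hy
    have h1 := abs_le_of_mem_cell hd hη hx
    have h2 := abs_le_of_mem_cell hd hη hy
    have h3 := abs_sub x.1 y.1
    have h4 := abs_sub x.2 y.2
    simp only [Prod.fst_sub, Prod.snd_sub]
    linarith [h1.1, h1.2, h2.1, h2.2]
  exact {
    pos := by positivity
    le₀₀ := (disp_fst_mem hs hη ht₀ hs₀ q).1
    le₁₀ := by rw [e1]; exact (disp_fst_mem hs hη ht hs₀ q).1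
    le₀₁ := by rw [e2]; exact (disp_fst_mem hs hη ht₀ hs₁ q).1
    le₁₁ := by rw [e3]; exact (disp_fst_mem hs hη ht hs₁ q).1
    le_mul := (disp_fst_mem hs hη ht₀ hs₀ q).2
    left_le := hdiff ht ht₀
    right_le := hdiff hs₀ hs₁ }

lemma dd_disp {E : Type*} [AddCommGroup E] (F : ℝ × ℝ → E) (t t₀ s s₀ : ℝ × ℝ) (q : S × ℕ) :
    dd F (disp M d ξ η t₀ s₀ q) (t - t₀) (s₀ - s) = F (disp M d ξ η t s q) -
      F (disp M d ξ η t₀ s q) - F (disp M d ξ η t s₀ q) + F (disp M d ξ η t₀ s₀ q) := by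
  have e1 : disp M d ξ η t₀ s₀ q + (t - t₀) = disp M d ξ η t s₀ q := by simp only [disp]; abel
  have e2 : disp M d ξ η t₀ s₀ q + (s₀ - s) = disp M d ξ η t₀ s q := by simp only [disp]; abel
  have e3 : disp M d ξ η t₀ s₀ q + (t - t₀) + (s₀ - s) = disp M d ξ η t s q := by
    simp only [disp]; abel
  rw [dd, e3, e2, e1]

/-! ### The kernel of a neutral pair -/

/-- The second difference of the kernel for the sources `s, s₀` and the targets `t, t₀`. -/
def neutral (k : ℝ × ℝ → ℝ × ℝ → ℝ → Matrix (Fin 2) (Fin 2) ℂ) (t t₀ s s₀ : ℝ × ℝ) (lam : ℝ) :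
    Matrix (Fin 2) (Fin 2) ℂ :=
  k t s lam - k t₀ s lam - k t s₀ lam + k t₀ s₀ lam

/-- The constant in the bound of the second differences. -/
def ddConst (M : ℕ) (d η : ℝ) : ℝ := (M * d + η) ^ 2 * (6 + 16 * (2 * M + 1))

lemma ddConst_nonneg (M : ℕ) (d η : ℝ) : 0 ≤ ddConst M d η := by unfold ddConst; positivity

/-- The bound of the contribution of one image cell. -/
def cellBound (M : ℕ) (d η : ℝ) (k : ℕ) (lam : ℝ) : ℝ :=
  ddConst M d η / ((k + 1) * d) * Real.exp (-(|lam| * ((k + 1) * d / 2)))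

lemma cellBound_nonneg (hd : 0 < d) (k : ℕ) (lam : ℝ) : 0 ≤ cellBound M d η k lam := by
  have := ddConst_nonneg M d η
  unfold cellBound; positivity

lemma integrable_cellBound (hd : 0 < d) (k : ℕ) : Integrable (cellBound M d η k) :=
  (integrable_exp_neg_mul_abs (by positivity)).const_mul _

lemma integral_cellBound (hd : 0 < d) (k : ℕ) :
    ∫ lam, cellBound M d η k lam = 4 * ddConst M d η / d ^ 2 * (1 / ((k : ℝ) + 1) ^ 2) := by
  unfold cellBound
  rw [integral_const_mul, integral_exp_neg_mul_abs (by positivity)]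
  field_simp
  norm_num

lemma summable_one_div_succ_sq : Summable fun k : ℕ => 1 / ((k : ℝ) + 1) ^ 2 := by
  have := (summable_nat_add_iff 1).2 (Real.summable_one_div_nat_pow.2 one_lt_two)
  simpa using this

lemma summable_cellBound (hd : 0 < d) {lam : ℝ} (h : lam ≠ 0) :
    Summable fun k : ℕ => cellBound M d η k lam := by
  have h0 := abs_pos.2 h
  have hr : Real.exp (-(|lam| * (d / 2))) < 1 := by
    rw [Real.exp_lt_one_iff, neg_lt_zero]; positivity
  refine Summable.of_nonneg_of_le (fun k => cellBound_nonneg hd k lam) (fun k => ?_)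
    ((summable_geometric_of_lt_one (Real.exp_pos _).le hr).mul_left (ddConst M d η / d))
  rw [← Real.exp_nat_mul]
  have hc := ddConst_nonneg M d η
  unfold cellBound
  gcongr
  · have : (0 : ℝ) ≤ k := k.cast_nonneg
    nlinarith
  · have : 0 ≤ |lam| * (d / 2) := by positivity
    nlinarith

/-- The integrable bound of the kernel of a neutral pair. -/
def kernelBound (M : ℕ) (S : Finset ℤ) (d η lam : ℝ) : ℝ :=
  (∑' q : S × ℕ, ENNReal.ofReal (cellBound M d η q.2 lam)).toReal

lemma kernelBound_eq (hd : 0 < d) {lam : ℝ} (h : lam ≠ 0) :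
    kernelBound M S d η lam = ∑' q : S × ℕ, cellBound M d η q.2 lam := by
  rw [kernelBound, ← ENNReal.ofReal_tsum_of_nonneg (fun q => cellBound_nonneg hd _ _)
    (summable_finite_prod (summable_cellBound hd h)),
    ENNReal.toReal_ofReal (tsum_nonneg fun q => cellBound_nonneg hd _ _)]

/-- Tonelli: the integrals of the cell bounds are multiples of `1/(k + 1)²`. Summing in `[0, ∞]`
gives measurability without a summability condition, which would fail at `λ = 0`, where the terms
are harmonic. -/
lemma integrable_kernelBound (hd : 0 < d) : Integrable (kernelBound M S d η) := by
  refine integrable_toReal_of_lintegral_ne_top ?_ ?_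
  · refine (Measurable.tsum fun q => ?_).aemeasurable
    unfold cellBound
    fun_prop
  · have hm : ∀ q : S × ℕ, AEMeasurable fun lam => ENNReal.ofReal (cellBound M d η q.2 lam) :=
      fun q => (integrable_cellBound (M := M) (η := η) hd q.2).1.aemeasurable.ennreal_ofReal
    rw [lintegral_tsum hm]
    have e : ∀ q : S × ℕ, ∫⁻ lam, ENNReal.ofReal (cellBound M d η q.2 lam) =
        ENNReal.ofReal (4 * ddConst M d η / d ^ 2 * (1 / ((q.2 : ℝ) + 1) ^ 2)) := fun q => by
      rw [← ofReal_integral_eq_lintegral_ofReal (integrable_cellBound hd _)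
        (Eventually.of_forall fun lam => cellBound_nonneg hd _ lam), integral_cellBound hd]
    simp only [e]
    rw [← ENNReal.ofReal_tsum_of_nonneg]
    · exact ENNReal.ofReal_ne_top
    · intro q
      have := ddConst_nonneg M d η
      positivity
    · exact summable_finite_prod (summable_one_div_succ_sq.mul_left _)

section

variable {t t₀ s s₀ : ℝ × ℝ}

/-- The contribution of one image cell to the kernel of a neutral pair. -/
def cellKernel (M : ℕ) {S : Finset ℤ} (d ξ η : ℝ) (t t₀ s s₀ : ℝ × ℝ) (a b : Fin 2)
    (q : S × ℕ) (lam : ℝ) : ℂ :=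
  (1 / (8 * π) : ℝ) * dd (fun p => symb |lam| lam p a b)
    (disp M d ξ η t₀ s₀ q) (t - t₀) (s₀ - s)

lemma hasSum_cellKernel (hd : 0 < d) {lam : ℝ} (h : lam ≠ 0) (a b : Fin 2) :
    HasSum (fun q : S × ℕ => cellKernel M d ξ η t t₀ s s₀ a b q lam)
      (neutral (kernelW M S d ξ η) t t₀ s s₀ lam a b) := by
  have hk := fun t s => hasSum_symb M S hd ξ η h t s a b
  have e : (fun q : S × ℕ => cellKernel M d ξ η t t₀ s s₀ a b q lam) = fun q =>
      (1 / (8 * π) : ℝ) * symb |lam| lam (disp M d ξ η t s q) a b -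
      (1 / (8 * π) : ℝ) * symb |lam| lam (disp M d ξ η t₀ s q) a b -
      (1 / (8 * π) : ℝ) * symb |lam| lam (disp M d ξ η t s₀ q) a b +
      (1 / (8 * π) : ℝ) * symb |lam| lam (disp M d ξ η t₀ s₀ q) a b := by
    ext q
    simp only [cellKernel, dd_disp]
    ring
  rw [e]
  exact (((hk t s).sub (hk t₀ s)).sub (hk t s₀)).add (hk t₀ s₀)

lemma norm_cellKernel_le (hs : IsSeparated M S d ξ) (hη : 0 < η) (ht : t ∈ cell d ξ η)
    (ht₀ : t₀ ∈ cell d ξ η) (hs₁ : s ∈ cell d ξ η) (hs₀ : s₀ ∈ cell d ξ η) (a b : Fin 2) (q : S × ℕ) {lam : ℝ} (h : lam ≠ 0) :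
    ‖cellKernel M d ξ η t t₀ s s₀ a b q lam‖ ≤ cellBound M d η q.2 lam := by
  have h1 := norm_dd_symb_le (isEast_disp hs hη ht ht₀ hs₁ hs₀ q) (abs_pos.2 h) le_rfl a b
  rw [cellKernel, norm_mul, Complex.norm_real, Real.norm_eq_abs, abs_of_pos (by positivity)]
  have h2 : 1 / (8 * π) ≤ 1 := by
    rw [div_le_one (by positivity)]; linarith [Real.pi_gt_three]
  exact (mul_le_of_le_one_left (norm_nonneg _) h2).trans h1

/-- The majorant involves neither the shear nor the positions, as a uniform quadrature rule
requires. -/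
lemma norm_neutral_kernelW_le (hs : IsSeparated M S d ξ) (hη : 0 < η) (ht : t ∈ cell d ξ η)
    (ht₀ : t₀ ∈ cell d ξ η) (hs₁ : s ∈ cell d ξ η) (hs₀ : s₀ ∈ cell d ξ η) (a b : Fin 2) {lam : ℝ} (h : lam ≠ 0) :
    ‖neutral (kernelW M S d ξ η) t t₀ s s₀ lam a b‖ ≤ kernelBound M S d η lam := by
  rw [kernelBound_eq hs.pos h, ← (hasSum_cellKernel hs.pos h a b).tsum_eq]
  exact tsum_of_norm_bounded (summable_finite_prod (summable_cellBound hs.pos h)).hasSum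
    fun q => norm_cellKernel_le hs hη ht ht₀ hs₁ hs₀ a b q h

/-- The integral of the kernel of a neutral pair is the lattice sum of Stokeslets. -/
theorem hasSum_dd_stokeslet (hs : IsSeparated M S d ξ) (hη : 0 < η) (ht : t ∈ cell d ξ η)
    (ht₀ : t₀ ∈ cell d ξ η) (hs₁ : s ∈ cell d ξ η) (hs₀ : s₀ ∈ cell d ξ η) (a b : Fin 2) :
    HasSum (fun q : S × ℕ => ((dd (fun p => stokeslet p a b)
        (disp M d ξ η t₀ s₀ q) (t - t₀) (s₀ - s) : ℝ) : ℂ))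
      (∫ lam, neutral (kernelW M S d ξ η) t t₀ s s₀ lam a b) := by
  have hint : ∀ q : S × ℕ, Integrable (cellKernel M d ξ η t t₀ s s₀ a b q) := fun q =>
    (dd_stokeslet (isEast_disp hs hη ht ht₀ hs₁ hs₀ q) a b).1.const_mul _
  have hbd : ∀ q : S × ℕ, ∫ lam, ‖cellKernel M d ξ η t t₀ s s₀ a b q lam‖ ≤
      4 * ddConst M d η / d ^ 2 * (1 / ((q.2 : ℝ) + 1) ^ 2) := fun q => by
    rw [← integral_cellBound hs.pos]
    refine integral_mono_ae (hint q).norm (integrable_cellBound hs.pos _) ?_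
    filter_upwards [ae_ne_zero] with lam h
    exact norm_cellKernel_le hs hη ht ht₀ hs₁ hs₀ a b q h
  -- Sum and integral are exchanged because the `L¹` norms of the cell contributions are summable.
  have h := hasSum_integral_of_summable_integral_norm hint
    (Summable.of_nonneg_of_le (fun q => integral_nonneg fun _ => norm_nonneg _) hbd
      (summable_finite_prod (summable_one_div_succ_sq.mul_left _)))
  have e1 : ∀ q : S × ℕ, ((dd (fun p => stokeslet p a b)
      (disp M d ξ η t₀ s₀ q) (t - t₀) (s₀ - s) : ℝ) : ℂ) =
      ∫ lam, cellKernel M d ξ η t t₀ s s₀ a b q lam := fun q => by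
    rw [(dd_stokeslet (isEast_disp hs hη ht ht₀ hs₁ hs₀ q) a b).2, ← integral_const_mul]
    rfl
  have e2 : ∫ lam, neutral (kernelW M S d ξ η) t t₀ s s₀ lam a b =
      ∫ lam, ∑' q : S × ℕ, cellKernel M d ξ η t t₀ s s₀ a b q lam := by
    refine integral_congr_ae ?_
    filter_upwards [ae_ne_zero] with lam h
    exact (hasSum_cellKernel hs.pos h a b).tsum_eq.symm
  simp only [e1]
  rw [e2]
  exact h

end

/-! ### Existence of quadrature rules -/

/-- Otherwise Hahn-Banach separates the integral from the closed span. The separating functional is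
bounded above on a subspace, hence zero there, hence zero on the integral. -/
lemma integral_mem_topologicalClosure {E : Type*} [NormedAddCommGroup E] [NormedSpace ℝ E]
    [CompleteSpace E] (V : Submodule ℝ E) {f : ℝ → E} (hf : Integrable f)
    (h : ∀ᵐ x, f x ∈ V) : ∫ x, f x ∈ V.topologicalClosure := by
  by_contra hI
  obtain ⟨l, u, hl, hu⟩ := geometric_hahn_banach_closed_point
    (s := (V.topologicalClosure : Set E)) V.topologicalClosure.convex
    V.isClosed_topologicalClosure hI
  have hzero : ∀ v ∈ V, l v = 0 := by
    intro v hv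
    by_contra hne
    -- This multiple of `v` has the value `u + 1` under `l`, beyond the bound `u`.
    have := hl (((u + 1) / l v) • v)
      (V.le_topologicalClosure (V.smul_mem _ hv))
    rw [map_smul, smul_eq_mul, div_mul_cancel₀ _ hne] at this
    linarith
  have h0 := hl 0 (Submodule.zero_mem _)
  rw [map_zero] at h0
  rw [← ContinuousLinearMap.integral_comp_comm l hf, integral_congr_ae
    (g := fun _ => (0 : ℝ)) (h.mono fun x hx => hzero _ hx)] at hu
  simp at hu
  linarith

lemma aestronglyMeasurable_of_continuousOn {E : Type*} [TopologicalSpace E]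
    [TopologicalSpace.PseudoMetrizableSpace E] {f : ℝ → E} (h : ContinuousOn f {0}ᶜ) :
    AEStronglyMeasurable f volume := by
  have := h.aestronglyMeasurable (μ := volume) (measurableSet_singleton (0 : ℝ)).compl
  rwa [Measure.restrict_eq_self_of_ae_mem (s := ({0}ᶜ : Set ℝ)) ae_ne_zero] at this

/-- A family of functions that is continuous away from `0` and dominated by one integrable function
has uniform quadrature rules of any precision. -/
theorem exists_uniform_quadrature {P : Type*} [TopologicalSpace P] [CompactSpace P]
    (F : P → ℝ → ℝ) (hF : Continuous fun z : {x : ℝ // x ≠ 0} × P => F z.2 z.1) {g : ℝ → ℝ}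
    (hg : Integrable g) (hb : ∀ p, ∀ x ≠ 0, |F p x| ≤ g x) {ε : ℝ} (hε : 0 < ε) :
    ∃ (N : ℕ) (wt nd : Fin N → ℝ), (∀ n, nd n ≠ 0) ∧
      ∀ p, |∑ n, wt n * F p (nd n) - ∫ x, F p x| ≤ ε := by
  classical
  set c : C({x : ℝ // x ≠ 0}, C(P, ℝ)) := ContinuousMap.curry ⟨_, hF⟩ with hc
  -- The default value at `0` never matters: the point is null, and the span below uses only values
  -- off `0`, so all nodes are nonzero.
  set f : ℝ → C(P, ℝ) := fun x => if h : x ≠ 0 then c ⟨x, h⟩ else 0 with hf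
  have hfx : ∀ x (h : x ≠ 0) p, f x p = F p x := fun x h p => by
    simp only [hf, dif_pos h]; rfl
  have hcont : ContinuousOn f {0}ᶜ := by
    rw [continuousOn_iff_continuous_domRestrict]
    have : domRestrict {0}ᶜ f = c := by
      ext x p
      exact hfx x x.2 p
    rw [this]
    exact c.continuous
  have hmeas : AEStronglyMeasurable f volume := aestronglyMeasurable_of_continuousOn hcont
  have hint : Integrable f := by
    refine hg.norm.mono' hmeas ?_
    filter_upwards [ae_ne_zero] with x hx
    rw [ContinuousMap.norm_le _ (norm_nonneg _)]
    intro p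
    rw [hfx x hx, Real.norm_eq_abs]
    exact (hb p x hx).trans (le_abs_self _)
  set V := Submodule.span ℝ (f '' {0}ᶜ) with hV
  have hmem := integral_mem_topologicalClosure V hint (by
    filter_upwards [ae_ne_zero] with x hx
    exact Submodule.subset_span ⟨x, hx, rfl⟩)
  -- An element of the span is a finite combination of values of `f`, that is, a rule; closeness in
  -- the sup norm is uniformity over `P`.
  obtain ⟨v, hv, hdist⟩ := Metric.mem_closure_iff.1 hmem ε hε
  obtain ⟨N, wt, y, rfl⟩ := Submodule.mem_span_set'.1 hv
  choose nd hnd hy using fun n => (y n).2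
  refine ⟨N, wt, nd, hnd, fun p => ?_⟩
  have h1 := (ContinuousMap.dist_apply_le_dist p).trans hdist.le
  rw [dist_comm, Real.dist_eq, ContinuousMap.integral_apply hint] at h1
  have h2 : ∫ x, f x p = ∫ x, F p x := integral_congr_ae (by
    filter_upwards [ae_ne_zero] with x hx
    exact hfx x hx p)
  rw [h2] at h1
  have h3 : (∑ n, wt n • ((y n : C(P, ℝ)))) p = ∑ n, wt n * F p (nd n) := by
    rw [ContinuousMap.sum_apply]
    refine Finset.sum_congr rfl fun n _ => ?_
    rw [ContinuousMap.smul_apply, smul_eq_mul, ← hy n, hfx _ (hnd n)]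
  rwa [h3] at h1

/-! ### Continuity of the kernel -/

lemma continuous_decay {α : Type*} [TopologicalSpace α] {f g : α → ℝ} (hf : Continuous f)
    (hg : Continuous g) : Continuous fun z => decay (f z) (g z) := by
  unfold decay; fun_prop

lemma continuous_osc {α : Type*} [TopologicalSpace α] {f g : α → ℝ} (hf : Continuous f)
    (hg : Continuous g) : Continuous fun z => osc (f z) (g z) := by
  unfold osc; fun_prop

lemma continuous_kernelW {α : Type*} [TopologicalSpace α] (M : ℕ) (S : Finset ℤ) {d : ℝ}
    (hd : 0 < d) (η : ℝ) {ξ lam : α → ℝ} {t s : α → ℝ × ℝ} (hξ : Continuous ξ)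
    (ht : Continuous t) (hs : Continuous s) (hlam : Continuous lam) (h0 : ∀ z, lam z ≠ 0) :
    Continuous fun z => kernelW M S d (ξ z) η (t z) (s z) (lam z) := by
  have habs : ∀ z, ((|lam z| : ℝ) : ℂ) ≠ 0 := fun z => by
    exact_mod_cast (abs_pos.2 (h0 z)).ne'
  have hr : ∀ z, 1 - decay (lam z) d ≠ 0 := fun z => one_sub_decay_ne_zero (h0 z) hd
  have hA : Continuous fun z => ((|lam z| : ℝ) : ℂ) := by fun_prop
  have hr' : Continuous fun z => decay (lam z) d := continuous_decay hlam continuous_const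
  have hr'' : Continuous fun z => 1 - decay (lam z) d := continuous_const.sub hr'
  have hJ : Continuous fun z => signMat (lam z) := by
    have hs : Continuous fun z => csgn (lam z) := by
      simp only [csgn_eq]
      exact Continuous.div (by fun_prop) hA habs
    unfold signMat
    refine continuous_matrix fun i j => ?_
    fin_cases i <;> fin_cases j <;> simp <;> fun_prop
  unfold kernelW
  refine continuous_finsetSum _ fun n _ => ?_
  refine Continuous.smul (M := ℂ) ?_ ?_
  · refine ((continuous_const.mul ((continuous_decay hlam continuous_const).div hr'' hr)).mul
      (continuous_decay hlam ?_)).mul (continuous_osc hlam ?_) <;> fun_prop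
  · have h1 : Continuous fun z => 1 / ((|lam z| : ℝ) : ℂ) := continuous_const.div hA habs
    refine (h1.smul continuous_const).sub (Continuous.smul (M := ℂ) ?_ hJ)
    refine Continuous.add (by fun_prop) (Continuous.mul (Continuous.div ?_ hr'' hr) continuous_const)
    fun_prop

lemma aestronglyMeasurable_kernelW (M : ℕ) (S : Finset ℤ) {d : ℝ} (hd : 0 < d) (ξ η : ℝ)
    (t s : ℝ × ℝ) (a b : Fin 2) :
    AEStronglyMeasurable (fun lam => kernelW M S d ξ η t s lam a b) volume := by
  have hc : ContinuousOn (fun lam => kernelW M S d ξ η t s lam a b) {0}ᶜ := by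
    rw [continuousOn_iff_continuous_domRestrict]
    have := continuous_kernelW M S hd η (α := ({0}ᶜ : Set ℝ)) (ξ := fun _ => ξ) (t := fun _ => t)
      (s := fun _ => s) (lam := fun x => x) continuous_const continuous_const continuous_const
      continuous_subtype_val fun z => z.2
    exact (continuous_apply b).comp ((continuous_apply a).comp this)
  exact aestronglyMeasurable_of_continuousOn hc

lemma integrable_neutral_kernelW {M : ℕ} {S : Finset ℤ} {d ξ η : ℝ} {t t₀ s s₀ : ℝ × ℝ}
    (hs : IsSeparated M S d ξ) (hη : 0 < η) (ht : t ∈ cell d ξ η)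
    (ht₀ : t₀ ∈ cell d ξ η) (hs₁ : s ∈ cell d ξ η) (hs₀ : s₀ ∈ cell d ξ η) (a b : Fin 2) :
    Integrable fun lam => neutral (kernelW M S d ξ η) t t₀ s s₀ lam a b := by
  refine (integrable_kernelBound (M := M) (S := S) (η := η) hs.pos).mono' ?_ ?_
  · have h := fun t s => aestronglyMeasurable_kernelW M S hs.pos ξ η t s a b
    exact (((h t s).sub (h t₀ s)).sub (h t s₀)).add (h t₀ s₀)
  · filter_upwards [ae_ne_zero] with lam hlam
    exact norm_neutral_kernelW_le hs hη ht ht₀ hs₁ hs₀ a b hlam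

/-- Configurations of two targets and two sources in a cell whose shear `ξ` is in `Ξ`. -/
def configs (d η : ℝ) (Ξ : Set ℝ) : Set (ℝ × (ℝ × ℝ) × (ℝ × ℝ) × (ℝ × ℝ) × (ℝ × ℝ)) :=
  {z | z.1 ∈ Ξ ∧ z.2.1 ∈ cell d z.1 η ∧ z.2.2.1 ∈ cell d z.1 η ∧ z.2.2.2.1 ∈ cell d z.1 η ∧
    z.2.2.2.2 ∈ cell d z.1 η}

/-- The cell varies with the shear, so the set is no product; it is the continuous image of one when
cell coordinates are used. -/
lemma isCompact_configs (d η : ℝ) {Ξ : Set ℝ} (hΞ : IsCompact Ξ) : IsCompact (configs d η Ξ) := by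
  set I : Set (ℝ × ℝ) := Icc (-(1 / 2) : ℝ) (1 / 2) ×ˢ Icc (-(1 / 2) : ℝ) (1 / 2) with hI
  have hIc : IsCompact I := isCompact_Icc.prod isCompact_Icc
  set m : ℝ → ℝ × ℝ → ℝ × ℝ := fun ξ ab => ab.1 • ((d, 0) : ℝ × ℝ) + ab.2 • ((ξ, η) : ℝ × ℝ)
  have hm : ∀ ξ p, p ∈ cell d ξ η ↔ ∃ ab ∈ I, m ξ ab = p := by
    intro ξ p
    constructor
    · rintro ⟨a, ha, b, hb, rfl⟩
      exact ⟨(a, b), ⟨ha, hb⟩, rfl⟩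
    · rintro ⟨⟨a, b⟩, ⟨ha, hb⟩, rfl⟩
      exact ⟨a, ha, b, hb, rfl⟩
  have himg : configs d η Ξ = (fun z : ℝ × (ℝ × ℝ) × (ℝ × ℝ) × (ℝ × ℝ) × (ℝ × ℝ) =>
      (z.1, m z.1 z.2.1, m z.1 z.2.2.1, m z.1 z.2.2.2.1, m z.1 z.2.2.2.2)) ''
      (Ξ ×ˢ I ×ˢ I ×ˢ I ×ˢ I) := by
    ext ⟨ξ, t, t₀, s, s₀⟩
    simp only [configs, mem_ofPred_eq, hm]
    constructor
    · rintro ⟨hξ, ⟨x, hx, rfl⟩, ⟨y, hy, rfl⟩, ⟨z, hz, rfl⟩, ⟨w, hw, rfl⟩⟩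
      exact ⟨(ξ, x, y, z, w), ⟨hξ, hx, hy, hz, hw⟩, rfl⟩
    · rintro ⟨⟨ξ', x, y, z, w⟩, ⟨hξ, hx, hy, hz, hw⟩, h⟩
      simp only [Prod.mk.injEq] at h
      obtain ⟨rfl, rfl, rfl, rfl, rfl⟩ := h
      exact ⟨hξ, ⟨x, hx, rfl⟩, ⟨y, hy, rfl⟩, ⟨z, hz, rfl⟩, ⟨w, hw, rfl⟩⟩
  rw [himg]
  refine (hΞ.prod (hIc.prod (hIc.prod (hIc.prod hIc)))).image ?_
  fun_prop

/-- The indices vary too: they belong to the compact parameter space, so that one rule serves all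
four entries. -/
lemma Continuous.matrix_apply_apply {α : Type*} [TopologicalSpace α]
    {m : α → Matrix (Fin 2) (Fin 2) ℂ} {a b : α → Fin 2} (hm : Continuous m) (ha : Continuous a)
    (hb : Continuous b) : Continuous fun z => m z (a z) (b z) := by
  have h1 : ∀ {c : α → Fin 2} (i : Fin 2), Continuous c →
      Continuous fun z => if c z = i then (1 : ℂ) else 0 := fun i hc =>
    (continuous_of_discreteTopology (f := fun k : Fin 2 => if k = i then (1 : ℂ) else 0)).comp hc
  have e : (fun z => m z (a z) (b z)) = fun z => ∑ i, ∑ j, (if a z = i then (1 : ℂ) else 0) *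
      (if b z = j then (1 : ℂ) else 0) * m z i j := by
    ext z; simp
  rw [e]
  exact continuous_finsetSum _ fun i _ => continuous_finsetSum _ fun j _ =>
    ((h1 i ha).mul (h1 j hb)).mul ((continuous_apply j).comp ((continuous_apply i).comp hm))

lemma continuous_neutral_kernelW {α : Type*} [TopologicalSpace α] (M : ℕ) (S : Finset ℤ) {d : ℝ}
    (hd : 0 < d) (η : ℝ) {ξ lam : α → ℝ} {t t₀ s s₀ : α → ℝ × ℝ} (hξ : Continuous ξ)
    (ht : Continuous t) (ht₀ : Continuous t₀) (hs : Continuous s) (hs₀ : Continuous s₀)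
    (hlam : Continuous lam) (h0 : ∀ z, lam z ≠ 0) :
    Continuous fun z => neutral (kernelW M S d (ξ z) η) (t z) (t₀ z) (s z) (s₀ z) (lam z) := by
  have hk := fun {t s : α → ℝ × ℝ} (ht : Continuous t) (hs : Continuous s) =>
    continuous_kernelW M S hd η hξ ht hs hlam h0
  exact (((hk ht hs).sub (hk ht₀ hs)).sub (hk ht hs₀)).add (hk ht₀ hs₀)

/-- One quadrature rule serves all shears in a compact set. -/
theorem exists_isQuadrature {M : ℕ} {S : Finset ℤ} {d η : ℝ} (hη : 0 < η) {Ξ : Set ℝ}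
    (hΞ : IsCompact Ξ) (hd : 0 < d) (hsep : ∀ ξ ∈ Ξ, IsSeparated M S d ξ) {ε : ℝ} (hε : 0 < ε) :
    ∃ (N : ℕ) (wt nd : Fin N → ℝ), ∀ ξ ∈ Ξ,
      IsQuadrature (cell d ξ η) (kernelW M S d ξ η) ε wt nd := by
  have : CompactSpace (configs d η Ξ) := isCompact_iff_compactSpace.1 (isCompact_configs d η hΞ)
  -- The parameters are the matrix entry, the shear, two targets and two sources.
  set F : (Fin 2 × Fin 2) × configs d η Ξ → ℝ → ℝ := fun p lam =>
    (neutral (kernelW M S d p.2.1.1 η) p.2.1.2.1 p.2.1.2.2.1 p.2.1.2.2.2.1 p.2.1.2.2.2.2 lam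
      p.1.1 p.1.2).re with hFdef
  have hF : Continuous fun z : {x : ℝ // x ≠ 0} × ((Fin 2 × Fin 2) × configs d η Ξ) =>
      F z.2 z.1 := by
    refine Complex.continuous_re.comp (Continuous.matrix_apply_apply ?_ ?_ ?_)
    · exact continuous_neutral_kernelW M S hd η (by fun_prop) (by fun_prop) (by fun_prop)
        (by fun_prop) (by fun_prop) (by fun_prop) fun z => z.1.2
    · fun_prop
    · fun_prop
  obtain ⟨N, wt, nd, hnd, hq⟩ := exists_uniform_quadrature F hF
    (integrable_kernelBound (M := M) (S := S) (η := η) hd) (fun p x hx =>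
      (Complex.abs_re_le_norm _).trans (norm_neutral_kernelW_le (hsep _ p.2.2.1) hη p.2.2.2.1
        p.2.2.2.2.1 p.2.2.2.2.2.1 p.2.2.2.2.2.2 p.1.1 p.1.2 hx)) hε
  refine ⟨N, wt, nd, fun ξ hξ => ⟨hnd, fun t ht t₀ ht₀ s hs s₀ hs₀ a b => ?_⟩⟩
  have h := hq ((a, b), ⟨(ξ, t, t₀, s, s₀), hξ, ht, ht₀, hs, hs₀⟩)
  have hint := integrable_neutral_kernelW (hsep ξ hξ) hη ht ht₀ hs hs₀ a b
  have hre : (∫ lam, neutral (kernelW M S d ξ η) t t₀ s s₀ lam a b).re =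
      ∫ lam, (neutral (kernelW M S d ξ η) t t₀ s s₀ lam a b).re :=
    (Complex.reCLM.integral_comp_comm hint).symm
  have hsum : (∑ n, (wt n : ℂ) * neutral (kernelW M S d ξ η) t t₀ s s₀ (nd n) a b).re =
      ∑ n, wt n * (neutral (kernelW M S d ξ η) t t₀ s s₀ (nd n) a b).re := by
    rw [Complex.re_sum]
    exact Finset.sum_congr rfl fun n _ => Complex.re_ofReal_mul _ _
  show |(∑ n, (wt n : ℂ) * neutral (kernelW M S d ξ η) t t₀ s s₀ (nd n) a b).re -
    (∫ lam, neutral (kernelW M S d ξ η) t t₀ s s₀ lam a b).re| ≤ ε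
  rw [hre, hsum]
  exact h

/-! ### The west contribution -/

section

variable {NS : ℕ} {M : ℕ} {S : Finset ℤ} {d ξ η : ℝ}

lemma zero_mem_cell (d ξ η : ℝ) : (0 : ℝ × ℝ) ∈ cell d ξ η :=
  ⟨0, by norm_num, 0, by norm_num, by simp⟩

/-- For neutral charges a term that does not depend on the source may be subtracted. -/
lemma sum_sub_mul_of_neutral {R : Type*} [CommRing R] (A : Fin NS → Fin 2 → R) (B : Fin 2 → R)
    {q : Fin NS → Fin 2 → R} (hq : ∀ b, ∑ j, q j b = 0) :
    ∑ j, ∑ b, (A j b - B b) * q j b = ∑ j, ∑ b, A j b * q j b := by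
  have h : ∑ j, ∑ b, B b * q j b = 0 := by
    rw [Finset.sum_comm]
    exact Finset.sum_eq_zero fun b _ => by rw [← Finset.mul_sum, hq, mul_zero]
  simp only [sub_mul, Finset.sum_sub_distrib, h, sub_zero]

lemma imageField_apply (G : ℝ × ℝ → Matrix (Fin 2) (Fin 2) ℝ) (s : Fin NS → ℝ × ℝ)
    (q : Fin NS → Fin 2 → ℝ) (t : ℝ × ℝ) (i : S × ℕ) (a : Fin 2) :
    imageField G d ξ η s q t (westEquiv M S i) a =
      ∑ j, ∑ b, G (disp M d ξ η t (s j) i) a b * q j b := by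
  simp only [imageField, Finset.sum_apply]
  rfl

/-- Differences of the field of neutral charges are combinations of second differences. -/
lemma imageField_sub_apply (G : ℝ × ℝ → Matrix (Fin 2) (Fin 2) ℝ) (s : Fin NS → ℝ × ℝ)
    {q : Fin NS → Fin 2 → ℝ} (hq : ∑ j, q j = 0) (t t₀ : ℝ × ℝ) (i : S × ℕ) (a : Fin 2) :
    imageField G d ξ η s q t (westEquiv M S i) a - imageField G d ξ η s q t₀ (westEquiv M S i) a =
      ∑ j, ∑ b, dd (fun p => G p a b) (disp M d ξ η t₀ 0 i) (t - t₀) (0 - s j) * q j b := by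
  -- The origin serves as reference source; by neutrality subtracting it costs nothing.
  have h := sum_sub_mul_of_neutral
    (fun j b => G (disp M d ξ η t (s j) i) a b - G (disp M d ξ η t₀ (s j) i) a b)
    (fun b => G (disp M d ξ η t 0 i) a b - G (disp M d ξ η t₀ 0 i) a b) (q := q)
    (fun b => by simpa using congrFun hq b)
  rw [imageField_apply, imageField_apply, ← Finset.sum_sub_distrib]
  simp only [dd_disp, ← Finset.sum_sub_distrib, ← sub_mul]
  rw [← h]
  refine Finset.sum_congr rfl fun j _ => Finset.sum_congr rfl fun b _ => ?_
  ring

/-- The difference of the west contribution at two targets. -/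
def westDiff (M : ℕ) (S : Finset ℤ) (d ξ η : ℝ) (s : Fin NS → ℝ × ℝ) (q : Fin NS → Fin 2 → ℝ)
    (t t₀ : ℝ × ℝ) (a : Fin 2) : ℝ :=
  ∑ j, ∑ b, (∫ lam, neutral (kernelW M S d ξ η) t t₀ (s j) 0 lam a b).re * q j b

/-- For fixed `β` the quadratic decay of the modified Stokeslet suffices, so neutrality plays no
role here. -/
lemma summable_imageField_modStokeslet (hsep : IsSeparated M S d ξ) (hη : 0 < η)
    {s : Fin NS → ℝ × ℝ} (q : Fin NS → Fin 2 → ℝ) (hs : ∀ j, s j ∈ cell d ξ η) {β : ℝ}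
    (hβ : 0 < β) {t : ℝ × ℝ} (ht : t ∈ cell d ξ η) :
    Summable fun w : westOf M S => imageField (modStokeslet β) d ξ η s q t w := by
  rw [← (westEquiv M S).summable_iff, Pi.summable]
  intro a
  simp only [Function.comp_def, imageField_apply]
  refine summable_sum fun j _ => summable_sum fun b _ => Summable.mul_right _ ?_
  refine Summable.of_norm_bounded (summable_finite_prod
    (summable_one_div_succ_sq.mul_left (8 / β ^ 2 / d ^ 2))) fun i => ?_
  have hd := hsep.pos
  refine (abs_modStokeslet_le hβ (X := (i.2 + 1) * d) (by positivity)
    (disp_fst_mem hsep hη ht (hs j) i).1 a b).trans (le_of_eq ?_)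
  field_simp

variable {s : Fin NS → ℝ × ℝ} {q : Fin NS → Fin 2 → ℝ} {t t₀ : ℝ × ℝ}

lemma hasSum_dd_stokeslet_re (hsep : IsSeparated M S d ξ) (hη : 0 < η) {s₁ : ℝ × ℝ}
    (hs : s₁ ∈ cell d ξ η) (ht : t ∈ cell d ξ η) (ht₀ : t₀ ∈ cell d ξ η) (a b : Fin 2) :
    HasSum (fun i : S × ℕ => dd (fun p => stokeslet p a b)
        (disp M d ξ η t₀ 0 i) (t - t₀) (0 - s₁))
      (∫ lam, neutral (kernelW M S d ξ η) t t₀ s₁ 0 lam a b).re := by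
  have h := Complex.hasSum_re (hasSum_dd_stokeslet hsep hη ht ht₀ hs (zero_mem_cell d ξ η) a b)
  simpa only [Complex.ofReal_re] using h

/-- The integral is real because it is a sum of real Stokeslet differences. -/
lemma ofReal_re_integral_neutral (hsep : IsSeparated M S d ξ) (hη : 0 < η) {s₁ : ℝ × ℝ}
    (hs : s₁ ∈ cell d ξ η) (ht : t ∈ cell d ξ η) (ht₀ : t₀ ∈ cell d ξ η) (a b : Fin 2) :
    (((∫ lam, neutral (kernelW M S d ξ η) t t₀ s₁ 0 lam a b).re : ℝ) : ℂ) =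
      ∫ lam, neutral (kernelW M S d ξ η) t t₀ s₁ 0 lam a b :=
  (Complex.hasSum_ofReal.2 (hasSum_dd_stokeslet_re hsep hη hs ht ht₀ a b)).unique
    (hasSum_dd_stokeslet hsep hη ht ht₀ hs (zero_mem_cell d ξ η) a b)

lemma hasSum_imageField_stokeslet_sub (hsep : IsSeparated M S d ξ) (hη : 0 < η)
    (hs : ∀ j, s j ∈ cell d ξ η) (hq : ∑ j, q j = 0) (ht : t ∈ cell d ξ η)
    (ht₀ : t₀ ∈ cell d ξ η) :
    HasSum (fun w : westOf M S => imageField stokeslet d ξ η s q t w -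
      imageField stokeslet d ξ η s q t₀ w) (westDiff M S d ξ η s q t t₀) := by
  rw [← (westEquiv M S).hasSum_iff, Pi.hasSum]
  intro a
  simp only [Function.comp_def, Pi.sub_apply, imageField_sub_apply _ _ hq]
  exact hasSum_sum fun j _ => hasSum_sum fun b _ =>
    (hasSum_dd_stokeslet_re hsep hη (hs j) ht ht₀ a b).mul_right _

/-- Additivity is evident for the lattice sums of Stokeslets and passes to the integrals by
uniqueness of sums. -/
lemma westDiff_eq_sub (hsep : IsSeparated M S d ξ) (hη : 0 < η)
    (hs : ∀ j, s j ∈ cell d ξ η) (hq : ∑ j, q j = 0) (ht : t ∈ cell d ξ η)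
    (ht₀ : t₀ ∈ cell d ξ η) :
    westDiff M S d ξ η s q t t₀ =
      westDiff M S d ξ η s q t 0 - westDiff M S d ξ η s q t₀ 0 := by
  have h := fun {t t₀ : ℝ × ℝ} (ht : t ∈ cell d ξ η) (ht₀ : t₀ ∈ cell d ξ η) =>
    hasSum_imageField_stokeslet_sub (M := M) hsep hη hs hq ht ht₀
  have h0 := zero_mem_cell d ξ η
  have h1 := (h ht h0).sub (h ht₀ h0)
  simp only [sub_sub_sub_cancel_right] at h1
  exact (h ht ht₀).unique h1

/-- Dominated convergence over the cells: each second difference converges, and the `β`-free bound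
of `abs_dd_modStokeslet_le` is summable. For fixed `β` the two lattice sums converge separately and
can be merged. -/
lemma tendsto_tsum_imageField_sub (hsep : IsSeparated M S d ξ) (hη : 0 < η)
    (hs : ∀ j, s j ∈ cell d ξ η) (hq : ∑ j, q j = 0) (ht : t ∈ cell d ξ η)
    (ht₀ : t₀ ∈ cell d ξ η) :
    Tendsto (fun β : ℝ => (∑' w : westOf M S, imageField (modStokeslet β) d ξ η s q t w) -
        ∑' w : westOf M S, imageField (modStokeslet β) d ξ η s q t₀ w)
      (𝓝[>] 0) (𝓝 (westDiff M S d ξ η s q t t₀)) := by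
  rw [tendsto_pi_nhds]
  intro a
  have hd := hsep.pos
  have h0 := zero_mem_cell d ξ η
  have hval : westDiff M S d ξ η s q t t₀ a = ∑' i : S × ℕ, ∑ j, ∑ b,
      dd (fun p => stokeslet p a b) (disp M d ξ η t₀ 0 i) (t - t₀) (0 - s j) * q j b :=
    (hasSum_sum fun j _ => hasSum_sum fun b _ =>
      (hasSum_dd_stokeslet_re hsep hη (hs j) ht ht₀ a b).mul_right _).tsum_eq.symm
  rw [hval]
  have hlim : Tendsto (fun β : ℝ => ∑' i : S × ℕ, ∑ j, ∑ b,
      dd (fun p => modStokeslet β p a b) (disp M d ξ η t₀ 0 i) (t - t₀) (0 - s j) * q j b)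
      (𝓝[>] 0) (𝓝 (∑' i : S × ℕ, ∑ j, ∑ b,
      dd (fun p => stokeslet p a b) (disp M d ξ η t₀ 0 i) (t - t₀) (0 - s j) * q j b)) := by
    refine tendsto_tsum_of_dominated_convergence
      (bound := fun i : S × ℕ => ∑ j, ∑ b, ddConst M d η / d ^ 2 * (1 / ((i.2 : ℝ) + 1) ^ 2) *
        |q j b|) ?_ ?_ ?_
    · exact summable_sum fun j _ => summable_sum fun b _ => Summable.mul_right _
        (summable_finite_prod (summable_one_div_succ_sq.mul_left (ddConst M d η / d ^ 2)))
    · intro i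
      exact tendsto_finsetSum _ fun j _ => tendsto_finsetSum _ fun b _ =>
        (tendsto_dd_modStokeslet (isEast_disp hsep hη ht ht₀ (hs j) h0 i) a b).mul_const _
    · filter_upwards [self_mem_nhdsWithin] with β hβ i
      refine (norm_sum_le _ _).trans (Finset.sum_le_sum fun j _ => (norm_sum_le _ _).trans
        (Finset.sum_le_sum fun b _ => ?_))
      rw [norm_mul, Real.norm_eq_abs, Real.norm_eq_abs]
      refine mul_le_mul_of_nonneg_right ?_ (abs_nonneg _)
      refine (abs_dd_modStokeslet_le (isEast_disp hsep hη ht ht₀ (hs j) h0 i) hβ a b).trans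
        (le_of_eq ?_)
      rw [ddConst]
      field_simp
  refine hlim.congr' ?_
  filter_upwards [self_mem_nhdsWithin] with β hβ
  have hsum := summable_imageField_modStokeslet hsep hη q hs hβ ht
  have hsum₀ := summable_imageField_modStokeslet hsep hη q hs hβ ht₀
  rw [Pi.sub_apply, tsum_apply hsum, tsum_apply hsum₀, ← Summable.tsum_sub (Pi.summable.1 hsum a)
    (Pi.summable.1 hsum₀ a), ← (westEquiv M S).tsum_eq]
  simp only [imageField_sub_apply _ _ hq]

lemma sum_kernel_sub_mulVec_apply (k : ℝ × ℝ → ℝ × ℝ → ℝ → Matrix (Fin 2) (Fin 2) ℂ)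
    (hq : ∑ j, q j = 0) (t t₀ : ℝ × ℝ) (lam : ℝ) (a : Fin 2) :
    (∑ j, (k t (s j) lam - k t₀ (s j) lam) *ᵥ fun b => (q j b : ℂ)) a =
      ∑ j, ∑ b, neutral k t t₀ (s j) 0 lam a b * (q j b : ℂ) := by
  have h := sum_sub_mul_of_neutral (fun j b => k t (s j) lam a b - k t₀ (s j) lam a b)
    (fun b => k t 0 lam a b - k t₀ 0 lam a b) (q := fun j b => (q j b : ℂ))
    (fun b => by
      have : ∑ j, q j b = 0 := by simpa using congrFun hq b
      exact_mod_cast this)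
  have e : (∑ j, (k t (s j) lam - k t₀ (s j) lam) *ᵥ fun b => (q j b : ℂ)) a =
      ∑ j, ∑ b, (k t (s j) lam a b - k t₀ (s j) lam a b) * (q j b : ℂ) := by
    rw [Finset.sum_apply]; rfl
  rw [e, ← h]
  refine Finset.sum_congr rfl fun j _ => Finset.sum_congr rfl fun b _ => ?_
  simp only [neutral, Matrix.sub_apply, Matrix.add_apply]
  ring

lemma integral_sum_kernel_sub (hsep : IsSeparated M S d ξ) (hη : 0 < η)
    (hs : ∀ j, s j ∈ cell d ξ η) (hq : ∑ j, q j = 0) (ht : t ∈ cell d ξ η)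
    (ht₀ : t₀ ∈ cell d ξ η) (a : Fin 2) :
    (Integrable fun lam : ℝ => (∑ j, (kernelW M S d ξ η t (s j) lam -
        kernelW M S d ξ η t₀ (s j) lam) *ᵥ fun b => (q j b : ℂ)) a) ∧
    ∫ lam : ℝ, (∑ j, (kernelW M S d ξ η t (s j) lam - kernelW M S d ξ η t₀ (s j) lam) *ᵥ
        fun b => (q j b : ℂ)) a = (westDiff M S d ξ η s q t t₀ a : ℂ) := by
  have hi : ∀ j b, Integrable fun lam =>
      neutral (kernelW M S d ξ η) t t₀ (s j) 0 lam a b * (q j b : ℂ) := fun j b =>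
    (integrable_neutral_kernelW hsep hη ht ht₀ (hs j) (zero_mem_cell d ξ η) a b).mul_const _
  simp only [sum_kernel_sub_mulVec_apply _ hq]
  refine ⟨integrable_finsetSum _ fun j _ => integrable_finsetSum _ fun b _ => hi j b, ?_⟩
  rw [integral_finsetSum _ fun j _ => integrable_finsetSum _ fun b _ => hi j b, westDiff,
    Complex.ofReal_sum]
  refine Finset.sum_congr rfl fun j _ => ?_
  rw [integral_finsetSum _ fun b _ => hi j b, Complex.ofReal_sum]
  refine Finset.sum_congr rfl fun b _ => ?_
  rw [integral_mul_const, Complex.ofReal_mul, ofReal_re_integral_neutral hsep hη (hs j) ht ht₀]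

/-- The sum of the quadrature rule, applied to the charges. -/
def quadSum {N : ℕ} (k : ℝ × ℝ → ℝ × ℝ → ℝ → Matrix (Fin 2) (Fin 2) ℂ) (s : Fin NS → ℝ × ℝ)
    (q : Fin NS → Fin 2 → ℝ) (wt nd : Fin N → ℝ) (t : ℝ × ℝ) (a : Fin 2) : ℝ :=
  (∑ j, ∑ b, (∑ n, (wt n : ℂ) * k t (s j) (nd n) a b) * (q j b : ℂ)).re

lemma quadSum_sub {N : ℕ} (k : ℝ × ℝ → ℝ × ℝ → ℝ → Matrix (Fin 2) (Fin 2) ℂ)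
    (hq : ∑ j, q j = 0) (wt nd : Fin N → ℝ) (t t₀ : ℝ × ℝ) (a : Fin 2) :
    quadSum k s q wt nd t a - quadSum k s q wt nd t₀ a =
      ∑ j, ∑ b, (∑ n, (wt n : ℂ) * neutral k t t₀ (s j) 0 (nd n) a b).re * q j b := by
  have h := sum_sub_mul_of_neutral (fun j b => (∑ n, (wt n : ℂ) * k t (s j) (nd n) a b) -
      ∑ n, (wt n : ℂ) * k t₀ (s j) (nd n) a b)
    (fun b => (∑ n, (wt n : ℂ) * k t 0 (nd n) a b) - ∑ n, (wt n : ℂ) * k t₀ 0 (nd n) a b)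
    (q := fun j b => (q j b : ℂ))
    (fun b => by
      have : ∑ j, q j b = 0 := by simpa using congrFun hq b
      exact_mod_cast this)
  simp only [sub_mul, Finset.sum_sub_distrib] at h
  rw [quadSum, quadSum, ← Complex.sub_re, ← h]
  simp only [← Finset.sum_sub_distrib, ← sub_mul]
  rw [Complex.re_sum]
  refine Finset.sum_congr rfl fun j _ => ?_
  rw [Complex.re_sum]
  refine Finset.sum_congr rfl fun b _ => ?_
  rw [Complex.re_mul_ofReal]
  congr 2
  simp only [← mul_sub]
  refine Finset.sum_congr rfl fun n _ => ?_
  simp only [neutral, Matrix.sub_apply, Matrix.add_apply]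
  ring

/-- A quadrature rule reproduces differences of the west contribution. -/
lemma abs_quadSum_sub_le {N : ℕ} (hs : ∀ j, s j ∈ cell d ξ η) (hq : ∑ j, q j = 0)
    (ht : t ∈ cell d ξ η) (ht₀ : t₀ ∈ cell d ξ η) {ε : ℝ} {wt nd : Fin N → ℝ}
    (hquad : IsQuadrature (cell d ξ η) (kernelW M S d ξ η) ε wt nd) (a : Fin 2) :
    |quadSum (kernelW M S d ξ η) s q wt nd t a - quadSum (kernelW M S d ξ η) s q wt nd t₀ a -
      westDiff M S d ξ η s q t t₀ a| ≤ ε * ∑ j, ∑ b, |q j b| := by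
  rw [quadSum_sub _ hq, westDiff]
  simp only [← Finset.sum_sub_distrib, ← sub_mul, Finset.mul_sum]
  refine (Finset.abs_sum_le_sum_abs _ _).trans (Finset.sum_le_sum fun j _ =>
    (Finset.abs_sum_le_sum_abs _ _).trans (Finset.sum_le_sum fun b _ => ?_))
  rw [abs_mul]
  exact mul_le_mul_of_nonneg_right
    (hquad.2 t ht t₀ ht₀ (s j) (hs j) 0 (zero_mem_cell d ξ η) a b) (abs_nonneg _)

/-- Existence of the west contribution, its representations and its approximation by quadrature. -/
theorem exists_west_contribution (hsep : IsSeparated M S d ξ) (hη : 0 < η)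
    (hs : ∀ j, s j ∈ cell d ξ η) (hq : ∑ j, q j = 0) :
    ∃ u : ℝ × ℝ → Fin 2 → ℝ, IsImagePotential (westOf M S) d ξ η s q u ∧
      (∀ t ∈ cell d ξ η, ∀ t₀ ∈ cell d ξ η,
        HasSum (fun w : westOf M S => imageField stokeslet d ξ η s q t w -
          imageField stokeslet d ξ η s q t₀ w) (u t - u t₀) ∧
        ∀ a : Fin 2,
          Integrable (fun lam : ℝ => (∑ j, (kernelW M S d ξ η t (s j) lam -
            kernelW M S d ξ η t₀ (s j) lam) *ᵥ fun b => (q j b : ℂ)) a) ∧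
          ∫ lam : ℝ, (∑ j, (kernelW M S d ξ η t (s j) lam - kernelW M S d ξ η t₀ (s j) lam) *ᵥ
            fun b => (q j b : ℂ)) a = ((u t a - u t₀ a : ℝ) : ℂ)) ∧
      ∀ (N : ℕ) (wt nd : Fin N → ℝ) (ε : ℝ),
        IsQuadrature (cell d ξ η) (kernelW M S d ξ η) ε wt nd →
          ∃ c : Fin 2 → ℝ, ∀ t ∈ cell d ξ η, ∀ a,
            |quadSum (kernelW M S d ξ η) s q wt nd t a - (u t a + c a)| ≤
              ε * ∑ j, ∑ b, |q j b| := by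
  have h0 := zero_mem_cell d ξ η
  -- The potential is normalized to vanish at the origin, and `c β` is minus the field of the
  -- modified Stokeslets there.
  refine ⟨fun t => westDiff M S d ξ η s q t 0, ⟨fun β hβ t ht =>
    summable_imageField_modStokeslet hsep hη q hs hβ ht,
    fun β => -∑' w : westOf M S, imageField (modStokeslet β) d ξ η s q 0 w, fun t ht => ?_⟩,
    fun t ht t₀ ht₀ => ?_, fun N wt nd ε hquad => ?_⟩
  · simpa only [sub_eq_add_neg] using tendsto_tsum_imageField_sub (M := M) hsep hη hs hq ht h0
  · rw [← westDiff_eq_sub hsep hη hs hq ht ht₀]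
    refine ⟨hasSum_imageField_stokeslet_sub hsep hη hs hq ht ht₀, fun a => ?_⟩
    rw [← Pi.sub_apply, ← westDiff_eq_sub hsep hη hs hq ht ht₀]
    exact integral_sum_kernel_sub hsep hη hs hq ht ht₀ a
  -- The constant is the value of the rule at the origin; the precision of the rule controls only
  -- the difference from it.
  · refine ⟨fun a => quadSum (kernelW M S d ξ η) s q wt nd 0 a, fun t ht a => ?_⟩
    have h := abs_quadSum_sub_le hs hq ht h0 hquad a
    rwa [sub_sub, add_comm (quadSum _ _ _ _ _ _ _)] at h

end

/-! ### The factorization -/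

section

variable {NS NT N : ℕ}

lemma Lmat_mul_blockDiagonal_mul_Rmat (T : Fin NT → ℝ × ℝ) (s : Fin NS → ℝ × ℝ) (nd : Fin N → ℝ)
    (A : Fin N → Matrix (Fin 2) (Fin 2) ℂ) (l : Fin NT) (j : Fin NS) (a b : Fin 2) :
    (Lmat T nd * Matrix.blockDiagonal A * Rmat s nd) (a, l) (b, j) =
      ∑ n, decay (nd n) ((T l).1 - (s j).1) * osc (nd n) ((T l).2 - (s j).2) * A n a b := by
  simp only [Matrix.mul_apply, Fintype.sum_prod_type_right, Lmat, Rmat, Matrix.kroneckerMap_apply,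
    Matrix.blockDiagonal_apply, Matrix.one_apply, Matrix.of_apply, mul_ite, ite_mul, mul_zero,
    zero_mul, one_mul, Finset.sum_ite_irrel, Finset.sum_ite_eq, Finset.sum_ite_eq', Finset.mem_univ, if_true,
    Finset.sum_const_zero]
  refine Finset.sum_congr rfl fun n _ => ?_
  rw [sub_eq_add_neg, sub_eq_add_neg, decay_add, osc_add]
  ring

lemma Xmat_mul_apply {m : Type*} (T : Fin NT → ℝ × ℝ) (A : Matrix (Fin 2 × Fin NT) m ℂ)
    (a : Fin 2) (l : Fin NT) (k : m) : (Xmat T * A) (a, l) k = ((T l).1 : ℂ) * A (a, l) k := by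
  simp [Matrix.mul_apply, Fintype.sum_prod_type_right, Xmat, Matrix.blockDiagonal_apply,
    Matrix.one_apply]

lemma mul_Xmat_apply {m : Type*} (s : Fin NS → ℝ × ℝ) (A : Matrix m (Fin 2 × Fin NS) ℂ)
    (b : Fin 2) (j : Fin NS) (k : m) : (A * Xmat s) k (b, j) = A k (b, j) * ((s j).1 : ℂ) := by
  simp [Matrix.mul_apply, Fintype.sum_prod_type_right, Xmat, Matrix.blockDiagonal_apply,
    Matrix.one_apply]

/-- The scalings by `x_l` on the left and `x'_j` on the right combine into the factor `x_l - x'_j`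
in front of `B`, which no single block diagonal factor in `n` could produce. -/
lemma factored_apply (T : Fin NT → ℝ × ℝ) (s : Fin NS → ℝ × ℝ) (nd : Fin N → ℝ)
    (A B : Fin N → Matrix (Fin 2) (Fin 2) ℂ) (l : Fin NT) (j : Fin NS) (a b : Fin 2) :
    (Lmat T nd * Matrix.blockDiagonal A * Rmat s nd -
      Xmat T * Lmat T nd * Matrix.blockDiagonal B * Rmat s nd +
      Lmat T nd * Matrix.blockDiagonal B * Rmat s nd * Xmat s) (a, l) (b, j) =
      ∑ n, decay (nd n) ((T l).1 - (s j).1) * osc (nd n) ((T l).2 - (s j).2) *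
        (A n a b - ((T l).1 - (s j).1 : ℂ) * B n a b) := by
  rw [Matrix.add_apply, Matrix.sub_apply, mul_Xmat_apply, Matrix.mul_assoc (Xmat T),
    Matrix.mul_assoc (Xmat T), Xmat_mul_apply]
  simp only [Lmat_mul_blockDiagonal_mul_Rmat, Finset.mul_sum, Finset.sum_mul]
  rw [← Finset.sum_sub_distrib, ← Finset.sum_add_distrib]
  exact Finset.sum_congr rfl fun n _ => by ring

theorem P₁_apply (d : ℝ) (T : Fin NT → ℝ × ℝ) (s : Fin NS → ℝ × ℝ) (wt nd : Fin N → ℝ)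
    (l : Fin NT) (j : Fin NS) (a b : Fin 2) :
    P₁ d T s wt nd (a, l) (b, j) = ∑ n, (wt n : ℂ) * kernel₁ d (T l) (s j) (nd n) a b := by
  rw [P₁, D₁a, D₁b, factored_apply]
  refine Finset.sum_congr rfl fun n _ => ?_
  simp only [kernel₁, Matrix.smul_apply, Matrix.sub_apply, smul_eq_mul]
  push_cast
  ring

lemma sum_Icc_neg_one_one {M : Type*} [AddCommMonoid M] (f : ℤ → M) :
    ∑ n ∈ Finset.Icc (-1 : ℤ) 1, f n = f (-1) + (f 0 + f 1) := by
  rw [show Finset.Icc (-1 : ℤ) 1 = {-1, 0, 1} by decide, Finset.sum_insert (by decide),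
    Finset.sum_insert (by decide), Finset.sum_singleton]

theorem P₂_apply (d ξ η : ℝ) (T : Fin NT → ℝ × ℝ) (s : Fin NS → ℝ × ℝ) (wt nd : Fin N → ℝ)
    (l : Fin NT) (j : Fin NS) (a b : Fin 2) :
    P₂ d ξ η T s wt nd (a, l) (b, j) =
      ∑ n, (wt n : ℂ) * kernel₂ d ξ η (T l) (s j) (nd n) a b := by
  rw [P₂, D₂a, D₂b, factored_apply]
  refine Finset.sum_congr rfl fun n _ => ?_
  simp only [kernel₂, sum_Icc_neg_one_one, Int.cast_neg, Int.cast_one, Int.cast_zero, zero_mul,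
    sub_zero, neg_mul, one_mul, sub_neg_eq_add, shiftW, shiftE, Matrix.smul_apply,
    Matrix.sub_apply, Matrix.add_apply, smul_eq_mul]
  -- The rows `n = -1` and `n = 1` shift the displacement by `±(ξ, η)`, which multiplies the wave by
  -- `shiftW` and `shiftE`.
  rw [decay_add _ _ ξ, osc_add _ _ η, sub_eq_add_neg _ ξ, sub_eq_add_neg _ η,
    decay_add _ _ (-ξ), osc_add _ _ (-η)]
  push_cast
  ring

lemma re_mulVec_stack {k : ℝ × ℝ → ℝ × ℝ → ℝ → Matrix (Fin 2) (Fin 2) ℂ} {T : Fin NT → ℝ × ℝ}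
    {s : Fin NS → ℝ × ℝ} {wt nd : Fin N → ℝ} {P : Matrix (Fin 2 × Fin NT) (Fin 2 × Fin NS) ℂ}
    (hP : ∀ l j a b, P (a, l) (b, j) = ∑ n, (wt n : ℂ) * k (T l) (s j) (nd n) a b)
    (q : Fin NS → Fin 2 → ℝ) (l : Fin NT) (a : Fin 2) :
    ((P *ᵥ stack q) (a, l)).re = quadSum k s q wt nd (T l) a := by
  simp only [Matrix.mulVec, dotProduct, Fintype.sum_prod_type_right, hP, stack, quadSum]

/-! ### The singly and the doubly periodic kernels -/

lemma west₁_eq : west₁ = westOf 2 {0} := by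
  ext w; simp [west₁, westOf]

lemma west₂_eq : west₂ = westOf 4 (Finset.Icc (-1) 1) := by
  ext w; simp [west₂, westOf]

lemma kernel₁_eq (d η : ℝ) : kernel₁ d = kernelW 2 {0} d 0 η := by
  funext t s lam
  simp only [kernel₁, kernelW, Finset.sum_singleton, Int.cast_zero, zero_mul, sub_zero,
    Nat.cast_ofNat, show (2 - 1 : ℂ) = 1 by norm_num, one_mul]

lemma kernel₂_eq (d ξ η : ℝ) : kernel₂ d ξ η = kernelW 4 (Finset.Icc (-1) 1) d ξ η := by
  funext t s lam
  simp only [kernel₂, kernelW, Nat.cast_ofNat, show (4 - 1 : ℂ) = 3 by norm_num]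

lemma isSeparated_single {d : ℝ} (hd : 0 < d) : IsSeparated 2 {0} d 0 where
  pos := hd
  le n hn := by simp

/-- From `|ξ| ≤ d` and `|n| ≤ 1` the two shear terms add up to at most `2 d`, which is `(M - 2) d`
for `M = 4`. -/
lemma isSeparated_double {d ξ η : ℝ} (hd : 0 < d) (h : √(ξ ^ 2 + η ^ 2) ≤ d) :
    IsSeparated 4 (Finset.Icc (-1) 1) d ξ where
  pos := hd
  le n hn := by
    have hξ : |ξ| ≤ d := (Real.abs_le_sqrt (by nlinarith [sq_nonneg η])).trans h
    have hn1 : |(n : ℝ)| ≤ 1 := by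
      rw [← Int.cast_abs]; exact_mod_cast abs_le.2 (Finset.mem_Icc.1 hn)
    have := mul_le_mul_of_nonneg_right hn1 (abs_nonneg ξ)
    rw [abs_mul]
    push_cast
    linarith

/-- Compactness of the set of admissible shears is what allows one rule for all of them. -/
lemma isCompact_setOf_sqrt_le (d η : ℝ) : IsCompact {ξ : ℝ | √(ξ ^ 2 + η ^ 2) ≤ d} :=
  (isCompact_Icc (a := -d) (b := d)).of_isClosed_subset
    (isClosed_le (by fun_prop) continuous_const) fun ξ h =>
      abs_le.1 ((Real.abs_le_sqrt (by nlinarith [sq_nonneg η])).trans h)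

end

end StokesWest

end

/-! ### Specialization to the singly and doubly periodic cases. -/

open StokesWest in
theorem mainTheorem9 (d η : ℝ) (hd : 0 < d) (hη : 0 < η) :
    -- singly periodic case, cell of dimensions `d × η`
    ((∀ ε : ℝ, 0 < ε → ∃ (N : ℕ) (wt nd : Fin N → ℝ),
        IsQuadrature (cell d 0 η) (kernel₁ d) ε wt nd) ∧
      ∀ (NS : ℕ) (s : Fin NS → ℝ × ℝ) (q : Fin NS → Fin 2 → ℝ),
        (∀ j, s j ∈ cell d 0 η) → ∑ j, q j = 0 →
        ∃ u : ℝ × ℝ → Fin 2 → ℝ,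
          IsImagePotential west₁ d 0 η s q u ∧
          (∀ t ∈ cell d 0 η, ∀ t₀ ∈ cell d 0 η,
            HasSum (fun w : west₁ => imageField stokeslet d 0 η s q t w -
              imageField stokeslet d 0 η s q t₀ w) (u t - u t₀) ∧
            ∀ a : Fin 2,
              Integrable (fun lam : ℝ => (∑ j, (kernel₁ d t (s j) lam - kernel₁ d t₀ (s j) lam) *ᵥ
                fun b => (q j b : ℂ)) a) ∧
              ∫ lam : ℝ, (∑ j, (kernel₁ d t (s j) lam - kernel₁ d t₀ (s j) lam) *ᵥ
                fun b => (q j b : ℂ)) a = ((u t a - u t₀ a : ℝ) : ℂ)) ∧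
          ∀ (N : ℕ) (wt nd : Fin N → ℝ),
            ((∀ n, nd n ≠ 0) → ∀ (NT : ℕ) (T : Fin NT → ℝ × ℝ) (l : Fin NT) (j : Fin NS)
              (a b : Fin 2), P₁ d T s wt nd (a, l) (b, j) =
                ∑ n, (wt n : ℂ) * kernel₁ d (T l) (s j) (nd n) a b) ∧
            ∀ ε : ℝ, IsQuadrature (cell d 0 η) (kernel₁ d) ε wt nd →
              ∃ c : Fin 2 → ℝ, ∀ (NT : ℕ) (T : Fin NT → ℝ × ℝ), (∀ l, T l ∈ cell d 0 η) →
                ∀ (l : Fin NT) (a : Fin 2),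
                  |((P₁ d T s wt nd *ᵥ stack q) (a, l)).re - (u (T l) a + c a)| ≤
                    ε * ∑ j, ∑ b, |q j b|) ∧
    -- doubly periodic case, cell spanned by `(d, 0)` and `(ξ, η)`
    ((∀ ε : ℝ, 0 < ε → ∃ (N : ℕ) (wt nd : Fin N → ℝ), ∀ ξ : ℝ, √(ξ ^ 2 + η ^ 2) ≤ d →
        IsQuadrature (cell d ξ η) (kernel₂ d ξ η) ε wt nd) ∧
      ∀ ξ : ℝ, √(ξ ^ 2 + η ^ 2) ≤ d →
      ∀ (NS : ℕ) (s : Fin NS → ℝ × ℝ) (q : Fin NS → Fin 2 → ℝ),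
        (∀ j, s j ∈ cell d ξ η) → ∑ j, q j = 0 →
        ∃ u : ℝ × ℝ → Fin 2 → ℝ,
          IsImagePotential west₂ d ξ η s q u ∧
          (∀ t ∈ cell d ξ η, ∀ t₀ ∈ cell d ξ η,
            HasSum (fun w : west₂ => imageField stokeslet d ξ η s q t w -
              imageField stokeslet d ξ η s q t₀ w) (u t - u t₀) ∧
            ∀ a : Fin 2,
              Integrable (fun lam : ℝ => (∑ j, (kernel₂ d ξ η t (s j) lam -
                kernel₂ d ξ η t₀ (s j) lam) *ᵥ fun b => (q j b : ℂ)) a) ∧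
              ∫ lam : ℝ, (∑ j, (kernel₂ d ξ η t (s j) lam - kernel₂ d ξ η t₀ (s j) lam) *ᵥ
                fun b => (q j b : ℂ)) a = ((u t a - u t₀ a : ℝ) : ℂ)) ∧
          ∀ (N : ℕ) (wt nd : Fin N → ℝ),
            ((∀ n, nd n ≠ 0) → ∀ (NT : ℕ) (T : Fin NT → ℝ × ℝ) (l : Fin NT) (j : Fin NS)
              (a b : Fin 2), P₂ d ξ η T s wt nd (a, l) (b, j) =
                ∑ n, (wt n : ℂ) * kernel₂ d ξ η (T l) (s j) (nd n) a b) ∧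
            ∀ ε : ℝ, IsQuadrature (cell d ξ η) (kernel₂ d ξ η) ε wt nd →
              ∃ c : Fin 2 → ℝ, ∀ (NT : ℕ) (T : Fin NT → ℝ × ℝ), (∀ l, T l ∈ cell d ξ η) →
                ∀ (l : Fin NT) (a : Fin 2),
                  |((P₂ d ξ η T s wt nd *ᵥ stack q) (a, l)).re - (u (T l) a + c a)| ≤
                    ε * ∑ j, ∑ b, |q j b|) := by
  constructor
  · refine ⟨fun ε hε => ?_, fun NS s q hs hq => ?_⟩
    -- The singly periodic case is a single row with the one shear `ξ = 0`.
    · obtain ⟨N, wt, nd, h⟩ := exists_isQuadrature (M := 2) (S := {0}) hη isCompact_singleton hd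
        (fun ξ (hξ : ξ ∈ ({0} : Set ℝ)) => hξ ▸ isSeparated_single hd) hε
      exact ⟨N, wt, nd, kernel₁_eq d η ▸ h 0 rfl⟩
    · obtain ⟨u, hu, hdiff, hquad⟩ := exists_west_contribution (isSeparated_single hd) hη hs hq
      rw [← west₁_eq] at hu hdiff
      rw [← kernel₁_eq] at hdiff hquad
      refine ⟨u, hu, hdiff, fun N wt nd => ⟨fun _ NT T l j a b => P₁_apply d T s wt nd l j a b,
        fun ε hε => ?_⟩⟩
      obtain ⟨c, hc⟩ := hquad N wt nd ε hε
      refine ⟨c, fun NT T hT l a => ?_⟩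
      rw [re_mulVec_stack (P₁_apply d T s wt nd)]
      exact hc (T l) (hT l) a
  · refine ⟨fun ε hε => ?_, fun ξ hξ NS s q hs hq => ?_⟩
    · obtain ⟨N, wt, nd, h⟩ := exists_isQuadrature hη (isCompact_setOf_sqrt_le d η) hd
        (fun ξ hξ => isSeparated_double hd hξ) hε
      exact ⟨N, wt, nd, fun ξ hξ => kernel₂_eq d ξ η ▸ h ξ hξ⟩
    · obtain ⟨u, hu, hdiff, hquad⟩ := exists_west_contribution (isSeparated_double hd hξ) hη hs hq
      rw [← west₂_eq] at hu hdiff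
      rw [← kernel₂_eq] at hdiff hquad
      refine ⟨u, hu, hdiff, fun N wt nd => ⟨fun _ NT T l j a b => P₂_apply d ξ η T s wt nd l j a b,
        fun ε hε => ?_⟩⟩
      obtain ⟨c, hc⟩ := hquad N wt nd ε hε
      refine ⟨c, fun NT T hT l a => ?_⟩
      rw [re_mulVec_stack (P₂_apply d ξ η T s wt nd)]
      exact hc (T l) (hT l) a
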